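/- Let $\mu\in(0,1)$ and $a>0$, let $I_\mu(x)=|x|^{-\mu}$ for $x\in\mathbb{R}\setminus\{0\}$, let $f:\mathbb{R}\to\mathbb{R}$, and let $F(t)=\int_0^t f(s)\,ds$. Assume: - $(f_1)$ $f$ is continuous, and $\lim_{t\to0}\frac{|f(t)|}{|t|^{\kappa}}=0$ for some $\kappa>2-\mu$; - $(f_2)$ $\lim_{|t|\to\infty}\frac{|f(t)|}{e^{\alpha t^2}}=0$ for every $\alpha>\pi$, and $\lim_{|t|\to\infty}\frac{|f(t)|}{e^{\alpha t^2}}=+\infty$ for every $0<\alpha<\pi$; - $(f_3)$ there is a constant $\theta>3-\mu$ such that $0<\theta F(t)\le tf(t)$ for all $t\neq0$; - $(f_5)$ with $\widetilde F(t)=f(t)t-(2-\mu)F(t)$, the function $t\mapsto \widetilde F(t)/|t|^{3-\mu}$ is non-increasing on $(-\infty,0)$ and non-decreasing on $(0,\infty)$. Let $H^{1/2}(\mathbb{R})$ be the space of real functions $u\in L^2(\mathbb{R})$ with $\iint_{\mathbb{R}^2}\frac{|u(x)-u(y)|^2}{|x-y|^2}\,dx\,dy<\infty$, with the norm $\|u\|_{1/2}^2=\|(-\Delta)^{1/4}u\|_2^2+\int_{\mathbb{R}}|u|^2\,dx$,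 where $$\|(-\Delta)^{1/4}u\|_2^2=\frac1{2\pi}\iint_{\mathbb{R}^2}\frac{|u(x)-u(y)|^2}{|x-y|^2}\,dx\,dy .$$ For $u\in H^{1/2}(\mathbb{R})$ put $$J(u)=\tfrac12\|(-\Delta)^{1/4}u\|_2^2-\tfrac12\int_{\mathbb{R}}(I_\mu*F(u))F(u)\,dx,$$ $$P(u)=\|(-\Delta)^{1/4}u\|_2^2+(2-\mu)\int_{\mathbb{R}}(I_\mu*F(u))F(u)\,dx-\int_{\mathbb{R}}(I_\mu*F(u))f(u)u\,dx,$$ and let $S(a)=\{u\in H^{1/2}(\mathbb{R}):\int_{\mathbb{R}}|u|^2dx=a^2\}$, $\mathcal P(a)=\{u\in S(a):P(u)=0\}$, $m(a)=\inf_{u\in\mathcal P(a)}J(u)$, and $T_u=\{v\in H^{1/2}(\mathbb{R}):\int_{\mathbb{R}}uv\,dx=0\}$ for $u\in S(a)$. Then $m(a)$ is a (finite) infimum over a non-empty set, and there exists a sequence $\{u_n\}\subset\mathcal P(a)$ which is a Palais–Smale sequence for $J|_{S(a)}$ at level $m(a)$: $J$ is Fréchet differentiable at each $u_n$, $$J(u_n)\to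 m(a)\qquad\text{and}\qquad \sup\{|\langle J'(u_n),v\rangle| : v\in T_{u_n},\ \|v\|_{1/2}\le1\}\to0\qquad(n\to\infty).$$ -/

import Mathlib

open MeasureTheory Filter Topology Set

noncomputable section

namespace Choquard

/-- The Gagliardo difference quotient `(u(x) - u(y)) / |x - y|` on `ℝ × ℝ`. -/
def quot (u : ℝ → ℝ) (z : ℝ × ℝ) : ℝ := (u z.1 - u z.2) / |z.1 - z.2|

theorem aestronglyMeasurable_quot {u : ℝ → ℝ} (hu : AEStronglyMeasurable u volume) :
    AEStronglyMeasurable (quot u) volume := by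
  have h1 : AEStronglyMeasurable (fun z : ℝ × ℝ => u z.1) volume := hu.comp_fst
  have h2 : AEStronglyMeasurable (fun z : ℝ × ℝ => u z.2) volume := hu.comp_snd
  have h3 : AEStronglyMeasurable (fun z : ℝ × ℝ => |z.1 - z.2|⁻¹) volume :=
    (by fun_prop : Measurable (fun z : ℝ × ℝ => |z.1 - z.2|⁻¹)).aestronglyMeasurable
  simpa [quot, div_eq_mul_inv] using! (h1.sub h2).mul h3

theorem quot_congr {u v : ℝ → ℝ} (h : u =ᵐ[volume] v) : quot u =ᵐ[volume] quot v := by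
  have h1 : (fun z : ℝ × ℝ => u z.1) =ᵐ[volume] fun z => v z.1 :=
    Measure.quasiMeasurePreserving_fst.ae_eq_comp h
  have h2 : (fun z : ℝ × ℝ => u z.2) =ᵐ[volume] fun z => v z.2 :=
    Measure.quasiMeasurePreserving_snd.ae_eq_comp h
  filter_upwards [h1, h2] with z hz1 hz2
  simp only [quot]
  rw [hz1, hz2]

/-- `u` has finite Gagliardo energy: `∬ |u(x) - u(y)|² / |x - y|² dx dy < ∞`
(for measurable `u` the integrand is nonnegative and measurable, so integrability is finiteness). -/
def FiniteGagliardo (u : ℝ → ℝ) : Prop :=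
  Integrable (fun z : ℝ × ℝ => (u z.1 - u z.2) ^ 2 / |z.1 - z.2| ^ 2) volume

theorem finiteGagliardo_iff {u : ℝ → ℝ} (hu : AEStronglyMeasurable u volume) :
    FiniteGagliardo u ↔ MemLp (quot u) 2 volume := by
  rw [memLp_two_iff_integrable_sq (aestronglyMeasurable_quot hu)]
  simp only [FiniteGagliardo, quot, div_pow]

theorem quot_add_ae (u v : Lp ℝ 2 (volume : Measure ℝ)) :
    quot ((u + v : Lp ℝ 2 (volume : Measure ℝ)) : ℝ → ℝ) =ᵐ[volume] quot u + quot v := by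
  refine (quot_congr (Lp.coeFn_add u v)).trans (Eventually.of_forall fun z => ?_)
  simp only [quot, Pi.add_apply]
  ring

theorem quot_smul_ae (c : ℝ) (u : Lp ℝ 2 (volume : Measure ℝ)) :
    quot ((c • u : Lp ℝ 2 (volume : Measure ℝ)) : ℝ → ℝ) =ᵐ[volume] c • quot u := by
  refine (quot_congr (Lp.coeFn_smul c u)).trans (Eventually.of_forall fun z => ?_)
  simp only [quot, Pi.smul_apply, smul_eq_mul]
  ring

/-- The functions of finite Gagliardo energy, as a linear subspace of the real space `L²(ℝ)`. -/
def halfSubmodule : Submodule ℝ (Lp ℝ 2 (volume : Measure ℝ)) where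
  carrier := {u | FiniteGagliardo u}
  zero_mem' := by
    rw [mem_ofPred_eq, finiteGagliardo_iff (Lp.aestronglyMeasurable _)]
    have h := quot_congr (Lp.coeFn_zero ℝ 2 (volume : Measure ℝ))
    refine (memLp_congr_ae (h.trans (Eventually.of_forall fun z => ?_))).2
      (MemLp.zero : MemLp (0 : ℝ × ℝ → ℝ) 2 volume)
    simp [quot]
  add_mem' := by
    intro u v hu hv
    rw [mem_ofPred_eq, finiteGagliardo_iff (Lp.aestronglyMeasurable _)] at *
    exact (memLp_congr_ae (quot_add_ae u v)).2 (hu.add hv)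
  smul_mem' := by
    intro c u hu
    rw [mem_ofPred_eq, finiteGagliardo_iff (Lp.aestronglyMeasurable _)] at *
    exact (memLp_congr_ae (quot_smul_ae c u)).2 (hu.const_smul c)

/-- The fractional Sobolev space `H^{1/2}(ℝ)` of real functions. It is a type of its own, so that
it carries the norm of `H^{1/2}(ℝ)` below and not the norm of `L²(ℝ)`. -/
def HHalf : Type := ↥halfSubmodule

namespace HHalf

instance : AddCommGroup HHalf := inferInstanceAs (AddCommGroup ↥halfSubmodule)

instance : Module ℝ HHalf := inferInstanceAs (Module ℝ ↥halfSubmodule)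

/-- The underlying element of `L²(ℝ)`. -/
def toL2 (u : HHalf) : Lp ℝ 2 (volume : Measure ℝ) := Subtype.val (p := (· ∈ halfSubmodule)) u

/-- An element of `H^{1/2}(ℝ)` as a function (a representative of its a.e. class). -/
instance : CoeFun HHalf (fun _ => ℝ → ℝ) := ⟨fun u => (u.toL2 : ℝ → ℝ)⟩

theorem memLp (u : HHalf) : MemLp u 2 volume := Lp.memLp u.toL2

theorem memLp_quot (u : HHalf) : MemLp (quot u) 2 volume :=
  (finiteGagliardo_iff (Lp.aestronglyMeasurable _)).1 (Subtype.property u)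

theorem coe_add (u v : HHalf) : ⇑(u + v).toL2 =ᵐ[volume] ⇑u.toL2 + ⇑v.toL2 :=
  Lp.coeFn_add u.toL2 v.toL2

theorem coe_smul (c : ℝ) (u : HHalf) : ⇑(c • u).toL2 =ᵐ[volume] c • ⇑u.toL2 :=
  Lp.coeFn_smul c u.toL2

theorem coe_zero : ⇑(0 : HHalf).toL2 =ᵐ[volume] 0 := Lp.coeFn_zero ℝ 2 volume

theorem integrable_mul (u v : HHalf) : Integrable (fun x => u x * v x) volume :=
  (memLp u).integrable_mul (memLp v)

theorem integrable_quot_mul (u v : HHalf) :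
    Integrable (fun z => quot u z * quot v z) volume :=
  (memLp_quot u).integrable_mul (memLp_quot v)

/-- The bilinear form
`(1/2π) ∬ (u(x) - u(y)) (v(x) - v(y)) / |x - y|² dx dy`. -/
def gagliardoForm (u v : HHalf) : ℝ :=
  1 / (2 * Real.pi) *
    ∫ z : ℝ × ℝ, (u z.1 - u z.2) * (v z.1 - v z.2) / |z.1 - z.2| ^ 2

theorem gagliardoForm_eq (u v : HHalf) :
    gagliardoForm u v = 1 / (2 * Real.pi) * ∫ z : ℝ × ℝ, quot u z * quot v z := by
  unfold gagliardoForm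
  congr 2
  funext z
  simp only [quot]
  rw [div_mul_div_comm, sq]

theorem gagliardoForm_add (u v w : HHalf) :
    gagliardoForm (u + v) w = gagliardoForm u w + gagliardoForm v w := by
  simp only [gagliardoForm_eq]
  rw [← mul_add, ← integral_add (integrable_quot_mul u w) (integrable_quot_mul v w)]
  congr 1
  refine integral_congr_ae ?_
  filter_upwards [quot_add_ae u.toL2 v.toL2] with z hz
  have hz' : quot (u + v).toL2 z = quot u.toL2 z + quot v.toL2 z := hz
  rw [hz', add_mul]

theorem gagliardoForm_smul (c : ℝ) (u w : HHalf) :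
    gagliardoForm (c • u) w = c * gagliardoForm u w := by
  simp only [gagliardoForm_eq]
  rw [mul_left_comm c, ← integral_const_mul c]
  congr 1
  refine integral_congr_ae ?_
  filter_upwards [quot_smul_ae c u.toL2] with z hz
  have hz' : quot (c • u).toL2 z = c * quot u.toL2 z := hz
  rw [hz', mul_assoc]

theorem gagliardoForm_self_nonneg (u : HHalf) : 0 ≤ gagliardoForm u u := by
  rw [gagliardoForm_eq]
  exact mul_nonneg (by positivity) (integral_nonneg fun z => mul_self_nonneg _)

theorem integral_add_mul (u v w : HHalf) :
    ∫ x, (u + v) x * w x = (∫ x, u x * w x) + ∫ x, v x * w x := by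
  rw [← integral_add (integrable_mul u w) (integrable_mul v w)]
  refine integral_congr_ae ?_
  filter_upwards [coe_add u v] with x hx
  rw [hx, Pi.add_apply, add_mul]

theorem integral_smul_mul (c : ℝ) (u w : HHalf) :
    ∫ x, (c • u) x * w x = c * ∫ x, u x * w x := by
  rw [← integral_const_mul]
  refine integral_congr_ae ?_
  filter_upwards [coe_smul c u] with x hx
  rw [hx, Pi.smul_apply, smul_eq_mul, mul_assoc]

/-- The inner product of `H^{1/2}(ℝ)`; the associated norm is
`‖u‖² = (1/2π) ∬ |u(x) - u(y)|² / |x - y|² dx dy + ∫ |u|² dx`. -/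
@[reducible]
def innerCore : InnerProductSpace.Core ℝ HHalf where
  inner u v := gagliardoForm u v + ∫ x, u x * v x
  conj_inner_symm u v := by
    simp only [conj_trivial, gagliardoForm, mul_comm]
  re_inner_nonneg u := by
    simp only [RCLike.re_to_real]
    exact add_nonneg (gagliardoForm_self_nonneg u) (integral_nonneg fun x => mul_self_nonneg _)
  add_left u v w := by
    rw [gagliardoForm_add, integral_add_mul]
    ring
  smul_left u v c := by
    rw [gagliardoForm_smul, integral_smul_mul]
    simp only [conj_trivial]
    ring
  definite u hu := by
    have h1 := gagliardoForm_self_nonneg u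
    have h2 : 0 ≤ ∫ x, u x * u x := integral_nonneg fun x => mul_self_nonneg _
    have h3 : ∫ x, u x * u x = 0 := by linarith
    rw [integral_eq_zero_iff_of_nonneg (fun x => mul_self_nonneg _) (integrable_mul u u)] at h3
    have h4 : u.toL2 = 0 := by
      refine Lp.ext ((?_ : ⇑u.toL2 =ᵐ[volume] 0).trans (Lp.coeFn_zero ℝ 2 volume).symm)
      filter_upwards [h3] with x hx
      exact mul_self_eq_zero.1 hx
    exact Subtype.ext h4

instance : NormedAddCommGroup HHalf := innerCore.toNormedAddCommGroup

instance : InnerProductSpace ℝ HHalf := InnerProductSpace.ofCore innerCore.toCore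

/-- `‖(-Δ)^{1/4} u‖₂² = (1/2π) ∬ |u(x) - u(y)|² / |x - y|² dx dy`. -/
def kinetic (u : HHalf) : ℝ :=
  1 / (2 * Real.pi) * ∫ z : ℝ × ℝ, (u z.1 - u z.2) ^ 2 / |z.1 - z.2| ^ 2

theorem norm_sq_eq (u : HHalf) : ‖u‖ ^ 2 = kinetic u + ∫ x, u x ^ 2 := by
  rw [← real_inner_self_eq_norm_sq]
  change gagliardoForm u u + ∫ x, u x * u x = _
  simp only [gagliardoForm, kinetic, sq]

end HHalf

/-- The primitive `F(t) = ∫₀ᵗ f(s) ds`. -/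
def prim (f : ℝ → ℝ) (t : ℝ) : ℝ := ∫ s in (0 : ℝ)..t, f s

/-- The convolution `(I_μ * g)(x) = ∫ g(y) / |x - y|^μ dy` with `I_μ(x) = 1 / |x|^μ`. -/
def riesz (μ : ℝ) (g : ℝ → ℝ) (x : ℝ) : ℝ := ∫ y, 1 / |x - y| ^ μ * g y

/-- The energy `J(u) = ½ ‖(-Δ)^{1/4} u‖₂² - ½ ∫ (I_μ * F(u)) F(u) dx` on `H^{1/2}(ℝ)`. -/
def energy (μ : ℝ) (f : ℝ → ℝ) (u : HHalf) : ℝ :=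
  1 / 2 * u.kinetic -
    1 / 2 * ∫ x, riesz μ (fun y => prim f (u y)) x * prim f (u x)

/-- The Pohozaev functional
`P(u) = ‖(-Δ)^{1/4} u‖₂² + (2 - μ) ∫ (I_μ * F(u)) F(u) dx - ∫ (I_μ * F(u)) f(u) u dx`. -/
def pohozaev (μ : ℝ) (f : ℝ → ℝ) (u : HHalf) : ℝ :=
  u.kinetic
    + (2 - μ) * (∫ x, riesz μ (fun y => prim f (u y)) x * prim f (u x))
    - ∫ x, riesz μ (fun y => prim f (u y)) x * (f (u x) * u x)

/-- The sphere `S(a) = {u ∈ H^{1/2}(ℝ) : ∫ |u|² dx = a²}`. -/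
def sphere (a : ℝ) : Set HHalf := {u | ∫ x, u x ^ 2 = a ^ 2}

/-- The Pohozaev manifold `P(a) = {u ∈ S(a) : P(u) = 0}`. -/
def pohozaevManifold (μ : ℝ) (f : ℝ → ℝ) (a : ℝ) : Set HHalf :=
  {u | u ∈ sphere a ∧ pohozaev μ f u = 0}

/-- The level `m(a) = inf_{P(a)} J`. -/
def groundLevel (μ : ℝ) (f : ℝ → ℝ) (a : ℝ) : ℝ :=
  sInf (energy μ f '' pohozaevManifold μ f a)

/-- The tangent space at `u` of the sphere through `u`: `T_u = {v ∈ H^{1/2}(ℝ) : ∫ u v dx = 0}`. -/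
def tangentSpace (u : HHalf) : Submodule ℝ HHalf where
  carrier := {v | ∫ x, v x * u x = 0}
  zero_mem' := by
    have h := HHalf.integral_smul_mul 0 0 u
    simpa using! h
  add_mem' := by
    intro v w hv hw
    rw [mem_ofPred_eq] at *
    rw [HHalf.integral_add_mul, hv, hw, add_zero]
  smul_mem' := by
    intro c v hv
    rw [mem_ofPred_eq] at *
    rw [HHalf.integral_smul_mul, hv, mul_zero]

/-- `u` is a Palais–Smale sequence at level `c` for the restriction of `Φ` to `S(a)`: it lies in
`S(a)`, `Φ(u_n) → c`, and the derivative of `Φ|_{S(a)}` at `u_n`, which is the Fréchet derivative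
`Φ'(u_n)` (required to exist) restricted to `T_{u_n}`, tends to `0` in the dual norm. -/
def IsPalaisSmaleOnSphere (Φ : HHalf → ℝ) (a c : ℝ) (u : ℕ → HHalf) : Prop :=
  (∀ n, u n ∈ sphere a) ∧
  (∀ n, DifferentiableAt ℝ Φ (u n)) ∧
  Tendsto (fun n => Φ (u n)) atTop (𝓝 c) ∧
  Tendsto (fun n => ‖(fderiv ℝ Φ (u n)).comp (tangentSpace (u n)).subtypeL‖) atTop (𝓝 0)

end Choquard

end

noncomputable section

namespace Choquard

/-! The dilations x ↦ τ u(τ² x), τ > 0, keep the L² norm. Along them the energy E(τ, u) has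
τ-derivative τ (K − g(τ)), where K is the kinetic term of u and g (`fibre`) is the rescaled nonlocal
part of P. For 0 < s ≤ 1 the superlinearity condition gives F(st) ≤ s^θ F(t), and the monotonicity
condition gives the same scaling with exponent 3 − μ for f(t)t − (2 − μ)F(t). Together they yield
g(sσ) ≤ s^(θ−(3−μ)) g(σ) (`fibre_mul_le`), so for u ≠ 0 the function g increases strictly from 0 to
∞. Each fibre therefore meets the Pohozaev manifold exactly once, at a parameter T(u), and there the
energy is maximal over the fibre. Hence m(a) is the infimum over the whole sphere of M(u) = max E(·,
u).

Ekeland's principle on the complete space S(a) supplies almost minimal points v of M that are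
ε-stationary in the metric sense. Differentiability of M is not needed: M(z) = E(T(z), z) and M(v) ≥
E(T(z), v), so an increment of M is at most an increment of E in its second variable alone. Since T
is continuous and E is strictly differentiable, this gives −ε‖ψ‖ ≤ ∂E/∂u (T(v), v) ψ for tangential
ψ (`neg_mul_norm_le_of_almost_min`), and −ψ gives the opposite bound. Because E(τ, ·) is J composed
with a linear dilation, the estimate passes to the point of the manifold on the fibre of v, at the
cost of the factor √(1 + τ⁻²). That factor stays bounded because K is bounded below on the manifold
(`exists_kinetic_lower_bound`) and is controlled from above by the energy (`kinetic_le_energy`).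

The analysis rests on three facts: u² exp(αu²) is integrable for every u in H^{1/2} and every α ≥ 0
(`integrable_sq_mul_exp`); convergent sequences have subsequences dominated by an element of H^{1/2}
(`exists_subseq_dominated`); and Riesz potentials of functions in L¹ ∩ L^q, q = 2/(1 − μ), are
bounded. They make the Choquard term strictly differentiable by dominated convergence. -/

/-! ### Dyadic averages and exponential integrability. -/

theorem sq_integral_le_mul_integral_sq {α : Type*} [MeasurableSpace α] {ν : Measure α}
    [IsFiniteMeasure ν] {g : α → ℝ} (hg : MemLp g 2 ν) :
    (∫ x, g x ∂ν) ^ 2 ≤ ν.real univ * ∫ x, g x ^ 2 ∂ν := by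
  have h1 : Integrable g ν := hg.integrable (by norm_num)
  have h2 : Integrable (fun x => g x ^ 2) ν := hg.integrable_sq
  have key : ∀ c : ℝ, 0 ≤ (∫ x, g x ^ 2 ∂ν) - 2 * c * (∫ x, g x ∂ν) + c ^ 2 * ν.real univ := by
    intro c
    have h : 0 ≤ ∫ x, (g x - c) ^ 2 ∂ν := integral_nonneg fun x => sq_nonneg _
    have e : ∫ x, (g x - c) ^ 2 ∂ν
        = (∫ x, g x ^ 2 ∂ν) - 2 * c * (∫ x, g x ∂ν) + c ^ 2 * ν.real univ := by
      have : (fun x => (g x - c) ^ 2) = fun x => (g x ^ 2 - 2 * c * g x) + c ^ 2 := by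
        funext x; ring
      rw [this, integral_add (show Integrable (fun x => g x ^ 2 - 2 * c * g x) ν from
          h2.sub (h1.const_mul _)) (integrable_const _),
        integral_sub h2 (h1.const_mul _), integral_const_mul, integral_const]
      simp [mul_comm]
    linarith
  set S := ∫ x, g x ∂ν
  set Q := ∫ x, g x ^ 2 ∂ν
  have hm : 0 ≤ ν.real univ := measureReal_nonneg
  rcases hm.eq_or_lt with h0 | h0
  · have : S = 0 := by
      have hν : ν = 0 := by
        rw [eq_comm, measureReal_eq_zero_iff] at h0
        exact Measure.measure_univ_eq_zero.1 h0
      simp [S, hν]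
    rw [this, ← h0]; simp
  · have h := key (S / ν.real univ)
    have : Q - 2 * (S / ν.real univ) * S + (S / ν.real univ) ^ 2 * ν.real univ
        = Q - S ^ 2 / ν.real univ := by
      field_simp; ring
    rw [this, sub_nonneg, div_le_iff₀ h0] at h
    linarith

/-- The average of `u` over `(x, x + r]`. -/
def runAvg (u : ℝ → ℝ) (r x : ℝ) : ℝ := r⁻¹ * ∫ y in Ioc x (x + r), u y

theorem sub_sq_eq_quot (u : ℝ → ℝ) (x y : ℝ) : (u x - u y) ^ 2 = (x - y) ^ 2 * quot u (x, y) ^ 2 := by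
  rcases eq_or_ne x y with rfl | h
  · simp
  · have : |x - y| ≠ 0 := abs_ne_zero.2 (sub_ne_zero.2 h)
    rw [← sq_abs (x - y), quot, div_pow]
    field_simp

/-- Cauchy–Schwarz on the interval of length r, where |x − y| ≤ r turns (u(x) − u(y))² into at most
r² times the squared quotient. -/
theorem sub_runAvg_sq_le {u : ℝ → ℝ} (hu : MemLp u 2 volume) {r : ℝ} (hr : 0 < r) {x : ℝ}
    (hq : Integrable (fun y => quot u (x, y) ^ 2)) :
    (u x - runAvg u r x) ^ 2 ≤ r * ∫ y, quot u (x, y) ^ 2 := by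
  have hI : MemLp u 2 (volume.restrict (Ioc x (x + r))) := hu.restrict _
  have hc : MemLp (fun y => u x - u y) 2 (volume.restrict (Ioc x (x + r))) :=
    (memLp_const (u x)).sub hI
  have hvol : (volume.restrict (Ioc x (x + r))).real univ = r := by
    simp [measureReal_def, hr.le]
  have e : u x - runAvg u r x = r⁻¹ * ∫ y in Ioc x (x + r), (u x - u y) := by
    rw [integral_sub (integrable_const _) (hI.integrable (by norm_num)), integral_const, hvol,
      runAvg, smul_eq_mul]
    field_simp
  have h1 := sq_integral_le_mul_integral_sq hc
  rw [hvol] at h1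
  have h2 : ∫ y in Ioc x (x + r), (u x - u y) ^ 2 ≤ r ^ 2 * ∫ y, quot u (x, y) ^ 2 := by
    calc ∫ y in Ioc x (x + r), (u x - u y) ^ 2
        ≤ ∫ y in Ioc x (x + r), r ^ 2 * quot u (x, y) ^ 2 := by
          refine setIntegral_mono_on hc.integrable_sq (hq.const_mul _).integrableOn
            measurableSet_Ioc fun y hy => ?_
          rw [sub_sq_eq_quot]
          refine mul_le_mul_of_nonneg_right ?_ (sq_nonneg _)
          nlinarith [hy.1, hy.2]
      _ = r ^ 2 * ∫ y in Ioc x (x + r), quot u (x, y) ^ 2 := integral_const_mul _ _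
      _ ≤ _ := by
          refine mul_le_mul_of_nonneg_left ?_ (sq_nonneg _)
          exact setIntegral_le_integral hq (Eventually.of_forall fun y => sq_nonneg _)
  rw [e, mul_pow]
  calc r⁻¹ ^ 2 * (∫ y in Ioc x (x + r), (u x - u y)) ^ 2
      ≤ r⁻¹ ^ 2 * (r * (r ^ 2 * ∫ y, quot u (x, y) ^ 2)) := by gcongr; exact h1.trans (by gcongr)
    _ = r * ∫ y, quot u (x, y) ^ 2 := by field_simp

theorem runAvg_sq_le {u : ℝ → ℝ} (hu : MemLp u 2 volume) {r : ℝ} (hr : 0 < r) (x : ℝ) :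
    runAvg u r x ^ 2 ≤ r⁻¹ * ∫ y, u y ^ 2 := by
  have hI : MemLp u 2 (volume.restrict (Ioc x (x + r))) := hu.restrict _
  have hvol : (volume.restrict (Ioc x (x + r))).real univ = r := by
    simp [measureReal_def, hr.le]
  have h1 := sq_integral_le_mul_integral_sq hI
  rw [hvol] at h1
  have h2 : ∫ y in Ioc x (x + r), u y ^ 2 ≤ ∫ y, u y ^ 2 :=
    setIntegral_le_integral hu.integrable_sq (Eventually.of_forall fun y => sq_nonneg _)
  rw [runAvg, mul_pow]
  calc r⁻¹ ^ 2 * (∫ y in Ioc x (x + r), u y) ^ 2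
      ≤ r⁻¹ ^ 2 * (r * ∫ y, u y ^ 2) := by gcongr; exact h1.trans (by gcongr)
    _ = r⁻¹ * ∫ y, u y ^ 2 := by field_simp

/-- The difference of the averages over (x, x+ρ] and (x, x+2ρ] is half the difference of the
averages over the two halves, that is, a double integral of u(y) − u(z) over a rectangle.
Cauchy–Schwarz and |y − z| ≤ 2ρ give a bound in which all powers of ρ cancel: the Gagliardo energy
is scale invariant in dimension one. -/
theorem runAvg_double_sub_sq_le {u : ℝ → ℝ} (hu : MemLp u 2 volume)
    (hq : MemLp (quot u) 2 volume) {ρ : ℝ} (hρ : 0 < ρ) (x : ℝ) :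
    (runAvg u ρ x - runAvg u (2 * ρ) x) ^ 2 ≤
      ∫ z in Ioc x (x + ρ) ×ˢ Ioc (x + ρ) (x + 2 * ρ), quot u z ^ 2 := by
  set I := Ioc x (x + ρ)
  set I' := Ioc (x + ρ) (x + 2 * ρ)
  have hI : MemLp u 2 (volume.restrict I) := hu.restrict _
  have hI' : MemLp u 2 (volume.restrict I') := hu.restrict _
  have hvI : (volume.restrict I).real univ = ρ := by simp [I, measureReal_def, hρ.le]
  have hvI' : (volume.restrict I').real univ = ρ := by
    simp only [I', measureReal_def, Measure.restrict_apply_univ, Real.volume_Ioc]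
    rw [ENNReal.toReal_ofReal (by linarith)]; ring
  have hvI2 : ((volume.restrict I).prod (volume.restrict I')).real univ = ρ ^ 2 := by
    rw [← univ_prod_univ, measureReal_prod_prod, hvI, hvI', sq]
  have hres : (volume.restrict I).prod (volume.restrict I')
      = (volume : Measure (ℝ × ℝ)).restrict (I ×ˢ I') := by
    rw [Measure.prod_restrict]; rfl
  have hunion : ∫ y in Ioc x (x + 2 * ρ), u y = (∫ y in I, u y) + ∫ y in I', u y := by
    have : Ioc x (x + 2 * ρ) = I ∪ I' := (Ioc_union_Ioc_eq_Ioc (by linarith) (by linarith)).symm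
    rw [this, setIntegral_union (Ioc_disjoint_Ioc_of_le le_rfl) measurableSet_Ioc
      (hI.integrable (by norm_num)) (hI'.integrable (by norm_num))]
  have hm1 : MemLp (fun z : ℝ × ℝ => u z.1) 2 ((volume.restrict I).prod (volume.restrict I')) :=
    hI.comp_fst _
  have hm2 : MemLp (fun z : ℝ × ℝ => u z.2) 2 ((volume.restrict I).prod (volume.restrict I')) :=
    hI'.comp_snd _
  have hm := hm1.sub hm2
  have e : runAvg u ρ x - runAvg u (2 * ρ) x = (2 * ρ ^ 2)⁻¹ *
      ∫ z, (u z.1 - u z.2) ∂((volume.restrict I).prod (volume.restrict I')) := by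
    rw [integral_sub (hm1.integrable (by norm_num)) (hm2.integrable (by norm_num)),
      integral_fun_fst, integral_fun_snd, hvI, hvI', runAvg, runAvg, hunion]
    simp only [smul_eq_mul]
    change ρ⁻¹ * (∫ y in I, u y) - _ = _
    field_simp
    ring
  have h1 := sq_integral_le_mul_integral_sq hm
  simp only [Pi.sub_apply] at h1
  rw [hvI2] at h1
  have hqi : Integrable (fun z => quot u z ^ 2) := hq.integrable_sq
  have h2 : ∫ z, (u z.1 - u z.2) ^ 2 ∂((volume.restrict I).prod (volume.restrict I'))
      ≤ (2 * ρ) ^ 2 * ∫ z in I ×ˢ I', quot u z ^ 2 := by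
    have hsq := hm.integrable_sq
    rw [hres] at hsq ⊢
    rw [← integral_const_mul]
    refine setIntegral_mono_on hsq (hqi.const_mul _).integrableOn
      (measurableSet_Ioc.prod measurableSet_Ioc) fun z hz => ?_
    have := sub_sq_eq_quot u z.1 z.2
    rw [this]
    refine mul_le_mul_of_nonneg_right ?_ (sq_nonneg _)
    have h1 := hz.1.1; have h2 := hz.1.2; have h3 := hz.2.1; have h4 := hz.2.2
    nlinarith
  rw [e, mul_pow]
  calc (2 * ρ ^ 2)⁻¹ ^ 2 * (∫ z, (u z.1 - u z.2) ∂((volume.restrict I).prod (volume.restrict I'))) ^ 2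
      ≤ (2 * ρ ^ 2)⁻¹ ^ 2 * (ρ ^ 2 * ((2 * ρ) ^ 2 * ∫ z in I ×ˢ I', quot u z ^ 2)) := by
        gcongr; exact h1.trans (by gcongr)
    _ = ∫ z in I ×ˢ I', quot u z ^ 2 := by field_simp

/-- The set of pairs of points at distance less than `R`. -/
def nearDiagonal (R : ℝ) : Set (ℝ × ℝ) := {z | |z.1 - z.2| < R}

theorem measurableSet_nearDiagonal (R : ℝ) : MeasurableSet (nearDiagonal R) :=
  measurableSet_lt (by fun_prop) measurable_const

/-- The rectangles attached to the successive halvings are pairwise disjoint and lie near the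
diagonal, so their energies add up to at most the near-diagonal energy. Cauchy–Schwarz over n
telescoping steps then costs √n rather than n, which is what makes an exponential of a square
integrable. -/
theorem abs_runAvg_dyadic_le {u : ℝ → ℝ} (hu : MemLp u 2 volume)
    (hq : MemLp (quot u) 2 volume) {R : ℝ} (hR : 0 < R) (x : ℝ) (n : ℕ) :
    |runAvg u (R / 2 ^ n) x| ≤
      |runAvg u R x| + √n * √(∫ z in nearDiagonal R, quot u z ^ 2) := by
  have hqi : Integrable (fun z => quot u z ^ 2) := hq.integrable_sq
  set S : ℕ → Set (ℝ × ℝ) := fun j =>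
    Ioc x (x + R / 2 ^ (j + 1)) ×ˢ Ioc (x + R / 2 ^ (j + 1)) (x + 2 * (R / 2 ^ (j + 1)))
  set e : ℕ → ℝ := fun j => ∫ z in S j, quot u z ^ 2
  have hhalf : ∀ j : ℕ, 2 * (R / 2 ^ (j + 1)) = R / 2 ^ j := fun j => by
    rw [pow_succ]; field_simp
  have hstep : ∀ j, |runAvg u (R / 2 ^ (j + 1)) x - runAvg u (R / 2 ^ j) x| ≤ √(e j) := by
    intro j
    refine Real.abs_le_sqrt ?_
    have := runAvg_double_sub_sq_le hu hq (ρ := R / 2 ^ (j + 1)) (by positivity) x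
    rw [← hhalf j]
    exact this
  have hmS : ∀ j, MeasurableSet (S j) := fun j => measurableSet_Ioc.prod measurableSet_Ioc
  have hmono : ∀ i j : ℕ, i < j → 2 * (R / 2 ^ (j + 1)) ≤ R / 2 ^ (i + 1) := by
    intro i j hij
    rw [hhalf j]
    exact div_le_div_of_nonneg_left hR.le (by positivity)
      (pow_le_pow_right₀ (by norm_num) hij)
  have hdisj : Pairwise (Function.onFun Disjoint S) := by
    intro i j hij
    rw [Function.onFun, Set.disjoint_left]
    intro z hz hz'
    rcases lt_or_gt_of_ne hij with h | h
    · have := hmono i j h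
      have h1 := hz.2.1; have h2 := hz'.2.2
      linarith
    · have := hmono j i h
      have h1 := hz'.2.1; have h2 := hz.2.2
      linarith
  have hsub : ∀ j, S j ⊆ nearDiagonal R := by
    intro j z hz
    have h1 := hz.1.1; have h2 := hz.1.2; have h3 := hz.2.1; have h4 := hz.2.2
    have h5 : R / 2 ^ j ≤ R := div_le_self hR.le (one_le_pow₀ (by norm_num))
    rw [hhalf j] at h4
    change |z.1 - z.2| < R
    rw [abs_lt]; constructor <;> linarith
  have hsum : ∑ j ∈ Finset.range n, e j ≤ ∫ z in nearDiagonal R, quot u z ^ 2 := by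
    have := integral_biUnion_finset (f := fun z => quot u z ^ 2) (μ := volume) (Finset.range n)
      (fun j _ => hmS j) (fun i _ j _ hij => hdisj hij) (fun j _ => hqi.integrableOn)
    rw [← this]
    refine setIntegral_mono_set hqi.integrableOn (Eventually.of_forall fun z => sq_nonneg _) ?_
    exact (iUnion₂_subset fun j _ => hsub j).eventuallyLE
  have htel : |runAvg u (R / 2 ^ n) x| ≤ |runAvg u R x| + ∑ j ∈ Finset.range n, √(e j) := by
    induction n with
    | zero => simp
    | succ n ih =>
      rw [Finset.sum_range_succ]
      have h1 := hstep n
      have h2 := abs_add_le (runAvg u (R / 2 ^ (n + 1)) x - runAvg u (R / 2 ^ n) x)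
        (runAvg u (R / 2 ^ n) x)
      rw [sub_add_cancel] at h2
      have h3 := ih ((Finset.sum_le_sum_of_subset_of_nonneg
        (Finset.range_mono (Nat.le_succ n)) fun j _ _ =>
          integral_nonneg fun z => sq_nonneg _).trans hsum)
      linarith
  have he : ∀ j, 0 ≤ e j := fun j => integral_nonneg fun z => sq_nonneg _
  have hcs : ∑ j ∈ Finset.range n, √(e j) ≤ √n * √(∫ z in nearDiagonal R, quot u z ^ 2) := by
    rw [← Real.sqrt_mul (Nat.cast_nonneg _)]
    refine Real.le_sqrt_of_sq_le ?_
    have := sq_sum_le_card_mul_sum_sq (s := Finset.range n) (f := fun j => √(e j))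
    simp only [Finset.card_range, Real.sq_sqrt (he _)] at this
    exact this.trans (by gcongr)
  linarith

/-- Either |v| ≤ 2M and the exponential is bounded, or the scale n is chosen so that A n is still at
most |v|/2. Then v² is at most a constant times 2^(−n) q while exp(αv²) is at most a constant times
2^n, and the powers of 2 cancel. -/
theorem sq_mul_exp_le_of_approx {v M ε α R q : ℝ} {A : ℕ → ℝ} (hM : 0 ≤ M) (hε : 0 < ε)
    (hα : 0 ≤ α) (hR : 0 ≤ R) (hq : 0 ≤ q) (hA : ∀ n : ℕ, |A n| ≤ M + √n * ε)
    (hvA : ∀ n : ℕ, (v - A n) ^ 2 ≤ R / 2 ^ n * q) (hsmall : 8 * α * ε ^ 2 ≤ Real.log 2) :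
    v ^ 2 * Real.exp (α * v ^ 2) ≤
      Real.exp (4 * α * M ^ 2) * v ^ 2 + 8 * R * Real.exp (8 * α * M ^ 2) * q := by
  have hnn2 : 0 ≤ 8 * R * Real.exp (8 * α * M ^ 2) * q := by positivity
  have hnn1 : 0 ≤ Real.exp (4 * α * M ^ 2) * v ^ 2 := by positivity
  rcases le_or_gt |v| (2 * M) with h | h
  · have h1 : v ^ 2 ≤ 4 * M ^ 2 := by
      rw [← sq_abs]; nlinarith [abs_nonneg v]
    have h2 : Real.exp (α * v ^ 2) ≤ Real.exp (4 * α * M ^ 2) := by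
      apply Real.exp_le_exp.2; nlinarith
    nlinarith [sq_nonneg v]
  · set s := (|v| / 2 - M) / ε
    have hs : 0 < s := div_pos (by linarith) hε
    -- The largest n with M + √n ε ≤ |v|/2.
    set n := ⌊s ^ 2⌋₊
    have hn1 : √n ≤ s := by
      rw [Real.sqrt_le_left hs.le]
      exact Nat.floor_le (sq_nonneg _)
    have hn2 : s ^ 2 < n + 1 := Nat.lt_floor_add_one _
    have hsε : s * ε = |v| / 2 - M := div_mul_cancel₀ _ hε.ne'
    have h1 : |A n| ≤ |v| / 2 := by
      have := hA n
      have : √n * ε ≤ s * ε := by gcongr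
      linarith
    have h2 : |v| ≤ 2 * |v - A n| := by
      have := abs_add_le (v - A n) (A n)
      rw [sub_add_cancel] at this
      linarith
    have h3 : v ^ 2 ≤ 4 * (R / 2 ^ n * q) := by
      have := hvA n
      have h4 : v ^ 2 ≤ 4 * (v - A n) ^ 2 := by
        rw [← sq_abs v, ← sq_abs (v - A n)]
        nlinarith [abs_nonneg v]
      linarith
    have h4 : v ^ 2 ≤ 8 * M ^ 2 + 8 * ε ^ 2 * (n + 1) := by
      have h5 : |v| = 2 * (M + s * ε) := by rw [hsε]; ring
      rw [← sq_abs, h5]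
      nlinarith [sq_nonneg (M - s * ε), mul_le_mul_of_nonneg_left hn2.le (sq_nonneg ε)]
    have h5 : Real.exp (α * v ^ 2) ≤ Real.exp (8 * α * M ^ 2) * 2 ^ (n + 1) := by
      have h6 : (2 : ℝ) ^ (n + 1) = Real.exp (Real.log 2 * (n + 1)) := by
        rw [mul_comm, ← Real.rpow_natCast, Real.rpow_def_of_pos (by norm_num), mul_comm]
        push_cast; rfl
      rw [h6, ← Real.exp_add]
      apply Real.exp_le_exp.2
      have : 8 * α * ε ^ 2 * (n + 1) ≤ Real.log 2 * (n + 1) := by gcongr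
      nlinarith [mul_le_mul_of_nonneg_left h4 hα]
    have h6 : v ^ 2 * Real.exp (α * v ^ 2) ≤
        4 * (R / 2 ^ n * q) * (Real.exp (8 * α * M ^ 2) * 2 ^ (n + 1)) := by
      gcongr
    have h7 : 4 * (R / 2 ^ n * q) * (Real.exp (8 * α * M ^ 2) * 2 ^ (n + 1))
        = 8 * R * Real.exp (8 * α * M ^ 2) * q := by
      rw [pow_succ]; field_simp; ring
    linarith

theorem tendsto_setIntegral_nearDiagonal {u : ℝ → ℝ} (hq : MemLp (quot u) 2 volume) :
    Tendsto (fun n : ℕ => ∫ z in nearDiagonal (1 / 2 ^ n), quot u z ^ 2) atTop (𝓝 0) := by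
  have hqi : Integrable (fun z => quot u z ^ 2) := hq.integrable_sq
  have hanti : Antitone fun n : ℕ => nearDiagonal (1 / 2 ^ n) := by
    intro i j hij z hz
    have hz' : |z.1 - z.2| < 1 / 2 ^ j := hz
    refine lt_of_lt_of_le hz' ?_
    exact one_div_le_one_div_of_le (by positivity) (pow_le_pow_right₀ (by norm_num) hij)
  have h := tendsto_setIntegral_of_antitone (μ := volume) (f := fun z => quot u z ^ 2)
    (fun n : ℕ => measurableSet_nearDiagonal (1 / 2 ^ n)) hanti ⟨0, hqi.integrableOn⟩
  have h0 : ∫ z in ⋂ n : ℕ, nearDiagonal (1 / 2 ^ n), quot u z ^ 2 = 0 := by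
    refine setIntegral_eq_zero_of_forall_eq_zero fun z hz => ?_
    have h1 : |z.1 - z.2| ≤ 0 := by
      refine ge_of_tendsto' (tendsto_pow_atTop_nhds_zero_of_lt_one
        (by norm_num : (0 : ℝ) ≤ 1 / 2) (by norm_num)) fun n => ?_
      have hz' : |z.1 - z.2| < 1 / 2 ^ n := mem_iInter.1 hz n
      rw [one_div_pow]; exact hz'.le
    have h2 : |z.1 - z.2| = 0 := le_antisymm h1 (abs_nonneg _)
    simp [quot, h2]
  rwa [h0] at h

/-- Exponential integrability of functions of finite Gagliardo energy, with every exponent. -/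
theorem integrable_sq_mul_exp {u : ℝ → ℝ} (hm : Measurable u) (hu : MemLp u 2 volume)
    (hq : MemLp (quot u) 2 volume) {α : ℝ} (hα : 0 ≤ α) :
    Integrable (fun x => u x ^ 2 * Real.exp (α * u x ^ 2)) := by
  have hqi : Integrable (fun z => quot u z ^ 2) := hq.integrable_sq
  obtain ⟨ε, hε, hsmall⟩ : ∃ ε : ℝ, 0 < ε ∧ 8 * α * ε ^ 2 ≤ Real.log 2 := by
    have hl : 0 < Real.log 2 := Real.log_pos (by norm_num)
    refine ⟨√(Real.log 2 / (8 * α + 1)), Real.sqrt_pos.2 (by positivity), ?_⟩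
    rw [Real.sq_sqrt (by positivity), mul_div_assoc', div_le_iff₀ (by positivity)]
    nlinarith
  -- Any α is allowed because the energy within distance R of the diagonal is as small as desired
  -- once R is small.
  obtain ⟨k, hk⟩ : ∃ k : ℕ, ∫ z in nearDiagonal (1 / 2 ^ k), quot u z ^ 2 < ε ^ 2 :=
    ((tendsto_setIntegral_nearDiagonal hq).eventually_lt_const (by positivity)).exists
  set R : ℝ := 1 / 2 ^ k
  have hR : 0 < R := by positivity
  set M := √(R⁻¹ * ∫ y, u y ^ 2)
  have hsec : ∀ᵐ x : ℝ, Integrable (fun y => quot u (x, y) ^ 2) :=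
    Integrable.prod_right_ae hqi
  have hint : Integrable (fun x => ∫ y, quot u (x, y) ^ 2) := Integrable.integral_prod_left hqi
  refine Integrable.mono' ((hu.integrable_sq.const_mul (Real.exp (4 * α * M ^ 2))).add
    (hint.const_mul (8 * R * Real.exp (8 * α * M ^ 2)))) (by fun_prop) ?_
  filter_upwards [hsec] with x hx
  rw [Real.norm_of_nonneg (by positivity)]
  refine sq_mul_exp_le_of_approx (A := fun n => runAvg u (R / 2 ^ n) x) (Real.sqrt_nonneg _) hε hα
    hR.le (integral_nonneg fun y => sq_nonneg _) (fun n => ?_) (fun n => ?_) hsmall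
  · refine (abs_runAvg_dyadic_le hu hq hR x n).trans ?_
    have h1 : |runAvg u R x| ≤ M := Real.abs_le_sqrt (runAvg_sq_le hu hR x)
    have h2 : √(∫ z in nearDiagonal R, quot u z ^ 2) ≤ ε := by
      rw [Real.sqrt_le_left hε.le]; exact hk.le
    gcongr
  · exact sub_runAvg_sq_le hu (by positivity) hx

/-- A square-integrable function of zero Gagliardo energy vanishes. -/
theorem ae_eq_zero_of_quot_ae_eq_zero {u : ℝ → ℝ} (hu : MemLp u 2 volume)
    (hq : quot u =ᵐ[volume] 0) : u =ᵐ[volume] 0 := by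
  have h1 : ∀ᵐ x : ℝ, ∀ᵐ y : ℝ, quot u (x, y) = 0 := Measure.ae_ae_of_ae_prod hq
  filter_upwards [h1] with x hx
  have hz : (fun y => quot u (x, y) ^ 2) =ᵐ[volume] 0 := by
    filter_upwards [hx] with y hy
    simp [hy]
  have hi : Integrable (fun y => quot u (x, y) ^ 2) := (integrable_congr hz).2 (integrable_zero _ _ _)
  have h0 : ∫ y, quot u (x, y) ^ 2 = 0 := by rw [integral_congr_ae hz]; simp
  -- With zero energy, u(x) equals its average over (x, x+r] for every r, and these averages tend to
  -- 0 as r → ∞ because u is in L².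
  have h2 : ∀ r : ℝ, 0 < r → u x ^ 2 ≤ r⁻¹ * ∫ y, u y ^ 2 := by
    intro r hr
    have h3 := sub_runAvg_sq_le hu hr hi
    rw [h0, mul_zero] at h3
    have h4 : u x = runAvg u r x := by nlinarith [sq_nonneg (u x - runAvg u r x)]
    rw [h4]
    exact runAvg_sq_le hu hr x
  have h3 : u x ^ 2 ≤ 0 := by
    have ht : Tendsto (fun r : ℝ => r⁻¹ * ∫ y, u y ^ 2) atTop (𝓝 0) := by
      simpa using tendsto_inv_atTop_zero.mul_const (∫ y, u y ^ 2)
    refine ge_of_tendsto ht ?_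
    filter_upwards [eventually_gt_atTop 0] with r hr using h2 r hr
  have : u x = 0 := by nlinarith [sq_nonneg (u x)]
  simpa using this

/-! ### The Hilbert space: completeness, domination, kinetic energy. -/

namespace HHalf

theorem measurable_coe (u : HHalf) : Measurable (u : ℝ → ℝ) :=
  (Lp.stronglyMeasurable u.toL2).measurable

theorem ext_ae {u v : HHalf} (h : (u : ℝ → ℝ) =ᵐ[volume] v) : u = v :=
  Subtype.ext (Lp.ext h)

theorem coe_sub (u v : HHalf) : ⇑(u - v).toL2 =ᵐ[volume] ⇑u.toL2 - ⇑v.toL2 :=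
  Lp.coeFn_sub u.toL2 v.toL2

theorem kinetic_eq_gagliardoForm (u : HHalf) : u.kinetic = gagliardoForm u u := by
  simp only [kinetic, gagliardoForm, sq]

theorem kinetic_nonneg (u : HHalf) : 0 ≤ u.kinetic := by
  rw [kinetic_eq_gagliardoForm]; exact gagliardoForm_self_nonneg u

theorem kinetic_eq_quot (u : HHalf) :
    u.kinetic = 1 / (2 * Real.pi) * ∫ z : ℝ × ℝ, quot u z ^ 2 := by
  simp only [kinetic, quot, div_pow]

theorem integral_sq_nonneg (u : HHalf) : 0 ≤ ∫ x, u x ^ 2 := integral_nonneg fun _ => sq_nonneg _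

theorem kinetic_le_norm_sq (u : HHalf) : u.kinetic ≤ ‖u‖ ^ 2 := by
  rw [norm_sq_eq]; linarith [integral_sq_nonneg u]

theorem integral_sq_le_norm_sq (u : HHalf) : ∫ x, u x ^ 2 ≤ ‖u‖ ^ 2 := by
  rw [norm_sq_eq]; linarith [kinetic_nonneg u]

theorem norm_sq_lp {α : Type*} [MeasurableSpace α] {ν : Measure α} (f : Lp ℝ 2 ν) :
    ‖f‖ ^ 2 = ∫ x, f x ^ 2 ∂ν := by
  rw [← real_inner_self_eq_norm_sq, L2.inner_def]
  simp [sq]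

theorem norm_toL2_sq (u : HHalf) : ‖u.toL2‖ ^ 2 = ∫ x, u x ^ 2 := norm_sq_lp _

theorem norm_toL2_le (u : HHalf) : ‖u.toL2‖ ≤ ‖u‖ := by
  refine le_of_sq_le_sq ?_ (norm_nonneg _)
  rw [norm_toL2_sq]; exact integral_sq_le_norm_sq u

/-- The inclusion of `H^{1/2}(ℝ)` into `L²(ℝ)`. -/
def toL2L : HHalf →L[ℝ] Lp ℝ 2 (volume : Measure ℝ) :=
  LinearMap.mkContinuous
    { toFun := toL2
      map_add' := fun _ _ => rfl
      map_smul' := fun _ _ => rfl } 1 (fun u => by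
        rw [one_mul]
        exact norm_toL2_le u)

@[simp] theorem toL2L_apply (u : HHalf) : toL2L u = u.toL2 := rfl

/-- The difference quotient of an element of `H^{1/2}(ℝ)` as an element of `L²(ℝ × ℝ)`. -/
def quotL2 (u : HHalf) : Lp ℝ 2 (volume : Measure (ℝ × ℝ)) := (memLp_quot u).toLp

theorem coe_quotL2 (u : HHalf) : quotL2 u =ᵐ[volume] quot u := MemLp.coeFn_toLp _

theorem norm_quotL2_sq (u : HHalf) : ‖quotL2 u‖ ^ 2 = 2 * Real.pi * u.kinetic := by
  rw [norm_sq_lp, kinetic_eq_quot]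
  have : ∫ z, quotL2 u z ^ 2 = ∫ z, quot u z ^ 2 := integral_congr_ae (by
    filter_upwards [coe_quotL2 u] with z hz
    rw [hz])
  rw [this]
  have := Real.pi_pos
  field_simp

theorem quotL2_add (u v : HHalf) : quotL2 (u + v) = quotL2 u + quotL2 v := by
  refine Lp.ext ?_
  filter_upwards [coe_quotL2 (u + v), coe_quotL2 u, coe_quotL2 v, quot_add_ae u.toL2 v.toL2,
    Lp.coeFn_add (quotL2 u) (quotL2 v)] with z h1 h2 h3 h4 h5
  rw [h1, h5, Pi.add_apply, h2, h3]
  exact h4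

theorem quotL2_smul (c : ℝ) (u : HHalf) : quotL2 (c • u) = c • quotL2 u := by
  refine Lp.ext ?_
  filter_upwards [coe_quotL2 (c • u), coe_quotL2 u, quot_smul_ae c u.toL2,
    Lp.coeFn_smul c (quotL2 u)] with z h1 h2 h4 h5
  rw [h1, h5, Pi.smul_apply, h2]
  exact h4

/-- The difference quotient as a bounded operator into `L²(ℝ × ℝ)`. -/
def quotL : HHalf →L[ℝ] Lp ℝ 2 (volume : Measure (ℝ × ℝ)) :=
  LinearMap.mkContinuous
    { toFun := quotL2
      map_add' := quotL2_add
      map_smul' := quotL2_smul } (√(2 * Real.pi)) (fun u => by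
        refine le_of_sq_le_sq ?_ (by positivity)
        rw [mul_pow, Real.sq_sqrt (by positivity)]
        change ‖quotL2 u‖ ^ 2 ≤ _
        rw [norm_quotL2_sq]
        have := kinetic_le_norm_sq u
        gcongr)

@[simp] theorem quotL_apply (u : HHalf) : quotL u = quotL2 u := rfl

theorem norm_sq_eq_lp (u : HHalf) :
    ‖u‖ ^ 2 = 1 / (2 * Real.pi) * ‖quotL u‖ ^ 2 + ‖toL2L u‖ ^ 2 := by
  rw [quotL_apply, toL2L_apply, norm_quotL2_sq, norm_toL2_sq, norm_sq_eq]
  have := Real.pi_pos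
  field_simp

/-- The element of `H^{1/2}(ℝ)` given by a function. -/
def ofFun (u : ℝ → ℝ) (hu : MemLp u 2 volume) (hq : MemLp (quot u) 2 volume) : HHalf :=
  ⟨hu.toLp, (finiteGagliardo_iff (Lp.aestronglyMeasurable _)).2
    ((memLp_congr_ae (quot_congr hu.coeFn_toLp)).2 hq)⟩

theorem coe_ofFun (u : ℝ → ℝ) (hu : MemLp u 2 volume) (hq : MemLp (quot u) 2 volume) :
    (ofFun u hu hq : ℝ → ℝ) =ᵐ[volume] u := hu.coeFn_toLp

theorem exists_subseq_tendsto_ae {α : Type*} [MeasurableSpace α] {ν : Measure α}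
    {f : ℕ → Lp ℝ 2 ν} {g : Lp ℝ 2 ν} (h : Tendsto f atTop (𝓝 g)) :
    ∃ φ : ℕ → ℕ, StrictMono φ ∧ ∀ᵐ x ∂ν, Tendsto (fun n => f (φ n) x) atTop (𝓝 (g x)) :=
  (tendstoInMeasure_of_tendsto_Lp h).exists_seq_tendsto_ae

instance : CompleteSpace HHalf := by
  refine Metric.complete_of_cauchySeq_tendsto fun u hu => ?_
  obtain ⟨a, ha⟩ := cauchySeq_tendsto_of_complete (toL2L.uniformContinuous.comp_cauchySeq hu)
  obtain ⟨b, hb⟩ := cauchySeq_tendsto_of_complete (quotL.uniformContinuous.comp_cauchySeq hu)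
  obtain ⟨φ, hφ, hφa⟩ := exists_subseq_tendsto_ae ha
  obtain ⟨ψ, hψ, hψb⟩ := exists_subseq_tendsto_ae (hb.comp hφ.tendsto_atTop)
  -- The two L² limits are matched along a common subsequence converging almost everywhere; this
  -- says that u ↦ (u, quot u) has closed range.
  have hquot : quot a =ᵐ[volume] b := by
    have h1 : ∀ᵐ z : ℝ × ℝ, Tendsto (fun n => u (φ n) z.1) atTop (𝓝 (a z.1)) :=
      Measure.quasiMeasurePreserving_fst.ae hφa
    have h2 : ∀ᵐ z : ℝ × ℝ, Tendsto (fun n => u (φ n) z.2) atTop (𝓝 (a z.2)) :=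
      Measure.quasiMeasurePreserving_snd.ae hφa
    have h3 : ∀ᵐ z : ℝ × ℝ, ∀ n, quotL2 (u n) z = quot (u n) z :=
      ae_all_iff.2 fun n => coe_quotL2 (u n)
    filter_upwards [h1, h2, h3, hψb] with z h1 h2 h3 h4
    refine tendsto_nhds_unique ?_ h4
    have h5 := (((h1.sub h2).div_const |z.1 - z.2|).comp hψ.tendsto_atTop)
    refine h5.congr fun n => ?_
    exact (h3 _).symm
  have hmem : MemLp (quot a) 2 volume := (memLp_congr_ae hquot).2 (Lp.memLp b)
  set w := ofFun a (Lp.memLp a) hmem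
  have hwa : toL2L w = a := Lp.ext (coe_ofFun a (Lp.memLp a) hmem)
  have hwb : quotL w = b := Lp.ext ((coe_quotL2 w).trans
    ((quot_congr (coe_ofFun a (Lp.memLp a) hmem)).trans hquot))
  refine ⟨w, tendsto_iff_norm_sub_tendsto_zero.2 ?_⟩
  have h1 : Tendsto (fun n => ‖u n - w‖ ^ 2) atTop (𝓝 0) := by
    have h2 := ((tendsto_iff_norm_sub_tendsto_zero.1 hb).pow 2).const_mul (1 / (2 * Real.pi))
    have h3 := (tendsto_iff_norm_sub_tendsto_zero.1 ha).pow 2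
    have h4 := h2.add h3
    simp only [ne_eq, OfNat.ofNat_ne_zero, not_false_eq_true, zero_pow, mul_zero, add_zero] at h4
    refine h4.congr fun n => ?_
    rw [norm_sq_eq_lp, map_sub, map_sub, hwa, hwb]
    rfl
  have h5 := h1.sqrt
  simpa using h5

theorem quot_abs_le (u : ℝ → ℝ) (z : ℝ × ℝ) : |quot (fun x => |u x|) z| ≤ |quot u z| := by
  simp only [quot, abs_div]
  exact div_le_div_of_nonneg_right (abs_abs_sub_abs_le _ _) (abs_nonneg _)

theorem memLp_quot_abs (u : HHalf) : MemLp (quot (fun x => |u x|)) 2 volume :=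
  (memLp_quot u).mono (aestronglyMeasurable_quot (memLp u).abs.1)
    (Eventually.of_forall fun z => quot_abs_le u z)

/-- The modulus of an element of `H^{1/2}(ℝ)`. -/
def modulus (u : HHalf) : HHalf := ofFun (fun x => |u x|) (memLp u).abs (memLp_quot_abs u)

theorem coe_modulus (u : HHalf) : (modulus u : ℝ → ℝ) =ᵐ[volume] fun x => |u x| :=
  coe_ofFun _ _ _

theorem norm_modulus_le (u : HHalf) : ‖modulus u‖ ≤ ‖u‖ := by
  refine le_of_sq_le_sq ?_ (norm_nonneg _)
  rw [norm_sq_eq, norm_sq_eq, kinetic_eq_quot, kinetic_eq_quot]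
  have h1 : ∫ x, modulus u x ^ 2 = ∫ x, u x ^ 2 := integral_congr_ae (by
    filter_upwards [coe_modulus u] with x hx
    rw [hx, sq_abs])
  have h2 : ∫ z, quot (modulus u) z ^ 2 ≤ ∫ z, quot u z ^ 2 := by
    refine integral_mono_ae (memLp_quot _).integrable_sq (memLp_quot _).integrable_sq ?_
    filter_upwards [quot_congr (coe_modulus u)] with z hz
    rw [hz]
    exact sq_le_sq.2 (quot_abs_le u z)
  rw [h1]
  gcongr

theorem modulus_nonneg (u : HHalf) : 0 ≤ (modulus u).toL2 := by
  rw [← Lp.coeFn_nonneg]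
  filter_upwards [coe_modulus u] with x hx
  rw [hx]
  exact abs_nonneg _

/-- A convergent sequence of `H^{1/2}(ℝ)` has a subsequence that converges almost everywhere and is
dominated by an element of `H^{1/2}(ℝ)`. -/
theorem exists_subseq_dominated {u : ℕ → HHalf} {p : HHalf} (h : Tendsto u atTop (𝓝 p)) :
    ∃ φ : ℕ → ℕ, StrictMono φ ∧ ∃ g : HHalf, (∀ᵐ x, ∀ n, |u (φ n) x| ≤ g x) ∧
      ∀ᵐ x, Tendsto (fun n => u (φ n) x) atTop (𝓝 (p x)) := by
  obtain ⟨φ, hφ, hφa⟩ := exists_subseq_tendsto_ae ((toL2L.continuous.tendsto p).comp h)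
  have h1 : Tendsto (fun n => u (φ n) - p) atTop (𝓝 0) := by
    have := (h.comp hφ.tendsto_atTop).sub_const p
    rwa [sub_self] at this
  obtain ⟨ψ, hψ, hψb⟩ : ∃ ψ : ℕ → ℕ, StrictMono ψ ∧ ∀ n, ‖u (φ (ψ n)) - p‖ < (1 / 2) ^ n := by
    refine extraction_forall_of_eventually' (P := fun n k => ‖u (φ k) - p‖ < (1 / 2) ^ n)
      fun n => ?_
    have h2 := (tendsto_zero_iff_norm_tendsto_zero.1 h1).eventually_lt_const
      (show (0 : ℝ) < (1 / 2) ^ n by positivity)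
    obtain ⟨N, hN⟩ := eventually_atTop.1 h2
    exact ⟨N, hN⟩
  -- The series is summed in H^{1/2}, not merely in L², so that the dominating function is itself
  -- exponentially integrable.
  have hsum : Summable fun n => modulus (u (φ (ψ n)) - p) :=
    Summable.of_norm_bounded (summable_geometric_of_lt_one (by norm_num) (by norm_num))
      fun n => (norm_modulus_le _).trans (hψb n).le
  set s := ∑' n, modulus (u (φ (ψ n)) - p)
  have hs : HasSum (fun n => (modulus (u (φ (ψ n)) - p)).toL2) s.toL2 :=
    toL2L.hasSum hsum.hasSum
  have hle : ∀ n, (modulus (u (φ (ψ n)) - p)).toL2 ≤ s.toL2 := fun n =>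
    le_hasSum hs n fun j _ => modulus_nonneg _
  refine ⟨φ ∘ ψ, hφ.comp hψ, modulus p + s, ?_, ?_⟩
  · have h2 : ∀ᵐ x, ∀ n, modulus (u (φ (ψ n)) - p) x ≤ s x :=
      ae_all_iff.2 fun n => (Lp.coeFn_le _ _).2 (hle n)
    have h3 : ∀ᵐ x, ∀ n, modulus (u (φ (ψ n)) - p) x = |(u (φ (ψ n)) - p) x| :=
      ae_all_iff.2 fun n => coe_modulus _
    have h4 : ∀ᵐ x, ∀ n, (u (φ (ψ n)) - p) x = u (φ (ψ n)) x - p x :=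
      ae_all_iff.2 fun n => coe_sub _ _
    filter_upwards [h2, h3, h4, coe_modulus p, coe_add (modulus p) s] with x h2 h3 h4 h5 h6 n
    rw [h6, Pi.add_apply, h5]
    have h7 := h2 n
    rw [h3, h4] at h7
    have := abs_add_le (p x) (u (φ (ψ n)) x - p x)
    rw [add_sub_cancel] at this
    exact this.trans (by linarith)
  · filter_upwards [hφa] with x hx
    exact hx.comp hψ.tendsto_atTop

/-- Zero kinetic energy makes u a constant, and the only constant in L² is 0. -/
theorem kinetic_pos {u : HHalf} (hu : u ≠ 0) : 0 < u.kinetic := by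
  refine (kinetic_nonneg u).lt_of_ne fun h => hu ?_
  rw [kinetic_eq_quot, eq_comm, mul_eq_zero] at h
  have hpi : 1 / (2 * Real.pi) ≠ 0 := by have := Real.pi_pos; positivity
  have h1 := h.resolve_left hpi
  rw [integral_eq_zero_iff_of_nonneg (fun z => sq_nonneg _) (memLp_quot u).integrable_sq] at h1
  refine ext_ae ((ae_eq_zero_of_quot_ae_eq_zero (memLp u) ?_).trans coe_zero.symm)
  filter_upwards [h1] with z hz
  simpa using hz

theorem integral_sq_smul (c : ℝ) (u : HHalf) : ∫ x, (c • u) x ^ 2 = c ^ 2 * ∫ x, u x ^ 2 := by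
  rw [← integral_const_mul]
  refine integral_congr_ae ?_
  filter_upwards [coe_smul c u] with x hx
  rw [hx, Pi.smul_apply, smul_eq_mul, mul_pow]


theorem kinetic_eq_inner (u : HHalf) :
    u.kinetic = 1 / (2 * Real.pi) * inner ℝ (quotL u) (quotL u) := by
  rw [real_inner_self_eq_norm_sq, quotL_apply, norm_quotL2_sq]
  have := Real.pi_pos
  field_simp

theorem contDiff_kinetic : ContDiff ℝ 1 kinetic := by
  have : kinetic = fun u => 1 / (2 * Real.pi) * inner ℝ (quotL u) (quotL u) :=
    funext kinetic_eq_inner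
  rw [this]
  exact contDiff_const.mul ((quotL.contDiff).inner ℝ quotL.contDiff)

theorem continuous_kinetic : Continuous kinetic := contDiff_kinetic.continuous

theorem continuous_integral_sq : Continuous fun u : HHalf => ∫ x, u x ^ 2 := by
  have : (fun u : HHalf => ∫ x, u x ^ 2) = fun u => ‖toL2L u‖ ^ 2 := by
    funext u; rw [toL2L_apply, norm_toL2_sq]
  rw [this]
  exact toL2L.continuous.norm.pow 2

end HHalf

theorem isClosed_sphere (a : ℝ) : IsClosed (sphere a) :=
  isClosed_eq HHalf.continuous_integral_sq continuous_const

theorem ne_zero_of_mem_sphere {a : ℝ} (ha : 0 < a) {u : HHalf} (hu : u ∈ sphere a) : u ≠ 0 := by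
  rintro rfl
  have h1 : ∫ x, (0 : HHalf) x ^ 2 = a ^ 2 := hu
  have h2 : ∫ x, (0 : HHalf) x ^ 2 = 0 := by
    rw [← HHalf.norm_toL2_sq]
    have : (0 : HHalf).toL2 = 0 := rfl
    rw [this]; simp
  rw [h2] at h1
  exact absurd h1.symm (by positivity)

/-! ### Dilations that preserve the L² norm. -/

theorem quasiMeasurePreserving_mul_left {c : ℝ} (hc : c ≠ 0) :
    Measure.QuasiMeasurePreserving (fun x : ℝ => c * x) volume volume :=
  ⟨by fun_prop, by
    rw [Real.map_volume_mul_left hc]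
    exact Measure.smul_absolutelyContinuous⟩

theorem quot_dilation (u : ℝ → ℝ) {τ : ℝ} (hτ : 0 < τ) (z : ℝ × ℝ) :
    quot (fun x => τ * u (τ ^ 2 * x)) z = τ ^ 3 * quot u ((τ ^ 2) • z) := by
  simp only [quot, Prod.smul_fst, Prod.smul_snd, smul_eq_mul]
  rw [← mul_sub (τ ^ 2), abs_mul, abs_of_pos (by positivity : (0 : ℝ) < τ ^ 2)]
  rcases eq_or_ne |z.1 - z.2| 0 with h | h
  · simp [h]
  · field_simp

theorem integral_quot_dilation_sq (u : ℝ → ℝ) {τ : ℝ} (hτ : 0 < τ) :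
    ∫ z, quot (fun x => τ * u (τ ^ 2 * x)) z ^ 2 = τ ^ 2 * ∫ z, quot u z ^ 2 := by
  simp only [quot_dilation u hτ, mul_pow]
  rw [integral_const_mul, Measure.integral_comp_smul volume (fun z => quot u z ^ 2) (τ ^ 2)]
  have : Module.finrank ℝ (ℝ × ℝ) = 2 := by simp
  rw [this, abs_of_pos (by positivity), smul_eq_mul]
  field_simp

namespace HHalf

theorem memLp_dilation (u : HHalf) {τ : ℝ} (hτ : 0 < τ) :
    MemLp (fun x => τ * u (τ ^ 2 * x)) 2 volume := by
  have hm := u.measurable_coe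
  have h1 : Measurable fun x => τ * u (τ ^ 2 * x) := by fun_prop
  rw [memLp_two_iff_integrable_sq h1.aestronglyMeasurable]
  have h2 := ((memLp u).integrable_sq.comp_mul_left' (by positivity : τ ^ 2 ≠ 0)).const_mul (τ ^ 2)
  simpa only [mul_pow] using h2

theorem memLp_quot_dilation (u : HHalf) {τ : ℝ} (hτ : 0 < τ) :
    MemLp (quot fun x => τ * u (τ ^ 2 * x)) 2 volume := by
  rw [memLp_two_iff_integrable_sq (aestronglyMeasurable_quot (memLp_dilation u hτ).1)]
  have h2 := ((memLp_quot u).integrable_sq.comp_smul (by positivity : τ ^ 2 ≠ 0)).const_mul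
    ((τ ^ 3) ^ 2)
  simpa only [quot_dilation _ hτ, mul_pow] using h2

/-- The `L²`-preserving dilation `x ↦ τ u(τ² x)`. -/
def dilation (τ : ℝ) (hτ : 0 < τ) (u : HHalf) : HHalf :=
  ofFun (fun x => τ * u (τ ^ 2 * x)) (memLp_dilation u hτ) (memLp_quot_dilation u hτ)

variable {τ : ℝ} (hτ : 0 < τ)

theorem coe_dilation (u : HHalf) : (dilation τ hτ u : ℝ → ℝ) =ᵐ[volume] fun x => τ * u (τ ^ 2 * x) :=
  coe_ofFun _ _ _

theorem kinetic_dilation (u : HHalf) : (dilation τ hτ u).kinetic = τ ^ 2 * u.kinetic := by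
  rw [kinetic_eq_quot, kinetic_eq_quot]
  have h1 : ∫ z, quot (dilation τ hτ u) z ^ 2 = ∫ z, quot (fun x => τ * u (τ ^ 2 * x)) z ^ 2 :=
    integral_congr_ae (by
      filter_upwards [quot_congr (coe_dilation hτ u)] with z hz
      rw [hz])
  rw [h1, integral_quot_dilation_sq _ hτ]
  ring

theorem integral_dilation_mul (u v : HHalf) :
    ∫ x, dilation τ hτ u x * dilation τ hτ v x = ∫ x, u x * v x := by
  have h1 : ∫ x, dilation τ hτ u x * dilation τ hτ v x
      = ∫ x, τ ^ 2 * (u (τ ^ 2 * x) * v (τ ^ 2 * x)) := integral_congr_ae (by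
    filter_upwards [coe_dilation hτ u, coe_dilation hτ v] with x h1 h2
    rw [h1, h2]; ring)
  rw [h1, integral_const_mul, Measure.integral_comp_mul_left (fun x => u x * v x) (τ ^ 2),
    abs_of_pos (by positivity), smul_eq_mul]
  field_simp

theorem integral_dilation_sq (u : HHalf) : ∫ x, dilation τ hτ u x ^ 2 = ∫ x, u x ^ 2 := by
  simpa only [sq] using integral_dilation_mul hτ u u

theorem dilation_add (u v : HHalf) :
    dilation τ hτ (u + v) = dilation τ hτ u + dilation τ hτ v := by
  refine ext_ae ?_
  have hq := quasiMeasurePreserving_mul_left (by positivity : τ ^ 2 ≠ 0)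
  filter_upwards [coe_dilation hτ (u + v), coe_dilation hτ u, coe_dilation hτ v,
    coe_add (dilation τ hτ u) (dilation τ hτ v), hq.ae (coe_add u v)] with x h1 h2 h3 h4 h5
  rw [h1, h4, Pi.add_apply, h2, h3, h5, Pi.add_apply, mul_add]

theorem dilation_smul (c : ℝ) (u : HHalf) :
    dilation τ hτ (c • u) = c • dilation τ hτ u := by
  refine ext_ae ?_
  have hq := quasiMeasurePreserving_mul_left (by positivity : τ ^ 2 ≠ 0)
  filter_upwards [coe_dilation hτ (c • u), coe_dilation hτ u,
    coe_smul c (dilation τ hτ u), hq.ae (coe_smul c u)] with x h1 h2 h4 h5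
  rw [h1, h4, Pi.smul_apply, h2, h5, Pi.smul_apply, smul_eq_mul, smul_eq_mul]
  ring

theorem dilation_inv_dilation (u : HHalf) :
    dilation τ hτ (dilation τ⁻¹ (inv_pos.2 hτ) u) = u := by
  refine ext_ae ?_
  have hq := quasiMeasurePreserving_mul_left (by positivity : τ ^ 2 ≠ 0)
  filter_upwards [coe_dilation hτ (dilation τ⁻¹ (inv_pos.2 hτ) u),
    hq.ae (coe_dilation (inv_pos.2 hτ) u)] with x h1 h2
  rw [h1, h2]
  have : τ⁻¹ ^ 2 * (τ ^ 2 * x) = x := by field_simp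
  rw [this]
  field_simp

theorem dilation_mem_sphere {a : ℝ} {u : HHalf} (hu : u ∈ sphere a) :
    dilation τ hτ u ∈ sphere a := by
  change ∫ x, dilation τ hτ u x ^ 2 = a ^ 2
  rw [integral_dilation_sq]; exact hu

end HHalf

/-! ### The sphere is not empty. -/

/-- The tent function `max(0, 1 - |x|)`. -/
def tent (x : ℝ) : ℝ := max 0 (1 - |x|)

theorem tent_nonneg (x : ℝ) : 0 ≤ tent x := le_max_left _ _

theorem tent_le_one (x : ℝ) : tent x ≤ 1 := max_le zero_le_one (by linarith [abs_nonneg x])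

theorem continuous_tent : Continuous tent := by unfold tent; fun_prop

theorem tent_eq_zero {x : ℝ} (hx : 1 ≤ |x|) : tent x = 0 := max_eq_left (by linarith)

theorem abs_tent_sub_le (x y : ℝ) : |tent x - tent y| ≤ |x - y| := by
  have h1 := abs_max_sub_max_le_abs (1 - |x|) (1 - |y|) 0
  rw [max_comm, max_comm (1 - |y|)] at h1
  refine h1.trans ?_
  have h2 : (1 - |x|) - (1 - |y|) = |y| - |x| := by ring
  rw [h2, abs_sub_comm x y]
  exact abs_abs_sub_abs_le y x

theorem hasCompactSupport_tent : HasCompactSupport tent :=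
  HasCompactSupport.intro (isCompact_Icc (a := (-1 : ℝ)) (b := 1)) fun x hx => by
    refine tent_eq_zero ?_
    by_contra h
    exact hx (abs_le.1 (not_le.1 h).le)

theorem memLp_tent : MemLp tent 2 volume :=
  continuous_tent.memLp_of_hasCompactSupport hasCompactSupport_tent

/-- The squared increment of the tent is at most min(1, (x − y)²) and vanishes unless x or y lies in
[−1, 1]. The majorant is a convolution integrand of two integrable functions, hence integrable on
the plane. -/
theorem quot_tent_sq_le (x y : ℝ) : quot tent (x, y) ^ 2 ≤
    ((Icc (-1) 1).indicator 1 x + (Icc (-1) 1).indicator 1 y) * (2 * (1 + (x - y) ^ 2)⁻¹) := by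
  have hi : ∀ t : ℝ, 0 ≤ (Icc (-1 : ℝ) 1).indicator (1 : ℝ → ℝ) t := fun t =>
    indicator_nonneg (fun _ _ => zero_le_one) t
  by_cases h : x ∈ Icc (-1 : ℝ) 1 ∨ y ∈ Icc (-1 : ℝ) 1
  · have h1 : 1 ≤ (Icc (-1) 1).indicator (1 : ℝ → ℝ) x + (Icc (-1) 1).indicator (1 : ℝ → ℝ) y := by
      rcases h with h | h
      · have := hi y
        rw [indicator_of_mem h]; simpa using this
      · have := hi x
        rw [indicator_of_mem h]; simpa using this
    have h2 : quot tent (x, y) ^ 2 ≤ 2 * (1 + (x - y) ^ 2)⁻¹ := by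
      rcases eq_or_ne x y with rfl | hxy
      · simp [quot]
      · have hpos : 0 < (x - y) ^ 2 := by
          have := sub_ne_zero.2 hxy
          positivity
        rw [quot, div_pow, sq_abs, ← div_eq_mul_inv, div_le_div_iff₀ hpos (by positivity)]
        have h3 : (tent x - tent y) ^ 2 ≤ (x - y) ^ 2 := sq_le_sq.2 (abs_tent_sub_le x y)
        have h4 : (tent x - tent y) ^ 2 ≤ 1 := by
          have a1 := tent_nonneg x; have a2 := tent_nonneg y
          have a3 := tent_le_one x; have a4 := tent_le_one y
          rw [sq_le_one_iff_abs_le_one, abs_le]; constructor <;> linarith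
        nlinarith
    calc quot tent (x, y) ^ 2 ≤ 1 * (2 * (1 + (x - y) ^ 2)⁻¹) := by rwa [one_mul]
      _ ≤ _ := by gcongr
  · push Not at h
    have h1 : ∀ t : ℝ, t ∉ Icc (-1 : ℝ) 1 → tent t = 0 := fun t ht => by
      refine tent_eq_zero ?_
      by_contra h
      exact ht (abs_le.1 (not_le.1 h).le)
    have h2 : quot tent (x, y) = 0 := by simp [quot, h1 x h.1, h1 y h.2]
    rw [h2, zero_pow two_ne_zero]
    exact mul_nonneg (add_nonneg (hi x) (hi y)) (by positivity)

theorem memLp_quot_tent : MemLp (quot tent) 2 volume := by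
  rw [memLp_two_iff_integrable_sq (aestronglyMeasurable_quot memLp_tent.1)]
  have hi : Integrable ((Icc (-1 : ℝ) 1).indicator (1 : ℝ → ℝ)) := by
    rw [integrable_indicator_iff measurableSet_Icc]
    exact integrableOn_const (by simp)
  have hk : Integrable fun t : ℝ => 2 * (1 + t ^ 2)⁻¹ := integrable_inv_one_add_sq.const_mul 2
  have h2 : Integrable fun z : ℝ × ℝ =>
      (Icc (-1 : ℝ) 1).indicator (1 : ℝ → ℝ) z.2 * (2 * (1 + (z.1 - z.2) ^ 2)⁻¹) :=
    hi.convolution_integrand (ContinuousLinearMap.mul ℝ ℝ) hk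
  have h1 : Integrable fun z : ℝ × ℝ =>
      (Icc (-1 : ℝ) 1).indicator (1 : ℝ → ℝ) z.1 * (2 * (1 + (z.1 - z.2) ^ 2)⁻¹) := by
    refine h2.swap.congr (Eventually.of_forall fun z => ?_)
    simp only [Function.comp, Prod.fst_swap, Prod.snd_swap]
    rw [← neg_sq (z.2 - z.1), neg_sub]
  refine (h1.add h2).mono' ((aestronglyMeasurable_quot memLp_tent.1).pow 2)
    (Eventually.of_forall fun z => ?_)
  rw [Real.norm_of_nonneg (sq_nonneg _), Pi.add_apply, ← add_mul]
  exact quot_tent_sq_le z.1 z.2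

theorem sphere_nonempty (a : ℝ) : (sphere a).Nonempty := by
  set w := HHalf.ofFun tent memLp_tent memLp_quot_tent
  have hw : ∫ x, w x ^ 2 = ∫ x, tent x ^ 2 := integral_congr_ae (by
    filter_upwards [HHalf.coe_ofFun tent memLp_tent memLp_quot_tent] with x hx
    rw [hx])
  have hpos : 0 < ∫ x, w x ^ 2 := by
    rw [hw]
    refine (continuous_tent.pow 2).integral_pos_of_hasCompactSupport_nonneg_nonzero (x := 0)
      ?_ (fun x => sq_nonneg _) (by simp [tent])
    exact hasCompactSupport_tent.comp_left (g := fun t => t ^ 2) (by simp)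
  refine ⟨(a / √(∫ x, w x ^ 2)) • w, ?_⟩
  change ∫ x, ((a / √(∫ x, w x ^ 2)) • w) x ^ 2 = a ^ 2
  rw [HHalf.integral_sq_smul, div_pow, Real.sq_sqrt hpos.le]
  field_simp

/-! ### Riesz potentials on L¹ ∩ L^q and the exponential weight. -/

section

variable {μ : ℝ}

/-- The kernel `|z|^{-μ}` cut off to `[-1, 1]`. -/
def nearKernel (μ z : ℝ) : ℝ := (Icc (-1 : ℝ) 1).indicator (fun z => 1 / |z| ^ μ) z

theorem measurable_nearKernel : Measurable (nearKernel μ) :=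
  (by fun_prop : Measurable fun z : ℝ => 1 / |z| ^ μ).indicator measurableSet_Icc

theorem nearKernel_nonneg (z : ℝ) : 0 ≤ nearKernel μ z :=
  indicator_nonneg (fun _ _ => by positivity) z

theorem kernel_le (hμ : 0 < μ) (z : ℝ) : 1 / |z| ^ μ ≤ nearKernel μ z + 1 := by
  by_cases h : z ∈ Icc (-1 : ℝ) 1
  · rw [nearKernel, indicator_of_mem h]; linarith
  · have h1 : 1 < |z| := by
      by_contra hz
      exact h (abs_le.1 (not_lt.1 hz))
    have h2 : 1 ≤ |z| ^ μ := Real.one_le_rpow h1.le hμ.le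
    have := nearKernel_nonneg (μ := μ) z
    have : 1 / |z| ^ μ ≤ 1 := (div_le_one (by positivity)).2 h2
    linarith

theorem integrableOn_abs_rpow {s : ℝ} (hs : -1 < s) :
    IntegrableOn (fun z : ℝ => |z| ^ s) (Icc (-1) 1) := by
  have h1 : IntervalIntegrable (fun z : ℝ => |z| ^ s) volume 0 1 := by
    refine (intervalIntegral.intervalIntegrable_rpow' hs).congr fun z hz => ?_
    rw [uIoc_of_le zero_le_one] at hz
    simp only [abs_of_pos hz.1]
  have h2 : IntervalIntegrable (fun z : ℝ => |z| ^ s) volume (-1) 0 := by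
    rw [IntervalIntegrable.iff_comp_neg]
    simpa using h1.symm
  rw [integrableOn_Icc_iff_integrableOn_Ioc]
  exact (intervalIntegrable_iff_integrableOn_Ioc_of_le (by norm_num)).1 (h2.trans h1)

/-- The exponent of the singularity is 2μ/(1 + μ), which is less than 1 because μ < 1. -/
theorem integrable_nearKernel_rpow (hμ0 : 0 < μ) (hμ1 : μ < 1) :
    Integrable fun z => nearKernel μ z ^ (2 / (1 + μ)) := by
  have hr : (0 : ℝ) < 2 / (1 + μ) := by positivity
  have e : (fun z => nearKernel μ z ^ (2 / (1 + μ)))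
      = (Icc (-1 : ℝ) 1).indicator fun z => |z| ^ (-(μ * (2 / (1 + μ)))) := by
    funext z
    by_cases h : z ∈ Icc (-1 : ℝ) 1
    · rw [nearKernel, indicator_of_mem h, indicator_of_mem h, one_div,
        Real.inv_rpow (by positivity), ← Real.rpow_mul (abs_nonneg _), Real.rpow_neg (abs_nonneg _)]
    · rw [nearKernel, indicator_of_notMem h, indicator_of_notMem h, Real.zero_rpow hr.ne']
  rw [e, integrable_indicator_iff measurableSet_Icc]
  refine integrableOn_abs_rpow ?_
  rw [neg_lt_neg_iff, mul_div_assoc', div_lt_one (by linarith)]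
  linarith

/-- Functions in `L¹ ∩ L^q` with `q = 2 / (1 - μ)`. -/
def Tame (μ : ℝ) (g : ℝ → ℝ) : Prop :=
  Integrable g ∧ Integrable fun x => |g x| ^ (2 / (1 - μ))

/-- A bound for the Riesz potential of a function in `L¹ ∩ L^q`. -/
def tameNorm (μ : ℝ) (g : ℝ → ℝ) : ℝ :=
  (∫ z, nearKernel μ z ^ (2 / (1 + μ))) ^ (1 / (2 / (1 + μ))) *
    (∫ x, |g x| ^ (2 / (1 - μ))) ^ (1 / (2 / (1 - μ))) + ∫ x, |g x|

theorem tameNorm_nonneg (g : ℝ → ℝ) : 0 ≤ tameNorm μ g := by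
  have h1 : 0 ≤ ∫ z, nearKernel μ z ^ (2 / (1 + μ)) :=
    integral_nonneg fun z => Real.rpow_nonneg (nearKernel_nonneg z) _
  have h2 : 0 ≤ ∫ x, |g x| ^ (2 / (1 - μ)) := integral_nonneg fun z => by positivity
  have h3 : 0 ≤ ∫ x, |g x| := integral_nonneg fun z => abs_nonneg _
  unfold tameNorm; positivity

theorem holderConjugate_exponents (hμ0 : 0 < μ) (hμ1 : μ < 1) :
    (2 / (1 + μ)).HolderConjugate (2 / (1 - μ)) := by
  rw [Real.holderConjugate_iff]
  refine ⟨by rw [lt_div_iff₀ (by linarith)]; linarith, ?_⟩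
  have : 1 - μ ≠ 0 := by linarith
  field_simp
  ring

theorem memLp_of_integrable_rpow {α : Type*} [MeasurableSpace α] {ν : Measure α} {g : α → ℝ}
    (hm : AEStronglyMeasurable g ν) {p : ℝ} (hp : 0 < p) (h : Integrable (fun x => |g x| ^ p) ν) :
    MemLp g (ENNReal.ofReal p) ν := by
  rw [← integrable_norm_rpow_iff hm (by simpa using hp) (by simp)]
  rw [ENNReal.toReal_ofReal hp.le]
  exact h

theorem Tame.memLp (hμ1 : μ < 1) {g : ℝ → ℝ} (hg : Tame μ g) :
    MemLp g (ENNReal.ofReal (2 / (1 - μ))) volume :=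
  memLp_of_integrable_rpow hg.1.1 (div_pos two_pos (by linarith)) hg.2

theorem memLp_nearKernel (hμ0 : 0 < μ) (hμ1 : μ < 1) (x : ℝ) :
    MemLp (fun y => nearKernel μ (x - y)) (ENNReal.ofReal (2 / (1 + μ))) volume := by
  refine memLp_of_integrable_rpow ?_ (by positivity) ?_
  · exact (measurable_nearKernel.comp (by fun_prop : Measurable fun y : ℝ => x - y)).aestronglyMeasurable
  · simp only [abs_of_nonneg (nearKernel_nonneg _)]
    exact (integrable_nearKernel_rpow hμ0 hμ1).comp_sub_left x

theorem integrable_nearKernel_mul (hμ0 : 0 < μ) (hμ1 : μ < 1) {g : ℝ → ℝ} (hg : Tame μ g) (x : ℝ) :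
    Integrable fun y => nearKernel μ (x - y) * |g y| := by
  have hc := holderConjugate_exponents hμ0 hμ1
  have := hc.ennrealOfReal
  exact (memLp_nearKernel hμ0 hμ1 x).integrable_mul (hg.memLp hμ1).abs

/-- Hölder's inequality on the singular part of the kernel, and the bound 1 on the rest. The result
is uniform in x, so a plain L∞–L¹ estimate controls the nonlocal terms in place of the
Hardy–Littlewood–Sobolev inequality. -/
theorem integral_nearKernel_mul_add_le (hμ0 : 0 < μ) (hμ1 : μ < 1) {g : ℝ → ℝ} (hg : Tame μ g)
    (x : ℝ) : ∫ y, (nearKernel μ (x - y) * |g y| + |g y|) ≤ tameNorm μ g := by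
  have hc := holderConjugate_exponents hμ0 hμ1
  rw [integral_add (integrable_nearKernel_mul hμ0 hμ1 hg x) hg.1.abs, tameNorm]
  have h1 := integral_mul_le_Lp_mul_Lq_of_nonneg hc
    (Eventually.of_forall fun y => nearKernel_nonneg (μ := μ) (x - y))
    (Eventually.of_forall fun y => abs_nonneg (g y))
    (memLp_nearKernel hμ0 hμ1 x) (hg.memLp hμ1).abs
  rw [integral_sub_left_eq_self (fun z => nearKernel μ z ^ (2 / (1 + μ)))] at h1
  linarith

theorem measurable_kernel : Measurable fun z : ℝ => 1 / |z| ^ μ := by fun_prop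

theorem abs_kernel_mul_le (hμ0 : 0 < μ) (g : ℝ → ℝ) (x y : ℝ) :
    |1 / |x - y| ^ μ * g y| ≤ nearKernel μ (x - y) * |g y| + |g y| := by
  rw [abs_mul, abs_of_nonneg (by positivity : 0 ≤ 1 / |x - y| ^ μ)]
  have := mul_le_mul_of_nonneg_right (kernel_le hμ0 (x - y)) (abs_nonneg (g y))
  linarith

theorem Tame.integrable_kernel_mul (hμ0 : 0 < μ) (hμ1 : μ < 1) {g : ℝ → ℝ} (hg : Tame μ g) (x : ℝ) :
    Integrable fun y => 1 / |x - y| ^ μ * g y := by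
  refine ((integrable_nearKernel_mul hμ0 hμ1 hg x).add hg.1.abs).mono' ?_
    (Eventually.of_forall fun y => abs_kernel_mul_le hμ0 g x y)
  exact (measurable_kernel.comp
    (by fun_prop : Measurable fun y : ℝ => x - y)).aestronglyMeasurable.mul hg.1.1

theorem Tame.integral_abs_kernel_mul_le (hμ0 : 0 < μ) (hμ1 : μ < 1) {g : ℝ → ℝ} (hg : Tame μ g)
    (x : ℝ) : ∫ y, |1 / |x - y| ^ μ * g y| ≤ tameNorm μ g :=
  (integral_mono (hg.integrable_kernel_mul hμ0 hμ1 x).abs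
    ((integrable_nearKernel_mul hμ0 hμ1 hg x).add hg.1.abs)
    fun y => abs_kernel_mul_le hμ0 g x y).trans (integral_nearKernel_mul_add_le hμ0 hμ1 hg x)

theorem Tame.abs_riesz_le (hμ0 : 0 < μ) (hμ1 : μ < 1) {g : ℝ → ℝ} (hg : Tame μ g) (x : ℝ) :
    |riesz μ g x| ≤ tameNorm μ g :=
  abs_integral_le_integral_abs.trans (hg.integral_abs_kernel_mul_le hμ0 hμ1 x)

theorem aestronglyMeasurable_kernel_mul {g : ℝ → ℝ} (hg : AEStronglyMeasurable g volume) :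
    AEStronglyMeasurable (fun z : ℝ × ℝ => 1 / |z.1 - z.2| ^ μ * g z.2) volume := by
  refine AEStronglyMeasurable.mul ?_ hg.comp_snd
  exact (measurable_kernel.comp
    (by fun_prop : Measurable fun z : ℝ × ℝ => z.1 - z.2)).aestronglyMeasurable

theorem aestronglyMeasurable_riesz {g : ℝ → ℝ} (hg : AEStronglyMeasurable g volume) :
    AEStronglyMeasurable (riesz μ g) volume :=
  (aestronglyMeasurable_kernel_mul hg).integral_prod_right'

/-- The bilinear form `∫ (I_μ * g) h dx`. -/
def pairing (μ : ℝ) (g h : ℝ → ℝ) : ℝ := ∫ x, riesz μ g x * h x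

theorem Tame.integrable_riesz_mul (hμ0 : 0 < μ) (hμ1 : μ < 1) {g h : ℝ → ℝ} (hg : Tame μ g)
    (hh : Integrable h) : Integrable fun x => riesz μ g x * h x :=
  hh.bdd_mul (aestronglyMeasurable_riesz hg.1.1)
    (Eventually.of_forall fun x => hg.abs_riesz_le hμ0 hμ1 x)

theorem Tame.abs_pairing_le (hμ0 : 0 < μ) (hμ1 : μ < 1) {g h : ℝ → ℝ} (hg : Tame μ g)
    (hh : Integrable h) : |pairing μ g h| ≤ tameNorm μ g * ∫ x, |h x| := by
  refine abs_integral_le_integral_abs.trans ?_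
  rw [← integral_const_mul]
  refine integral_mono (hg.integrable_riesz_mul hμ0 hμ1 hh).abs (hh.abs.const_mul _) fun x => ?_
  simp only [abs_mul]
  exact mul_le_mul_of_nonneg_right (hg.abs_riesz_le hμ0 hμ1 x) (abs_nonneg _)

theorem riesz_congr {g g' : ℝ → ℝ} (h : g =ᵐ[volume] g') : riesz μ g = riesz μ g' := by
  funext x
  refine integral_congr_ae ?_
  filter_upwards [h] with y hy
  rw [hy]

theorem pairing_congr {g g' h h' : ℝ → ℝ} (hg : g =ᵐ[volume] g') (hh : h =ᵐ[volume] h') :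
    pairing μ g h = pairing μ g' h' := by
  rw [pairing, pairing, riesz_congr hg]
  refine integral_congr_ae ?_
  filter_upwards [hh] with y hy
  rw [hy]

theorem pairing_add_right (hμ0 : 0 < μ) (hμ1 : μ < 1) {g h h' : ℝ → ℝ} (hg : Tame μ g)
    (hh : Integrable h) (hh' : Integrable h') :
    pairing μ g (fun x => h x + h' x) = pairing μ g h + pairing μ g h' := by
  simp only [pairing, mul_add]
  exact integral_add (hg.integrable_riesz_mul hμ0 hμ1 hh) (hg.integrable_riesz_mul hμ0 hμ1 hh')

theorem pairing_const_mul_right (c : ℝ) (g h : ℝ → ℝ) :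
    pairing μ g (fun x => c * h x) = c * pairing μ g h := by
  simp only [pairing, mul_left_comm _ c]
  exact integral_const_mul _ _

theorem pairing_sub_right (hμ0 : 0 < μ) (hμ1 : μ < 1) {g h h' : ℝ → ℝ} (hg : Tame μ g)
    (hh : Integrable h) (hh' : Integrable h') :
    pairing μ g (fun x => h x - h' x) = pairing μ g h - pairing μ g h' := by
  simp only [pairing, mul_sub]
  exact integral_sub (hg.integrable_riesz_mul hμ0 hμ1 hh) (hg.integrable_riesz_mul hμ0 hμ1 hh')

theorem riesz_add (hμ0 : 0 < μ) (hμ1 : μ < 1) {g g' : ℝ → ℝ} (hg : Tame μ g) (hg' : Tame μ g')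
    (x : ℝ) : riesz μ (fun y => g y + g' y) x = riesz μ g x + riesz μ g' x := by
  simp only [riesz, mul_add]
  exact integral_add (hg.integrable_kernel_mul hμ0 hμ1 x) (hg'.integrable_kernel_mul hμ0 hμ1 x)

theorem riesz_const_mul (c : ℝ) (g : ℝ → ℝ) (x : ℝ) :
    riesz μ (fun y => c * g y) x = c * riesz μ g x := by
  simp only [riesz, mul_left_comm _ c]
  exact integral_const_mul _ _

theorem pairing_const_mul_left (c : ℝ) (g h : ℝ → ℝ) :
    pairing μ (fun x => c * g x) h = c * pairing μ g h := by
  simp only [pairing, riesz_const_mul, mul_assoc]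
  exact integral_const_mul _ _

theorem pairing_add_left (hμ0 : 0 < μ) (hμ1 : μ < 1) {g g' h : ℝ → ℝ} (hg : Tame μ g)
    (hg' : Tame μ g') (hh : Integrable h) :
    pairing μ (fun x => g x + g' x) h = pairing μ g h + pairing μ g' h := by
  simp only [pairing, riesz_add hμ0 hμ1 hg hg', add_mul]
  exact integral_add (hg.integrable_riesz_mul hμ0 hμ1 hh) (hg'.integrable_riesz_mul hμ0 hμ1 hh)

theorem Tame.integrable_prod (hμ0 : 0 < μ) (hμ1 : μ < 1) {g h : ℝ → ℝ} (hg : Tame μ g)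
    (hh : Integrable h) :
    Integrable fun z : ℝ × ℝ => (1 / |z.1 - z.2| ^ μ * g z.2) * h z.1 := by
  have hm : AEStronglyMeasurable
      (fun z : ℝ × ℝ => (1 / |z.1 - z.2| ^ μ * g z.2) * h z.1) volume :=
    (aestronglyMeasurable_kernel_mul hg.1.1).mul hh.1.comp_fst
  refine (integrable_prod_iff hm).2 ⟨Eventually.of_forall fun x =>
    (hg.integrable_kernel_mul hμ0 hμ1 x).mul_const (h x), ?_⟩
  refine (hh.abs.const_mul (tameNorm μ g)).mono' hm.norm.integral_prod_right'
    (Eventually.of_forall fun x => ?_)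
  rw [Real.norm_of_nonneg (integral_nonneg fun y => norm_nonneg _)]
  simp only [norm_mul _ (h _), Real.norm_eq_abs]
  rw [integral_mul_const]
  exact mul_le_mul_of_nonneg_right (hg.integral_abs_kernel_mul_le hμ0 hμ1 x) (abs_nonneg _)

/-- Fubini and the symmetry of the kernel. -/
theorem pairing_comm (hμ0 : 0 < μ) (hμ1 : μ < 1) {g h : ℝ → ℝ} (hg : Tame μ g)
    (hh : Integrable h) : pairing μ g h = pairing μ h g := by
  have h1 : pairing μ g h = ∫ x, ∫ y, (1 / |x - y| ^ μ * g y) * h x := by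
    simp only [pairing, riesz, integral_mul_const]
  have h2 : pairing μ h g = ∫ y, ∫ x, (1 / |x - y| ^ μ * g y) * h x := by
    simp only [pairing, riesz, ← integral_mul_const]
    refine integral_congr_ae (Eventually.of_forall fun y =>
      integral_congr_ae (Eventually.of_forall fun x => ?_))
    simp only [abs_sub_comm x y]
    ring
  rw [h1, h2]
  exact integral_integral_swap (hg.integrable_prod hμ0 hμ1 hh)

theorem riesz_mono (hμ0 : 0 < μ) (hμ1 : μ < 1) {g g' : ℝ → ℝ} (hg : Tame μ g) (hg' : Tame μ g')
    (h : ∀ᵐ x, g x ≤ g' x) (x : ℝ) : riesz μ g x ≤ riesz μ g' x := by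
  refine integral_mono_ae (hg.integrable_kernel_mul hμ0 hμ1 x)
    (hg'.integrable_kernel_mul hμ0 hμ1 x) ?_
  filter_upwards [h] with y hy
  exact mul_le_mul_of_nonneg_left hy (by positivity)

theorem riesz_nonneg {g : ℝ → ℝ} (h : ∀ᵐ x, 0 ≤ g x) (x : ℝ) : 0 ≤ riesz μ g x := by
  refine integral_nonneg_of_ae ?_
  filter_upwards [h] with y hy
  exact mul_nonneg (by positivity) hy

theorem pairing_mono (hμ0 : 0 < μ) (hμ1 : μ < 1) {g g' h h' : ℝ → ℝ} (hg : Tame μ g)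
    (hg' : Tame μ g') (hh : Integrable h) (hh' : Integrable h') (hg0 : ∀ᵐ x, 0 ≤ g' x)
    (hh0 : ∀ᵐ x, 0 ≤ h x) (hgg : ∀ᵐ x, g x ≤ g' x) (hhh : ∀ᵐ x, h x ≤ h' x) :
    pairing μ g h ≤ pairing μ g' h' := by
  refine integral_mono_ae (hg.integrable_riesz_mul hμ0 hμ1 hh)
    (hg'.integrable_riesz_mul hμ0 hμ1 hh') ?_
  filter_upwards [hh0, hhh] with x h1 h2
  exact mul_le_mul (riesz_mono hμ0 hμ1 hg hg' hgg x) h2 h1 (riesz_nonneg hg0 x)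

theorem Tame.mono {g G : ℝ → ℝ} (hμ1 : μ < 1) (hG : Tame μ G) (hm : AEStronglyMeasurable g volume)
    (h : ∀ᵐ x, |g x| ≤ G x) : Tame μ g := by
  refine ⟨hG.1.mono' hm h, hG.2.mono' ?_ ?_⟩
  · exact (hm.aemeasurable.abs.pow_const _).aestronglyMeasurable
  · filter_upwards [h] with x hx
    rw [Real.norm_of_nonneg (by positivity)]
    exact Real.rpow_le_rpow (abs_nonneg _) (hx.trans (le_abs_self _))
      (div_nonneg zero_le_two (by linarith))

theorem Tame.const_mul {g : ℝ → ℝ} (c : ℝ) (hg : Tame μ g) : Tame μ fun x => c * g x := by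
  refine ⟨hg.1.const_mul c, ?_⟩
  simp only [abs_mul, Real.mul_rpow (abs_nonneg c) (abs_nonneg _)]
  exact hg.2.const_mul _

theorem Tame.tendsto_tameNorm_zero {g : ℕ → ℝ → ℝ} {G : ℝ → ℝ} (hμ1 : μ < 1) (hG : Tame μ G)
    (hm : ∀ n, AEStronglyMeasurable (g n) volume) (h : ∀ᵐ x, ∀ n, |g n x| ≤ G x)
    (h0 : ∀ᵐ x, Tendsto (fun n => g n x) atTop (𝓝 0)) :
    Tendsto (fun n => tameNorm μ (g n)) atTop (𝓝 0) := by
  have hq : 0 < 2 / (1 - μ) := div_pos two_pos (by linarith)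
  have h1 : Tendsto (fun n => ∫ x, |g n x|) atTop (𝓝 (∫ _ : ℝ, (0 : ℝ))) := by
    refine tendsto_integral_of_dominated_convergence G (fun n => (hm n).norm) hG.1
      (fun n => ?_) ?_
    · filter_upwards [h] with x hx
      simpa using hx n
    · filter_upwards [h0] with x hx
      simpa using hx.abs
  have h2 : Tendsto (fun n => ∫ x, |g n x| ^ (2 / (1 - μ))) atTop (𝓝 (∫ _ : ℝ, (0 : ℝ))) := by
    refine tendsto_integral_of_dominated_convergence _
      (fun n => ((hm n).aemeasurable.abs.pow_const _).aestronglyMeasurable) hG.2 (fun n => ?_) ?_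
    · filter_upwards [h] with x hx
      rw [Real.norm_of_nonneg (by positivity)]
      exact Real.rpow_le_rpow (abs_nonneg _) ((hx n).trans (le_abs_self _)) hq.le
    · filter_upwards [h0] with x hx
      have := hx.abs.rpow_const (p := 2 / (1 - μ)) (Or.inr hq.le)
      rwa [abs_zero, Real.zero_rpow hq.ne'] at this
  rw [integral_zero] at h1 h2
  have h3 := h2.rpow_const (p := 1 / (2 / (1 - μ))) (Or.inr (by positivity))
  rw [Real.zero_rpow (by positivity)] at h3
  have h4 := (h3.const_mul ((∫ z, nearKernel μ z ^ (2 / (1 + μ))) ^ (1 / (2 / (1 + μ))))).add h1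
  rw [mul_zero, add_zero] at h4
  exact h4

/-- The function `t² exp(α t²)`, which dominates the nonlinearities. -/
def expWeight (α t : ℝ) : ℝ := t ^ 2 * Real.exp (α * t ^ 2)

theorem expWeight_nonneg (α t : ℝ) : 0 ≤ expWeight α t := by unfold expWeight; positivity

theorem expWeight_le_of_abs_le {α s t : ℝ} (hα : 0 ≤ α) (h : |s| ≤ t) :
    expWeight α s ≤ expWeight α t := by
  have h1 : s ^ 2 ≤ t ^ 2 := sq_le_sq' (abs_le.1 h).1 (abs_le.1 h).2
  unfold expWeight
  gcongr

theorem HHalf.integrable_expWeight (u : HHalf) {α : ℝ} (hα : 0 ≤ α) :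
    Integrable fun x => expWeight α (u x) :=
  integrable_sq_mul_exp u.measurable_coe u.memLp u.memLp_quot hα

theorem tame_expWeight (hμ0 : 0 < μ) (hμ1 : μ < 1) {α : ℝ} (hα : 0 ≤ α) (u : HHalf) :
    Tame μ fun x => expWeight α (u x) := by
  refine ⟨u.integrable_expWeight hα, ?_⟩
  set q := 2 / (1 - μ)
  have hq : 1 ≤ q := by
    rw [one_le_div (by linarith)]; linarith
  have hm := u.measurable_coe
  -- With s = u², s^q ≤ s exp((q − 1)s), so the q-th power of the weight is again below a weight of
  -- the same type.
  refine (u.integrable_expWeight (α := α * q + (q - 1)) (by nlinarith)).mono' ?_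
    (Eventually.of_forall fun x => ?_)
  · exact (by unfold expWeight; fun_prop : Measurable fun x => |expWeight α (u x)| ^ q).aestronglyMeasurable
  · rw [Real.norm_of_nonneg (by positivity), abs_of_nonneg (expWeight_nonneg _ _), expWeight,
      expWeight, Real.mul_rpow (sq_nonneg _) (Real.exp_nonneg _), ← Real.exp_mul]
    set s := u x ^ 2
    have hs : 0 ≤ s := sq_nonneg _
    have h1 : s ^ q ≤ s * Real.exp ((q - 1) * s) := by
      rcases hs.eq_or_lt with h | h
      · rw [← h, Real.zero_rpow (by linarith)]; simp
      · have h2 : s ^ q = s * s ^ (q - 1) := by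
          rw [Real.rpow_sub_one h.ne']; field_simp
        rw [h2, mul_comm (q - 1), Real.exp_mul]
        have h3 : s ≤ Real.exp s := by linarith [Real.add_one_le_exp s]
        have h4 : s ^ (q - 1) ≤ Real.exp s ^ (q - 1) := Real.rpow_le_rpow hs h3 (by linarith)
        gcongr
    calc s ^ q * Real.exp (α * s * q) ≤ s * Real.exp ((q - 1) * s) * Real.exp (α * s * q) := by gcongr
      _ = s * Real.exp ((α * q + (q - 1)) * s) := by
        rw [mul_assoc, ← Real.exp_add]; ring_nf

end

/-! ### The Choquard functional: continuity and strict differentiability. -/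

section

variable {μ : ℝ}

theorem tameNorm_mono {g G : ℝ → ℝ} (hμ1 : μ < 1) (hG : Tame μ G)
    (hm : AEStronglyMeasurable g volume) (h : ∀ᵐ x, |g x| ≤ G x) : tameNorm μ g ≤ tameNorm μ G := by
  have hg := hG.mono hμ1 hm h
  have hq : 0 < 2 / (1 - μ) := div_pos two_pos (by linarith)
  have h1 : ∫ x, |g x| ≤ ∫ x, |G x| := integral_mono_ae hg.1.abs hG.1.abs (by
    filter_upwards [h] with x hx using hx.trans (le_abs_self _))
  have h2 : ∫ x, |g x| ^ (2 / (1 - μ)) ≤ ∫ x, |G x| ^ (2 / (1 - μ)) :=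
    integral_mono_ae hg.2 hG.2 (by
      filter_upwards [h] with x hx
      exact Real.rpow_le_rpow (abs_nonneg _) (hx.trans (le_abs_self _)) hq.le)
  have h3 : 0 ≤ ∫ z, nearKernel μ z ^ (2 / (1 + μ)) :=
    integral_nonneg fun z => Real.rpow_nonneg (nearKernel_nonneg z) _
  have h4 : 0 ≤ ∫ x, |g x| ^ (2 / (1 - μ)) := integral_nonneg fun z => by positivity
  unfold tameNorm
  gcongr

theorem integral_abs_mul_le_sqrt {a b : ℝ → ℝ} (ha : MemLp a 2 volume) (hb : MemLp b 2 volume) :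
    ∫ x, |a x * b x| ≤ √(∫ x, a x ^ 2) * √(∫ x, b x ^ 2) := by
  have h2 : (2 : ENNReal) = ENNReal.ofReal 2 := by simp
  have h := integral_mul_norm_le_Lp_mul_Lq Real.HolderConjugate.two_two (f := a) (g := b)
    (by rwa [← h2]) (by rwa [← h2])
  simpa only [Real.norm_eq_abs, ← abs_mul, Real.rpow_two, sq_abs, ← Real.sqrt_eq_rpow] using h

theorem tame_comp (hμ0 : 0 < μ) (hμ1 : μ < 1) {h : ℝ → ℝ} (hc : Continuous h) {C α : ℝ}
    (hα : 0 ≤ α) (hb : ∀ t, |h t| ≤ C * expWeight α t) (u : HHalf) : Tame μ fun x => h (u x) :=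
  ((tame_expWeight hμ0 hμ1 hα u).const_mul C).mono hμ1
    (hc.measurable.comp u.measurable_coe).aestronglyMeasurable
    (Eventually.of_forall fun _ => hb _)

theorem abs_le_of_tendsto_of_abs_le {s : ℕ → ℝ} {p g : ℝ} (h : Tendsto s atTop (𝓝 p))
    (hb : ∀ n, |s n| ≤ g) : |p| ≤ g :=
  le_of_tendsto h.abs (Eventually.of_forall hb)

theorem abs_comp_le {h : ℝ → ℝ} {C α : ℝ} (hC : 0 ≤ C) (hα : 0 ≤ α)
    (hb : ∀ t, |h t| ≤ C * expWeight α t) {s g : ℝ} (hs : |s| ≤ g) : |h s| ≤ C * expWeight α g :=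
  (hb s).trans (mul_le_mul_of_nonneg_left (expWeight_le_of_abs_le hα hs) hC)

/-- Continuity on `H^{1/2}(ℝ)` of `u ↦ ∫ (I_μ * g(u)) h(u) dx` for nonlinearities of exponential
growth that vanish quadratically at the origin. -/
theorem continuous_pairing_comp (hμ0 : 0 < μ) (hμ1 : μ < 1) {g h : ℝ → ℝ} (hg : Continuous g)
    (hh : Continuous h) {C α : ℝ} (hC : 0 ≤ C) (hα : 0 ≤ α)
    (hgb : ∀ t, |g t| ≤ C * expWeight α t) (hhb : ∀ t, |h t| ≤ C * expWeight α t) :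
    Continuous fun u : HHalf => pairing μ (fun x => g (u x)) (fun x => h (u x)) := by
  refine continuous_iff_continuousAt.2 fun p => ?_
  -- Dominated convergence is available only along subsequences, and that suffices for continuity.
  refine tendsto_of_subseq_tendsto fun u hu => ?_
  obtain ⟨φ, hφ, G, hG, hlim⟩ := HHalf.exists_subseq_dominated hu
  refine ⟨φ, ?_⟩
  have htg := fun u : HHalf => tame_comp hμ0 hμ1 hg hα hgb u
  have hth := fun u : HHalf => tame_comp hμ0 hμ1 hh hα hhb u
  set W : ℝ → ℝ := fun x => C * expWeight α (G x)
  have hW : Tame μ W := (tame_expWeight hμ0 hμ1 hα G).const_mul C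
  have hW2 : Tame μ fun x => 2 * W x := hW.const_mul 2
  have hpG : ∀ᵐ x, |p x| ≤ G x := by
    filter_upwards [hG, hlim] with x h1 h2 using abs_le_of_tendsto_of_abs_le h2 h1
  have key : ∀ k : ℝ → ℝ, Continuous k → (∀ t, |k t| ≤ C * expWeight α t) →
      Tendsto (fun n => tameNorm μ fun x => k (u (φ n) x) - k (p x)) atTop (𝓝 0) := by
    intro k hk hkb
    refine hW2.tendsto_tameNorm_zero hμ1 (fun n => ?_) ?_ ?_
    · exact ((hk.measurable.comp (u (φ n)).measurable_coe).sub
        (hk.measurable.comp p.measurable_coe)).aestronglyMeasurable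
    · filter_upwards [hG, hpG] with x h1 h2 n
      have h3 := abs_comp_le hC hα hkb (h1 n)
      have h4 := abs_comp_le hC hα hkb h2
      have h5 := abs_sub (k (u (φ n) x)) (k (p x))
      change _ ≤ 2 * (C * expWeight α (G x))
      linarith
    · filter_upwards [hlim] with x h1
      have := ((hk.tendsto _).comp h1).sub_const (k (p x))
      rwa [sub_self] at this
  have hT : ∀ n, (tameNorm μ fun x => h (u (φ n) x)) ≤ tameNorm μ W := fun n => by
    refine tameNorm_mono hμ1 hW (hth _).1.1 ?_
    filter_upwards [hG] with x h1 using abs_comp_le hC hα hhb (h1 n)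
  have hle : ∀ k : ℝ → ℝ, 0 ≤ ∫ x, |k x| := fun k => integral_nonneg fun x => abs_nonneg _
  have hint : ∀ k : ℝ → ℝ, ∫ x, |k x| ≤ tameNorm μ k := fun k => by
    have h1 : 0 ≤ ∫ z, nearKernel μ z ^ (2 / (1 + μ)) :=
      integral_nonneg fun z => Real.rpow_nonneg (nearKernel_nonneg z) _
    have h2 : 0 ≤ ∫ x, |k x| ^ (2 / (1 - μ)) := integral_nonneg fun z => by positivity
    unfold tameNorm
    have : 0 ≤ (∫ z, nearKernel μ z ^ (2 / (1 + μ))) ^ (1 / (2 / (1 + μ))) *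
      (∫ x, |k x| ^ (2 / (1 - μ))) ^ (1 / (2 / (1 - μ))) := by positivity
    linarith
  have hsub : ∀ k : ℝ → ℝ, Continuous k → (∀ t, |k t| ≤ C * expWeight α t) → ∀ n,
      Tame μ fun x => k (u (φ n) x) - k (p x) := by
    intro k hk hkb n
    refine hW2.mono hμ1 ((hk.measurable.comp (u (φ n)).measurable_coe).sub
        (hk.measurable.comp p.measurable_coe)).aestronglyMeasurable ?_
    filter_upwards [hG, hpG] with x h1 h2
    have h3 := abs_comp_le hC hα hkb (h1 n)
    have h4 := abs_comp_le hC hα hkb h2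
    have h5 := abs_sub (k (u (φ n) x)) (k (p x))
    change _ ≤ 2 * (C * expWeight α (G x))
    linarith
  rw [tendsto_iff_norm_sub_tendsto_zero]
  have hlim0 : Tendsto (fun n => (tameNorm μ fun x => g (u (φ n) x) - g (p x)) * tameNorm μ W +
      (tameNorm μ fun x => g (p x)) * tameNorm μ fun x => h (u (φ n) x) - h (p x)) atTop (𝓝 0) := by
    have := ((key g hg hgb).mul_const (tameNorm μ W)).add
      ((key h hh hhb).const_mul (tameNorm μ fun x => g (p x)))
    rwa [zero_mul, mul_zero, add_zero] at this
  refine squeeze_zero (fun n => norm_nonneg _) (fun n => ?_) hlim0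
  have e1 : pairing μ (fun x => g (u (φ n) x)) (fun x => h (u (φ n) x)) =
      pairing μ (fun x => g (u (φ n) x) - g (p x)) (fun x => h (u (φ n) x)) +
        pairing μ (fun x => g (p x)) (fun x => h (u (φ n) x)) := by
    rw [← pairing_add_left hμ0 hμ1 (hsub g hg hgb n) (htg p) (hth _).1]
    simp only [sub_add_cancel]
  have e2 : pairing μ (fun x => g (p x)) (fun x => h (u (φ n) x) - h (p x)) =
      pairing μ (fun x => g (p x)) (fun x => h (u (φ n) x)) -
        pairing μ (fun x => g (p x)) (fun x => h (p x)) :=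
    pairing_sub_right hμ0 hμ1 (htg p) (hth _).1 (hth p).1
  have e3 : pairing μ (fun x => g (u (φ n) x)) (fun x => h (u (φ n) x)) -
      pairing μ (fun x => g (p x)) (fun x => h (p x)) =
      pairing μ (fun x => g (u (φ n) x) - g (p x)) (fun x => h (u (φ n) x)) +
      pairing μ (fun x => g (p x)) (fun x => h (u (φ n) x) - h (p x)) := by
    rw [e1, e2]; ring
  rw [e3, Real.norm_eq_abs]
  refine (abs_add_le _ _).trans (add_le_add ?_ ?_)
  · refine ((hsub g hg hgb n).abs_pairing_le hμ0 hμ1 (hth _).1).trans ?_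
    exact mul_le_mul_of_nonneg_left ((hint _).trans (hT n)) (tameNorm_nonneg _)
  · refine ((htg p).abs_pairing_le hμ0 hμ1 (hsub h hh hhb n).1).trans ?_
    exact mul_le_mul_of_nonneg_left (hint _) (tameNorm_nonneg _)

section Nonlinearity

variable {f : ℝ → ℝ} {C : ℝ}

theorem hasDerivAt_prim (hf : Continuous f) (t : ℝ) : HasDerivAt (prim f) (f t) t :=
  intervalIntegral.integral_hasDerivAt_right (hf.intervalIntegrable _ _)
    (hf.stronglyMeasurableAtFilter _ _) hf.continuousAt

theorem continuous_prim (hf : Continuous f) : Continuous (prim f) :=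
  continuous_iff_continuousAt.2 fun t => (hasDerivAt_prim hf t).continuousAt

theorem abs_mul_self_le (hb : ∀ t, |f t| ≤ C * (|t| * Real.exp (4 * t ^ 2))) (t : ℝ) :
    |f t * t| ≤ C * expWeight 4 t := by
  rw [abs_mul, expWeight, ← sq_abs t, sq_abs t]
  calc |f t| * |t| ≤ C * (|t| * Real.exp (4 * t ^ 2)) * |t| := by gcongr; exact hb t
    _ = C * (|t| ^ 2 * Real.exp (4 * t ^ 2)) := by ring
    _ = _ := by rw [sq_abs]

theorem abs_le_of_abs_le_exp (hC : 0 ≤ C) (hb : ∀ t, |f t| ≤ C * (|t| * Real.exp (4 * t ^ 2)))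
    {s g : ℝ} (h : |s| ≤ g) : |f s| ≤ C * (g * Real.exp (4 * g ^ 2)) := by
  refine (hb s).trans ?_
  have h0 : 0 ≤ g := (abs_nonneg s).trans h
  have h1 : s ^ 2 ≤ g ^ 2 := sq_le_sq' (abs_le.1 h).1 (abs_le.1 h).2
  gcongr

theorem abs_prim_le (hC : 0 ≤ C) (hb : ∀ t, |f t| ≤ C * (|t| * Real.exp (4 * t ^ 2))) (t : ℝ) :
    |prim f t| ≤ C * expWeight 4 t := by
  have h1 : ‖∫ s in (0 : ℝ)..t, f s‖ ≤ C * (|t| * Real.exp (4 * |t| ^ 2)) * |t - 0| := by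
    refine intervalIntegral.norm_integral_le_of_norm_le_const fun s hs => ?_
    refine abs_le_of_abs_le_exp hC hb ?_
    rcases le_total 0 t with h | h
    · rw [uIoc_of_le h] at hs
      rw [abs_of_pos hs.1, abs_of_nonneg h]; exact hs.2
    · rw [uIoc_of_ge h] at hs
      rw [abs_of_nonpos hs.2, abs_of_nonpos h]; linarith [hs.1]
  rw [sub_zero, sq_abs] at h1
  refine h1.trans (le_of_eq ?_)
  rw [expWeight, ← sq_abs t, sq_abs t]
  calc C * (|t| * Real.exp (4 * t ^ 2)) * |t| = C * (|t| ^ 2 * Real.exp (4 * t ^ 2)) := by ring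
    _ = _ := by rw [sq_abs]

theorem memLp_comp (hf : Continuous f)
    (hb : ∀ t, |f t| ≤ C * (|t| * Real.exp (4 * t ^ 2))) (u : HHalf) :
    MemLp (fun x => f (u x)) 2 volume := by
  have hm : Measurable fun x => f (u x) := hf.measurable.comp u.measurable_coe
  rw [memLp_two_iff_integrable_sq hm.aestronglyMeasurable]
  refine ((u.integrable_expWeight (α := 8) (by norm_num)).const_mul (C ^ 2)).mono'
    (hm.pow_const 2).aestronglyMeasurable (Eventually.of_forall fun x => ?_)
  rw [Real.norm_of_nonneg (sq_nonneg _), ← sq_abs, expWeight]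
  calc |f (u x)| ^ 2 ≤ (C * (|u x| * Real.exp (4 * u x ^ 2))) ^ 2 := by gcongr; exact hb _
    _ = C ^ 2 * (u x ^ 2 * Real.exp (8 * u x ^ 2)) := by
      rw [mul_pow, mul_pow, sq_abs, ← Real.exp_nat_mul]; ring_nf

theorem integrable_comp_mul (hf : Continuous f)
    (hb : ∀ t, |f t| ≤ C * (|t| * Real.exp (4 * t ^ 2))) (u φ : HHalf) :
    Integrable fun x => f (u x) * φ x :=
  (memLp_comp hf hb u).integrable_mul φ.memLp

/-- The Choquard functional `∫ (I_μ * F(u)) F(u) dx`. -/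
def choquard (μ : ℝ) (f : ℝ → ℝ) (u : HHalf) : ℝ :=
  pairing μ (fun x => prim f (u x)) (fun x => prim f (u x))

theorem tame_prim (hμ0 : 0 < μ) (hμ1 : μ < 1) (hf : Continuous f) (hC : 0 ≤ C)
    (hb : ∀ t, |f t| ≤ C * (|t| * Real.exp (4 * t ^ 2))) (u : HHalf) :
    Tame μ fun x => prim f (u x) :=
  tame_comp hμ0 hμ1 (continuous_prim hf) (by norm_num) (abs_prim_le hC hb) u

/-- The derivative `φ ↦ 2 ∫ (I_μ * F(u)) f(u) φ dx` of the Choquard functional. -/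
def choquardDeriv (hμ0 : 0 < μ) (hμ1 : μ < 1) (hf : Continuous f) (hC : 0 ≤ C)
    (hb : ∀ t, |f t| ≤ C * (|t| * Real.exp (4 * t ^ 2))) (p : HHalf) : HHalf →L[ℝ] ℝ :=
  LinearMap.mkContinuous
    { toFun := fun φ => 2 * pairing μ (fun x => prim f (p x)) (fun x => f (p x) * φ x)
      map_add' := fun φ ψ => by
        have h1 : (fun x => f (p x) * (φ + ψ) x) =ᵐ[volume]
            fun x => f (p x) * φ x + f (p x) * ψ x := by
          filter_upwards [HHalf.coe_add φ ψ] with x hx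
          rw [hx, Pi.add_apply, mul_add]
        rw [pairing_congr (EventuallyEq.refl _ _) h1,
          pairing_add_right hμ0 hμ1 (tame_prim hμ0 hμ1 hf hC hb p)
            (integrable_comp_mul hf hb p φ)
            (integrable_comp_mul hf hb p ψ), mul_add]
      map_smul' := fun c φ => by
        have h1 : (fun x => f (p x) * (c • φ) x) =ᵐ[volume] fun x => c * (f (p x) * φ x) := by
          filter_upwards [HHalf.coe_smul c φ] with x hx
          rw [hx, Pi.smul_apply, smul_eq_mul, mul_left_comm]
        rw [pairing_congr (EventuallyEq.refl _ _) h1, pairing_const_mul_right, RingHom.id_apply,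
          smul_eq_mul, mul_left_comm] }
    (2 * ((tameNorm μ fun x => prim f (p x)) * √(∫ x, f (p x) ^ 2)))
    (fun φ => by
      have h1 := (tame_prim hμ0 hμ1 hf hC hb p).abs_pairing_le hμ0 hμ1
        (integrable_comp_mul hf hb p φ)
      have h2 := integral_abs_mul_le_sqrt (memLp_comp hf hb p) φ.memLp
      have h3 : √(∫ x, φ x ^ 2) ≤ ‖φ‖ := by
        rw [← HHalf.norm_toL2_sq, Real.sqrt_sq (norm_nonneg _)]
        exact HHalf.norm_toL2_le φ
      have h4 := tameNorm_nonneg (μ := μ) fun x => prim f (p x)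
      simp only [LinearMap.coe_mk, AddHom.coe_mk, norm_mul, Real.norm_eq_abs, Nat.abs_ofNat]
      rw [mul_assoc 2, mul_assoc (tameNorm μ _)]
      refine mul_le_mul_of_nonneg_left (h1.trans (mul_le_mul_of_nonneg_left (h2.trans ?_) h4))
        (by norm_num)
      gcongr)

theorem choquardDeriv_apply (hμ0 : 0 < μ) (hμ1 : μ < 1) (hf : Continuous f) (hC : 0 ≤ C)
    (hb : ∀ t, |f t| ≤ C * (|t| * Real.exp (4 * t ^ 2))) (p φ : HHalf) :
    choquardDeriv hμ0 hμ1 hf hC hb p φ =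
      2 * pairing μ (fun x => prim f (p x)) (fun x => f (p x) * φ x) := rfl

theorem exists_prim_sub_eq (hf : Continuous f) {s t : ℝ} (h : s ≠ t) :
    ∃ ξ ∈ uIcc s t, (prim f s - prim f t) / (s - t) = f ξ := by
  rcases lt_or_gt_of_ne h with h | h
  · obtain ⟨ξ, hξ, h1⟩ := exists_hasDerivAt_eq_slope (prim f) f h
      (continuous_prim hf).continuousOn fun x _ => hasDerivAt_prim hf x
    refine ⟨ξ, ?_, ?_⟩
    · rw [uIcc_of_le h.le]; exact Ioo_subset_Icc_self hξ
    · rw [h1, ← neg_sub (prim f t), ← neg_sub t s, neg_div_neg_eq]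
  · obtain ⟨ξ, hξ, h1⟩ := exists_hasDerivAt_eq_slope (prim f) f h
      (continuous_prim hf).continuousOn fun x _ => hasDerivAt_prim hf x
    refine ⟨ξ, ?_, h1.symm⟩
    rw [uIcc_of_ge h.le]; exact Ioo_subset_Icc_self hξ

/-- The defect of the difference quotient of the primitive of `f` from the value `f p`. -/
def slopeDefect (f : ℝ → ℝ) (s t p : ℝ) : ℝ :=
  -- The value 0 on the diagonal keeps `slopeDefect_mul` true without s ≠ t and the defect
  -- convergent to 0 when s and t tend to p.
  if s = t then 0 else (prim f s - prim f t) / (s - t) - f p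

theorem slopeDefect_mul (f : ℝ → ℝ) (s t p : ℝ) :
    slopeDefect f s t p * (s - t) = prim f s - prim f t - f p * (s - t) := by
  unfold slopeDefect
  split_ifs with h
  · simp [h]
  · have : s - t ≠ 0 := sub_ne_zero.2 h
    field_simp

theorem abs_slopeDefect_le (hf : Continuous f) (hC : 0 ≤ C)
    (hb : ∀ t, |f t| ≤ C * (|t| * Real.exp (4 * t ^ 2))) {s t p g : ℝ} (hs : |s| ≤ g)
    (ht : |t| ≤ g) (hp : |p| ≤ g) : |slopeDefect f s t p| ≤ 2 * (C * (g * Real.exp (4 * g ^ 2))) := by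
  have hg : 0 ≤ g := (abs_nonneg _).trans hs
  unfold slopeDefect
  split_ifs with h
  · rw [abs_zero]; positivity
  · obtain ⟨ξ, hξ, h1⟩ := exists_prim_sub_eq hf h
    rw [h1]
    have h2 : |ξ| ≤ g := by
      rw [abs_le] at hs ht ⊢
      exact uIcc_subset_Icc hs ht hξ
    have h3 := abs_le_of_abs_le_exp hC hb h2
    have h4 := abs_le_of_abs_le_exp hC hb hp
    have h5 := abs_sub (f ξ) (f p)
    linarith

/-- The difference quotient is a value of f between s and t by the mean value theorem, and f is
continuous at p. -/
theorem tendsto_slopeDefect (hf : Continuous f) {s t : ℕ → ℝ} {p : ℝ}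
    (hs : Tendsto s atTop (𝓝 p)) (ht : Tendsto t atTop (𝓝 p)) :
    Tendsto (fun n => slopeDefect f (s n) (t n) p) atTop (𝓝 0) := by
  rw [Metric.tendsto_atTop] at hs ht ⊢
  intro ε hε
  obtain ⟨δ, hδ, hfδ⟩ := Metric.continuous_iff.1 hf p ε hε
  obtain ⟨N, hN⟩ := hs δ hδ
  obtain ⟨M, hM⟩ := ht δ hδ
  refine ⟨max N M, fun n hn => ?_⟩
  rw [dist_zero_right, Real.norm_eq_abs]
  unfold slopeDefect
  split_ifs with h
  · rwa [abs_zero]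
  · obtain ⟨ξ, hξ, h1⟩ := exists_prim_sub_eq hf h
    rw [h1]
    refine hfδ ξ ?_
    have h2 := hN n (le_of_max_le_left hn)
    have h3 := hM n (le_of_max_le_right hn)
    have h4 : ξ ∈ Metric.ball p δ := by
      rw [Real.ball_eq_Ioo] at *
      rw [← Metric.mem_ball, Real.ball_eq_Ioo] at h2 h3
      exact ordConnected_Ioo.uIcc_subset h2 h3 hξ
    exact h4

/-- Difference of two squares for a symmetric bilinear form. -/
theorem choquard_sub (hμ0 : 0 < μ) (hμ1 : μ < 1) {g h : ℝ → ℝ} (hg : Tame μ g) (hh : Tame μ h) :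
    pairing μ g g - pairing μ h h =
      pairing μ (fun x => g x + h x) (fun x => g x - h x) := by
  have hi : Integrable fun x => g x - h x := hg.1.sub hh.1
  rw [pairing_add_left hμ0 hμ1 hg hh hi, pairing_sub_right hμ0 hμ1 hg hg.1 hh.1,
    pairing_sub_right hμ0 hμ1 hh hg.1 hh.1, pairing_comm hμ0 hμ1 hg hh.1]
  ring

theorem Tame.add (hμ1 : μ < 1) {g h : ℝ → ℝ} (hg : Tame μ g) (hh : Tame μ h) :
    Tame μ fun x => g x + h x := by
  have hpos : 0 < 2 / (1 - μ) := div_pos two_pos (by linarith)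
  refine ⟨hg.1.add hh.1, ?_⟩
  have h1 := ((hg.memLp hμ1).add (hh.memLp hμ1)).integrable_norm_rpow (by simpa using hμ1) (by simp)
  rwa [ENNReal.toReal_ofReal hpos.le] at h1

/-- Put S = F(U) + F(V), δ = U − V and write F(U) − F(V) = (w + f(p)) δ with w the slope defect. The
remainder is then the pairing of S with wδ plus that of S − 2F(p) with f(p)δ. By domination w → 0 in
L² and S − 2F(p) → 0 in the norm that bounds the potential, so both terms are o(‖δ‖). -/
theorem exists_subseq_choquard_sub_le (hμ0 : 0 < μ) (hμ1 : μ < 1) (hf : Continuous f) (hC : 0 ≤ C)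
    (hb : ∀ t, |f t| ≤ C * (|t| * Real.exp (4 * t ^ 2))) {u v : ℕ → HHalf} {p : HHalf}
    (hu : Tendsto u atTop (𝓝 p)) (hv : Tendsto v atTop (𝓝 p)) :
    ∃ φ : ℕ → ℕ, ∃ ε : ℕ → ℝ, Tendsto ε atTop (𝓝 0) ∧ ∀ n,
      |choquard μ f (u (φ n)) - choquard μ f (v (φ n)) -
        choquardDeriv hμ0 hμ1 hf hC hb p (u (φ n) - v (φ n))| ≤ ε n * ‖u (φ n) - v (φ n)‖ := by
  obtain ⟨φ, hφ, g₁, hg₁, hlim₁⟩ := HHalf.exists_subseq_dominated hu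
  obtain ⟨ψ, hψ, g₂, hg₂, hlim₂⟩ := HHalf.exists_subseq_dominated (hv.comp hφ.tendsto_atTop)
  set U : ℕ → HHalf := fun n => u (φ (ψ n))
  set V : ℕ → HHalf := fun n => v (φ (ψ n))
  set g := g₁ + g₂
  have hUV : ∀ᵐ x, ∀ n, |U n x| ≤ g x ∧ |V n x| ≤ g x := by
    filter_upwards [hg₁, hg₂, HHalf.coe_add g₁ g₂] with x h1 h2 h3 n
    have h4 := h1 (ψ n)
    have h5 := h2 n
    rw [h3, Pi.add_apply]
    have := abs_nonneg (u (φ (ψ n)) x)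
    have := abs_nonneg (v (φ (ψ n)) x)
    exact ⟨h4.trans (by simp only [Function.comp] at h5; linarith),
      h5.trans (by linarith)⟩
  have hlimU : ∀ᵐ x, Tendsto (fun n => U n x) atTop (𝓝 (p x)) := by
    filter_upwards [hlim₁] with x hx using hx.comp hψ.tendsto_atTop
  have hlimV : ∀ᵐ x, Tendsto (fun n => V n x) atTop (𝓝 (p x)) := hlim₂
  have hp : ∀ᵐ x, |p x| ≤ g x := by
    filter_upwards [hUV, hlimU] with x h1 h2
    exact abs_le_of_tendsto_of_abs_le h2 fun n => (h1 n).1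
  have hmF : Measurable (prim f) := (continuous_prim hf).measurable
  set w : ℕ → ℝ → ℝ := fun n x => slopeDefect f (U n x) (V n x) (p x)
  have hmw : ∀ n, Measurable (w n) := fun n => by
    have h1 := (U n).measurable_coe
    have h2 := (V n).measurable_coe
    have h3 := p.measurable_coe
    refine Measurable.ite (measurableSet_eq_fun h1 h2) measurable_const ?_
    exact (((hmF.comp h1).sub (hmF.comp h2)).div (h1.sub h2)).sub (hf.measurable.comp h3)
  have hwb : ∀ᵐ x, ∀ n, w n x ^ 2 ≤ (2 * C) ^ 2 * expWeight 8 (g x) := by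
    filter_upwards [hUV, hp] with x h1 h2 n
    have h3 := abs_slopeDefect_le hf hC hb (h1 n).1 (h1 n).2 h2
    rw [← sq_abs]
    calc |w n x| ^ 2 ≤ (2 * (C * (g x * Real.exp (4 * g x ^ 2)))) ^ 2 := by gcongr
      _ = (2 * C) ^ 2 * expWeight 8 (g x) := by
        rw [expWeight, mul_pow, mul_pow, mul_pow, ← Real.exp_nat_mul]; ring_nf
  have hdom : Integrable fun x => (2 * C) ^ 2 * expWeight 8 (g x) :=
    (g.integrable_expWeight (by norm_num)).const_mul _
  have hw2 : ∀ n, MemLp (w n) 2 volume := fun n => by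
    rw [memLp_two_iff_integrable_sq (hmw n).aestronglyMeasurable]
    refine hdom.mono' ((hmw n).pow_const 2).aestronglyMeasurable ?_
    filter_upwards [hwb] with x hx
    rw [Real.norm_of_nonneg (sq_nonneg _)]
    exact hx n
  have hwlim : Tendsto (fun n => √(∫ x, w n x ^ 2)) atTop (𝓝 0) := by
    have h1 : Tendsto (fun n => ∫ x, w n x ^ 2) atTop (𝓝 (∫ _ : ℝ, (0 : ℝ))) := by
      refine tendsto_integral_of_dominated_convergence _
        (fun n => ((hmw n).pow_const 2).aestronglyMeasurable) hdom (fun n => ?_) ?_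
      · filter_upwards [hwb] with x hx
        rw [Real.norm_of_nonneg (sq_nonneg _)]
        exact hx n
      · filter_upwards [hlimU, hlimV] with x h1 h2
        simpa using (tendsto_slopeDefect hf h1 h2).pow 2
    rw [integral_zero] at h1
    simpa using h1.sqrt
  have htF := fun u : HHalf => tame_prim hμ0 hμ1 hf hC hb u
  set W : ℝ → ℝ := fun x => C * expWeight 4 (g x)
  have hW : Tame μ W := (tame_expWeight hμ0 hμ1 (by norm_num) g).const_mul C
  set S : ℕ → ℝ → ℝ := fun n x => prim f (U n x) + prim f (V n x)
  set E : ℕ → ℝ → ℝ := fun n x => S n x + (-2) * prim f (p x)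
  have hS : ∀ n, Tame μ (S n) := fun n => (htF (U n)).add hμ1 (htF (V n))
  have hE : ∀ n, Tame μ (E n) := fun n => (hS n).add hμ1 ((htF p).const_mul (-2))
  have hFb : ∀ {s t : ℝ}, |s| ≤ t → |prim f s| ≤ C * expWeight 4 t := fun h =>
    abs_comp_le hC (by norm_num) (abs_prim_le hC hb) h
  have hSle : ∀ n, tameNorm μ (S n) ≤ tameNorm μ fun x => 2 * W x := fun n => by
    refine tameNorm_mono hμ1 (hW.const_mul 2) (hS n).1.1 ?_
    filter_upwards [hUV] with x h1
    have h2 := hFb (h1 n).1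
    have h3 := hFb (h1 n).2
    have h4 := abs_add_le (prim f (U n x)) (prim f (V n x))
    change _ ≤ 2 * (C * expWeight 4 (g x))
    exact h4.trans (by linarith)
  have hElim : Tendsto (fun n => tameNorm μ (E n)) atTop (𝓝 0) := by
    refine (hW.const_mul 4).tendsto_tameNorm_zero hμ1 (fun n => (hE n).1.1) ?_ ?_
    · filter_upwards [hUV, hp] with x h1 h2 n
      have h3 := hFb (h1 n).1
      have h4 := hFb (h1 n).2
      have h5 := hFb h2
      change |prim f (U n x) + prim f (V n x) + (-2) * prim f (p x)| ≤ 4 * (C * expWeight 4 (g x))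
      rw [abs_le] at *
      constructor <;> linarith [h3.1, h3.2, h4.1, h4.2, h5.1, h5.2]
    · filter_upwards [hlimU, hlimV] with x h1 h2
      have hc := continuous_prim hf
      have h3 := (((hc.tendsto _).comp h1).add ((hc.tendsto _).comp h2)).add_const
        ((-2) * prim f (p x))
      have h4 : prim f (p x) + prim f (p x) + (-2) * prim f (p x) = 0 := by ring
      rw [h4] at h3
      exact h3
  refine ⟨φ ∘ ψ, fun n => (tameNorm μ fun x => 2 * W x) * √(∫ x, w n x ^ 2) +
    tameNorm μ (E n) * √(∫ x, f (p x) ^ 2), ?_, fun n => ?_⟩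
  · have := (hwlim.const_mul (tameNorm μ fun x => 2 * W x)).add
      (hElim.mul_const (√(∫ x, f (p x) ^ 2)))
    rwa [mul_zero, zero_mul, add_zero] at this
  · change |choquard μ f (U n) - choquard μ f (V n) -
        choquardDeriv hμ0 hμ1 hf hC hb p (U n - V n)| ≤ _ * ‖U n - V n‖
    set δ : HHalf := U n - V n
    have hδ2 : √(∫ x, δ x ^ 2) ≤ ‖δ‖ := by
      rw [← HHalf.norm_toL2_sq, Real.sqrt_sq (norm_nonneg _)]
      exact HHalf.norm_toL2_le δ
    have hwδ : Integrable fun x => w n x * δ x := (hw2 n).integrable_mul δ.memLp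
    have hfδ : Integrable fun x => f (p x) * δ x := integrable_comp_mul hf hb p δ
    have hdec : (fun x => prim f (U n x) - prim f (V n x)) =ᵐ[volume]
        fun x => w n x * δ x + f (p x) * δ x := by
      filter_upwards [HHalf.coe_sub (U n) (V n)] with x hx
      have h1 := slopeDefect_mul f (U n x) (V n x) (p x)
      have h2 : δ x = U n x - V n x := hx
      rw [h2]
      change _ = slopeDefect f (U n x) (V n x) (p x) * (U n x - V n x) + _
      rw [h1]; ring
    have e1 : choquard μ f (U n) - choquard μ f (V n) =
        pairing μ (S n) (fun x => w n x * δ x) + pairing μ (S n) (fun x => f (p x) * δ x) := by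
      rw [choquard, choquard, choquard_sub hμ0 hμ1 (htF _) (htF _),
        pairing_congr (EventuallyEq.refl _ _) hdec]
      exact pairing_add_right hμ0 hμ1 (hS n) hwδ hfδ
    have e2 : pairing μ (E n) (fun x => f (p x) * δ x) =
        pairing μ (S n) (fun x => f (p x) * δ x) -
          2 * pairing μ (fun x => prim f (p x)) (fun x => f (p x) * δ x) := by
      rw [pairing_add_left hμ0 hμ1 (hS n) ((htF p).const_mul (-2)) hfδ, pairing_const_mul_left]
      ring
    have e3 : choquard μ f (U n) - choquard μ f (V n) - choquardDeriv hμ0 hμ1 hf hC hb p δ =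
        pairing μ (S n) (fun x => w n x * δ x) + pairing μ (E n) (fun x => f (p x) * δ x) := by
      rw [e1, e2, choquardDeriv_apply]; ring
    rw [e3, add_mul]
    refine (abs_add_le _ _).trans (add_le_add ?_ ?_)
    · refine ((hS n).abs_pairing_le hμ0 hμ1 hwδ).trans ?_
      rw [mul_assoc]
      refine mul_le_mul (hSle n) ?_ (integral_nonneg fun x => abs_nonneg _) (tameNorm_nonneg _)
      refine (integral_abs_mul_le_sqrt (hw2 n) δ.memLp).trans ?_
      gcongr
    · refine ((hE n).abs_pairing_le hμ0 hμ1 hfδ).trans ?_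
      rw [mul_assoc]
      refine mul_le_mul_of_nonneg_left ?_ (tameNorm_nonneg _)
      refine (integral_abs_mul_le_sqrt (memLp_comp hf hb p) δ.memLp).trans ?_
      gcongr

theorem hasStrictFDerivAt_choquard (hμ0 : 0 < μ) (hμ1 : μ < 1) (hf : Continuous f) (hC : 0 ≤ C)
    (hb : ∀ t, |f t| ≤ C * (|t| * Real.exp (4 * t ^ 2))) (p : HHalf) :
    HasStrictFDerivAt (choquard μ f) (choquardDeriv hμ0 hμ1 hf hC hb p) p := by
  rw [hasStrictFDerivAt_iff_isLittleO, Asymptotics.isLittleO_iff]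
  intro c hc
  -- A failure of the little-o produces a sequence of bad pairs tending to (p, p), which the
  -- subsequence estimate excludes.
  by_contra hcon
  obtain ⟨z, hz, hzc⟩ := exists_seq_forall_of_frequently (not_eventually.1 hcon)
  rw [nhds_prod_eq] at hz
  have hu : Tendsto (fun n => (z n).1) atTop (𝓝 p) := tendsto_fst.comp hz
  have hv : Tendsto (fun n => (z n).2) atTop (𝓝 p) := tendsto_snd.comp hz
  obtain ⟨φ, ε, hε, h⟩ := exists_subseq_choquard_sub_le hμ0 hμ1 hf hC hb hu hv
  obtain ⟨n, hn⟩ := (hε.eventually_lt_const hc).exists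
  refine hzc (φ n) ?_
  rw [Real.norm_eq_abs]
  refine (h n).trans ?_
  gcongr

end Nonlinearity

end

/-! ### Growth of the nonlinearity and scaling of the nonlocal terms. -/

/-- Near 0 the bound |f(t)| ≤ |t| follows from κ > 2 − μ > 1, for large |t| the growth condition
applies with exponent 4 > π, and in between f is bounded by compactness while |t| ≥ δ. -/
theorem exists_exp_bound {μ : ℝ} (hμ1 : μ < 1) {f : ℝ → ℝ} (hf : Continuous f)
    (h0 : ∃ κ : ℝ, 2 - μ < κ ∧ Tendsto (fun t : ℝ => |f t| / |t| ^ κ) (𝓝[≠] 0) (𝓝 0))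
    (hinf : ∀ α : ℝ, Real.pi < α →
        Tendsto (fun t : ℝ => |f t| / Real.exp (α * t ^ 2)) (cocompact ℝ) (𝓝 0)) :
    ∃ C : ℝ, 0 ≤ C ∧ ∀ t, |f t| ≤ C * (|t| * Real.exp (4 * t ^ 2)) := by
  obtain ⟨κ, hκ, h0⟩ := h0
  have hnear : ∀ᶠ t in 𝓝[≠] (0 : ℝ), |f t| ≤ |t| := by
    have h1 : ∀ᶠ t in 𝓝[≠] (0 : ℝ), |t| < 1 := by
      have : ∀ᶠ t in 𝓝 (0 : ℝ), |t| < 1 := by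
        have := (continuous_abs (G := ℝ)).tendsto 0
        rw [abs_zero] at this
        exact this.eventually_lt_const one_pos
      exact this.filter_mono nhdsWithin_le_nhds
    filter_upwards [h0.eventually_lt_const one_pos, h1, self_mem_nhdsWithin] with t h2 h3 h4
    have h5 : 0 < |t| := abs_pos.2 h4
    rw [div_lt_one (by positivity)] at h2
    have h6 : |t| ^ κ ≤ |t| ^ (1 : ℝ) :=
      Real.rpow_le_rpow_of_exponent_ge h5 h3.le (by linarith)
    rw [Real.rpow_one] at h6
    linarith
  have hf0 : f 0 = 0 := by
    have h1 : Tendsto (fun t => |f t|) (𝓝[≠] 0) (𝓝 |f 0|) :=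
      (hf.abs.tendsto 0).mono_left nhdsWithin_le_nhds
    have h2 : Tendsto (fun t : ℝ => |t|) (𝓝[≠] 0) (𝓝 |0|) :=
      ((continuous_abs (G := ℝ)).tendsto 0).mono_left nhdsWithin_le_nhds
    have h3 := le_of_tendsto_of_tendsto h1 h2 hnear
    rw [abs_zero] at h3
    exact abs_eq_zero.1 (le_antisymm h3 (abs_nonneg _))
  obtain ⟨δ, hδ, hδb⟩ : ∃ δ > 0, ∀ t, |t| < δ → |f t| ≤ |t| := by
    rw [eventually_nhdsWithin_iff, Metric.eventually_nhds_iff] at hnear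
    obtain ⟨δ, hδ, h⟩ := hnear
    refine ⟨δ, hδ, fun t ht => ?_⟩
    rcases eq_or_ne t 0 with rfl | h1
    · simp [hf0]
    · exact h (by simpa using ht) h1
  have hfar := (hinf 4 Real.pi_lt_four).eventually_lt_const one_pos
  rw [← Metric.cobounded_eq_cocompact, ← comap_norm_atTop, eventually_comap,
    eventually_atTop] at hfar
  obtain ⟨R, hR⟩ := hfar
  obtain ⟨M, hM⟩ := (isCompact_Icc (a := -|R|) (b := |R|)).exists_bound_of_continuousOn
    hf.continuousOn
  have hM0 : 0 ≤ M := (norm_nonneg _).trans (hM 0 (by simp))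
  refine ⟨1 + M / δ + 1 / δ, by positivity, fun t => ?_⟩
  have hexp : 1 ≤ Real.exp (4 * t ^ 2) := Real.one_le_exp (by positivity)
  have hexp0 := Real.exp_pos (4 * t ^ 2)
  have hMδ : 0 ≤ M / δ := by positivity
  have hδ' : 0 < 1 / δ := by positivity
  rcases lt_or_ge |t| δ with h1 | h1
  · calc |f t| ≤ |t| := hδb t h1
      _ = 1 * (|t| * 1) := by ring
      _ ≤ (1 + M / δ + 1 / δ) * (|t| * Real.exp (4 * t ^ 2)) := by
        gcongr; linarith
  · have ht0 : 0 < |t| := hδ.trans_le h1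
    rcases le_or_gt |t| |R| with h2 | h2
    · calc |f t| ≤ M := hM t (abs_le.1 h2)
        _ = M / δ * (δ * 1) := by field_simp
        _ ≤ (1 + M / δ + 1 / δ) * (|t| * Real.exp (4 * t ^ 2)) := by
          gcongr; linarith
    · have h3 := hR |t| ((le_abs_self R).trans h2.le) t rfl
      rw [div_lt_one hexp0] at h3
      calc |f t| ≤ 1 / δ * (δ * Real.exp (4 * t ^ 2)) := by
            rw [← mul_assoc, one_div_mul_cancel hδ.ne', one_mul]; exact h3.le
        _ ≤ (1 + M / δ + 1 / δ) * (|t| * Real.exp (4 * t ^ 2)) := by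
          gcongr; linarith

/-- The density `f(t) t - (2 - μ) F(t)` of the nonlocal part of the Pohozaev functional. -/
def pohoDensity (μ : ℝ) (f : ℝ → ℝ) (t : ℝ) : ℝ := f t * t - (2 - μ) * prim f t

/-- The hypotheses on the nonlinearity, with the growth conditions in integrated form. -/
structure Admissible (μ : ℝ) (f : ℝ → ℝ) (θ C : ℝ) : Prop where
  mu_pos : 0 < μ
  mu_lt_one : μ < 1
  cont : Continuous f
  nonneg : 0 ≤ C
  bound : ∀ t, |f t| ≤ C * (|t| * Real.exp (4 * t ^ 2))
  theta_gt : 3 - μ < θ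
  superlinear : ∀ t : ℝ, t ≠ 0 → 0 < θ * prim f t ∧ θ * prim f t ≤ t * f t
  antitone : AntitoneOn (fun t : ℝ => pohoDensity μ f t / |t| ^ (3 - μ)) (Iio 0)
  monotone : MonotoneOn (fun t : ℝ => pohoDensity μ f t / |t| ^ (3 - μ)) (Ioi 0)

theorem riesz_comp_mul_left (μ : ℝ) (g : ℝ → ℝ) {c : ℝ} (hc : 0 < c) (x : ℝ) :
    riesz μ (fun y => g (c * y)) x = c ^ (μ - 1) * riesz μ g (c * x) := by
  have h1 : ∀ y, 1 / |x - y| ^ μ * g (c * y) = c ^ μ * (1 / |c * x - c * y| ^ μ * g (c * y)) := by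
    intro y
    rw [← mul_sub, abs_mul, abs_of_pos hc, Real.mul_rpow hc.le (abs_nonneg _)]
    have : c ^ μ ≠ 0 := (Real.rpow_pos_of_pos hc μ).ne'
    rw [← mul_assoc, mul_one_div, div_mul_cancel_left₀ this, one_div]
  simp only [riesz, h1]
  rw [integral_const_mul, Measure.integral_comp_mul_left (fun y => 1 / |c * x - y| ^ μ * g y) c,
    abs_of_pos (inv_pos.2 hc), smul_eq_mul, Real.rpow_sub_one hc.ne']
  ring

theorem pairing_comp_mul_left (μ : ℝ) (g h : ℝ → ℝ) {c : ℝ} (hc : 0 < c) :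
    pairing μ (fun x => g (c * x)) (fun x => h (c * x)) = c ^ (μ - 2) * pairing μ g h := by
  simp only [pairing, riesz_comp_mul_left μ g hc, mul_assoc]
  rw [integral_const_mul, Measure.integral_comp_mul_left (fun x => riesz μ g x * h x) c,
    abs_of_pos (inv_pos.2 hc), smul_eq_mul, ← mul_assoc]
  have : c ^ (μ - 2) = c ^ (μ - 1) * c⁻¹ := by
    rw [← Real.rpow_neg_one, ← Real.rpow_add hc]; ring_nf
  rw [this]

/-- The substitution x ↦ τ² x removes the inner dilation; two integrations and the kernel of degree
−μ contribute (τ²)^(μ−2). -/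
theorem pairing_dilation (μ : ℝ) (g h : ℝ → ℝ) {τ : ℝ} (hτ : 0 < τ) (u : HHalf) :
    pairing μ (fun x => g (HHalf.dilation τ hτ u x)) (fun x => h (HHalf.dilation τ hτ u x)) =
      τ ^ (2 * μ - 4) * pairing μ (fun x => g ((τ • u) x)) (fun x => h ((τ • u) x)) := by
  have h1 := HHalf.coe_dilation hτ u
  have h2 := HHalf.coe_smul τ u
  have e1 : pairing μ (fun x => g (HHalf.dilation τ hτ u x))
      (fun x => h (HHalf.dilation τ hτ u x)) =
      pairing μ (fun x => g (τ * u (τ ^ 2 * x))) (fun x => h (τ * u (τ ^ 2 * x))) :=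
    pairing_congr (h1.fun_comp g) (h1.fun_comp h)
  have e2 : pairing μ (fun x => g ((τ • u) x)) (fun x => h ((τ • u) x)) =
      pairing μ (fun x => g (τ * u x)) (fun x => h (τ * u x)) :=
    pairing_congr (h2.fun_comp g) (h2.fun_comp h)
  rw [e1, e2, pairing_comp_mul_left μ (fun x => g (τ * u x)) (fun x => h (τ * u x))
    (by positivity : 0 < τ ^ 2), ← Real.rpow_natCast, ← Real.rpow_mul hτ.le]
  push_cast
  ring_nf

/-- The nonlocal part `∫ (I_μ * F(u)) (f(u) u - (2 - μ) F(u)) dx` of the Pohozaev functional. -/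
def nonlocalPoho (μ : ℝ) (f : ℝ → ℝ) (u : HHalf) : ℝ :=
  pairing μ (fun x => prim f (u x)) (fun x => pohoDensity μ f (u x))

/-- The rescaled nonlocal part along the fibre of dilations. -/
def fibre (μ : ℝ) (f : ℝ → ℝ) (u : HHalf) (τ : ℝ) : ℝ :=
  τ ^ (2 * μ - 6) * nonlocalPoho μ f (τ • u)

/-- The energy of the dilation by `τ` of `u`. -/
def fibreEnergy (μ : ℝ) (f : ℝ → ℝ) (τ : ℝ) (u : HHalf) : ℝ :=
  1 / 2 * (τ ^ 2 * u.kinetic) - 1 / 2 * (τ ^ (2 * μ - 4) * choquard μ f (τ • u))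

theorem energy_dilation (μ : ℝ) (f : ℝ → ℝ) {τ : ℝ} (hτ : 0 < τ) (u : HHalf) :
    energy μ f (HHalf.dilation τ hτ u) = fibreEnergy μ f τ u := by
  rw [energy, fibreEnergy, HHalf.kinetic_dilation, choquard,
    ← pairing_dilation μ (prim f) (prim f) hτ u]
  rfl

theorem prim_zero (f : ℝ → ℝ) : prim f 0 = 0 := intervalIntegral.integral_same

/-! ### The fibre of dilations and the Pohozaev manifold. -/

namespace Admissible

variable {μ θ C : ℝ} {f : ℝ → ℝ} (H : Admissible μ f θ C)
include H

theorem theta_pos : 0 < θ := by linarith [H.theta_gt, H.mu_lt_one]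

theorem prim_pos {t : ℝ} (ht : t ≠ 0) : 0 < prim f t :=
  pos_of_mul_pos_right (H.superlinear t ht).1 H.theta_pos.le

theorem prim_nonneg (t : ℝ) : 0 ≤ prim f t := by
  rcases eq_or_ne t 0 with rfl | ht
  · rw [prim_zero]
  · exact (H.prim_pos ht).le

theorem le_pohoDensity (t : ℝ) : (θ - (2 - μ)) * prim f t ≤ pohoDensity μ f t := by
  rcases eq_or_ne t 0 with rfl | ht
  · simp [pohoDensity, prim_zero]
  · have := (H.superlinear t ht).2
    unfold pohoDensity
    linarith

theorem pohoDensity_pos {t : ℝ} (ht : t ≠ 0) : 0 < pohoDensity μ f t :=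
  (mul_pos (by linarith [H.theta_gt]) (H.prim_pos ht)).trans_le (H.le_pohoDensity t)

theorem pohoDensity_nonneg (t : ℝ) : 0 ≤ pohoDensity μ f t :=
  (mul_nonneg (by linarith [H.theta_gt]) (H.prim_nonneg t)).trans (H.le_pohoDensity t)

theorem continuous_prim : Continuous (prim f) := Choquard.continuous_prim H.cont

theorem continuous_pohoDensity : Continuous (pohoDensity μ f) := by
  have := H.continuous_prim
  have := H.cont
  unfold pohoDensity
  fun_prop

/-- The constant 3C is not sharp for F; it is chosen so that F and f(t)t − (2 − μ)F(t) have one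
common bound. -/
theorem abs_prim_le (t : ℝ) : |prim f t| ≤ (3 * C) * expWeight 4 t := by
  have h1 := Choquard.abs_prim_le H.nonneg H.bound t
  have h2 := mul_nonneg H.nonneg (expWeight_nonneg 4 t)
  linarith

theorem abs_pohoDensity_le (t : ℝ) : |pohoDensity μ f t| ≤ (3 * C) * expWeight 4 t := by
  have h1 := Choquard.abs_prim_le H.nonneg H.bound t
  have h2 := abs_mul_self_le H.bound t
  have h3 := abs_sub (f t * t) ((2 - μ) * prim f t)
  have h4 : |(2 - μ) * prim f t| ≤ 2 * |prim f t| := by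
    rw [abs_mul, abs_of_pos (by linarith [H.mu_lt_one])]
    have := H.mu_pos
    gcongr
    linarith
  unfold pohoDensity
  linarith

theorem tame_prim (u : HHalf) : Tame μ fun x => prim f (u x) :=
  Choquard.tame_prim H.mu_pos H.mu_lt_one H.cont H.nonneg H.bound u

theorem tame_pohoDensity (u : HHalf) : Tame μ fun x => pohoDensity μ f (u x) :=
  tame_comp H.mu_pos H.mu_lt_one H.continuous_pohoDensity (by norm_num) H.abs_pohoDensity_le u

theorem continuous_nonlocalPoho : Continuous (nonlocalPoho μ f) :=
  continuous_pairing_comp H.mu_pos H.mu_lt_one H.continuous_prim H.continuous_pohoDensity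
    (mul_nonneg (by norm_num) H.nonneg) (by norm_num) H.abs_prim_le H.abs_pohoDensity_le

theorem nonlocalPoho_eq (u : HHalf) : nonlocalPoho μ f u =
    pairing μ (fun x => prim f (u x)) (fun x => f (u x) * u x) - (2 - μ) * choquard μ f u := by
  rw [choquard, ← pairing_const_mul_right]
  exact pairing_sub_right H.mu_pos H.mu_lt_one (H.tame_prim u)
    (integrable_comp_mul H.cont H.bound u u) ((H.tame_prim u).1.const_mul _)

theorem pohozaev_eq (u : HHalf) : pohozaev μ f u = u.kinetic - nonlocalPoho μ f u := by
  rw [H.nonlocalPoho_eq, pohozaev, choquard, pairing, pairing]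
  ring

theorem pohozaev_dilation {τ : ℝ} (hτ : 0 < τ) (u : HHalf) :
    pohozaev μ f (HHalf.dilation τ hτ u) = τ ^ 2 * (u.kinetic - fibre μ f u τ) := by
  rw [H.pohozaev_eq, HHalf.kinetic_dilation, nonlocalPoho,
    pairing_dilation μ (prim f) (pohoDensity μ f) hτ u, fibre, nonlocalPoho, mul_sub, ← mul_assoc]
  congr 2
  rw [← Real.rpow_natCast, ← Real.rpow_add hτ]
  push_cast
  ring_nf

/-- By the superlinearity condition, r ↦ F(rt) r^(−θ) has nonnegative derivative on r > 0. -/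
theorem prim_smul_le {s : ℝ} (hs0 : 0 < s) (hs1 : s ≤ 1) (t : ℝ) :
    prim f (s * t) ≤ s ^ θ * prim f t := by
  rcases eq_or_ne t 0 with rfl | ht
  · simp [prim_zero]
  have hder : ∀ r ∈ Ioi (0 : ℝ), HasDerivAt (fun r => prim f (r * t) * r ^ (-θ))
      ((f (r * t) * t) * r ^ (-θ) + prim f (r * t) * (-θ * r ^ (-θ - 1))) r := by
    intro r hr
    have h1 : HasDerivAt (fun r : ℝ => r * t) t r := by
      simpa using (hasDerivAt_id r).mul_const t
    exact ((hasDerivAt_prim H.cont (r * t)).comp r h1).mul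
      (Real.hasDerivAt_rpow_const (Or.inl (ne_of_gt hr)))
  have hmono : MonotoneOn (fun r => prim f (r * t) * r ^ (-θ)) (Ioi 0) := by
    refine monotoneOn_of_hasDerivWithinAt_nonneg (convex_Ioi 0)
      (fun r hr => (hder r hr).continuousAt.continuousWithinAt)
      (fun r hr => (hder r (interior_subset hr)).hasDerivWithinAt) fun r hr => ?_
    rw [interior_Ioi] at hr
    have hr0 : (0 : ℝ) < r := hr
    have h1 := (H.superlinear (r * t) (mul_ne_zero hr0.ne' ht)).2
    have h2 : r ^ (-θ) = r * r ^ (-θ - 1) := by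
      rw [Real.rpow_sub_one hr0.ne']; field_simp
    have h3 : 0 ≤ r ^ (-θ - 1) := Real.rpow_nonneg hr0.le _
    rw [h2]
    have : f (r * t) * t * (r * r ^ (-θ - 1)) + prim f (r * t) * (-θ * r ^ (-θ - 1)) =
        (r * t * f (r * t) - θ * prim f (r * t)) * r ^ (-θ - 1) := by ring
    rw [this]
    exact mul_nonneg (by linarith) h3
  have h1 := hmono (mem_Ioi.2 hs0) (mem_Ioi.2 one_pos) hs1
  simp only [one_mul, Real.one_rpow, mul_one] at h1
  rw [Real.rpow_neg hs0.le, ← div_eq_mul_inv, div_le_iff₀ (by positivity)] at h1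
  linarith

/-- This is the monotonicity hypothesis, compared at st and t, with the two half-lines treated
alike. -/
theorem pohoDensity_smul_le {s : ℝ} (hs0 : 0 < s) (hs1 : s ≤ 1) (t : ℝ) :
    pohoDensity μ f (s * t) ≤ s ^ (3 - μ) * pohoDensity μ f t := by
  rcases eq_or_ne t 0 with rfl | ht
  · simp [pohoDensity, prim_zero]
  have key : pohoDensity μ f (s * t) / |s * t| ^ (3 - μ) ≤ pohoDensity μ f t / |t| ^ (3 - μ) := by
    rcases lt_or_gt_of_ne ht with h | h
    · exact H.antitone (mem_Iio.2 h) (mem_Iio.2 (mul_neg_of_pos_of_neg hs0 h)) (by nlinarith)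
    · exact H.monotone (mem_Ioi.2 (mul_pos hs0 h)) (mem_Ioi.2 h) (by nlinarith)
  have hp : 0 < |t| ^ (3 - μ) := Real.rpow_pos_of_pos (abs_pos.2 ht) _
  have hp' : 0 < s ^ (3 - μ) := Real.rpow_pos_of_pos hs0 _
  rw [abs_mul, abs_of_pos hs0, Real.mul_rpow hs0.le (abs_nonneg _),
    div_le_div_iff₀ (by positivity) hp] at key
  refine le_of_mul_le_mul_right (key.trans (le_of_eq ?_)) hp
  ring

theorem nonlocalPoho_smul_le {s : ℝ} (hs0 : 0 < s) (hs1 : s ≤ 1) (u : HHalf) :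
    nonlocalPoho μ f (s • u) ≤ s ^ (θ + (3 - μ)) * nonlocalPoho μ f u := by
  have e : s ^ (θ + (3 - μ)) * nonlocalPoho μ f u =
      pairing μ (fun x => s ^ θ * prim f (u x)) (fun x => s ^ (3 - μ) * pohoDensity μ f (u x)) := by
    rw [pairing_const_mul_left, pairing_const_mul_right, Real.rpow_add hs0, nonlocalPoho]
    ring
  rw [e]
  have hc := HHalf.coe_smul s u
  refine pairing_mono H.mu_pos H.mu_lt_one (H.tame_prim _) ((H.tame_prim u).const_mul _)
    (H.tame_pohoDensity _).1 ((H.tame_pohoDensity u).1.const_mul _)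
    (Eventually.of_forall fun x => mul_nonneg (by positivity) (H.prim_nonneg _))
    (Eventually.of_forall fun x => H.pohoDensity_nonneg _) ?_ ?_
  · filter_upwards [hc] with x hx
    rw [hx, Pi.smul_apply, smul_eq_mul]
    exact H.prim_smul_le hs0 hs1 _
  · filter_upwards [hc] with x hx
    rw [hx, Pi.smul_apply, smul_eq_mul]
    exact H.pohoDensity_smul_le hs0 hs1 _

/-- F(u) is positive on a set of positive measure, so its potential is positive at every point, and
the density is positive wherever u ≠ 0. -/
theorem nonlocalPoho_pos {u : HHalf} (hu : u ≠ 0) : 0 < nonlocalPoho μ f u := by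
  have hsupp : volume {x : ℝ | u x ≠ 0} ≠ 0 := fun h =>
    hu (HHalf.ext_ae ((show (u : ℝ → ℝ) =ᵐ[volume] 0 from ae_iff.2 h).trans HHalf.coe_zero.symm))
  have hF0 : ∀ x, 0 ≤ prim f (u x) := fun x => H.prim_nonneg _
  have hr : ∀ x, 0 < riesz μ (fun y => prim f (u y)) x := by
    intro x
    refine (integral_pos_iff_support_of_nonneg
      (fun y => mul_nonneg (by positivity) (hF0 y))
      ((H.tame_prim u).integrable_kernel_mul H.mu_pos H.mu_lt_one x)).2 ?_
    have h1 : {y : ℝ | u y ≠ 0} \ {x} ⊆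
        Function.support fun y => 1 / |x - y| ^ μ * prim f (u y) := by
      intro y hy
      have h2 : 0 < |x - y| := abs_pos.2 (sub_ne_zero.2 fun h => hy.2 h.symm)
      have h3 := H.prim_pos hy.1
      rw [Function.mem_support]
      positivity
    refine lt_of_lt_of_le ?_ (measure_mono h1)
    rw [measure_sdiff_null Real.volume_singleton]
    exact pos_iff_ne_zero.2 hsupp
  refine (integral_pos_iff_support_of_nonneg
    (fun x => mul_nonneg (hr x).le (H.pohoDensity_nonneg _))
    ((H.tame_prim u).integrable_riesz_mul H.mu_pos H.mu_lt_one (H.tame_pohoDensity u).1)).2 ?_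
  refine lt_of_lt_of_le (pos_iff_ne_zero.2 hsupp) (measure_mono fun x hx => ?_)
  exact (mul_pos (hr x) (H.pohoDensity_pos hx)).ne'

theorem fibre_pos {u : HHalf} (hu : u ≠ 0) {τ : ℝ} (hτ : 0 < τ) : 0 < fibre μ f u τ :=
  mul_pos (Real.rpow_pos_of_pos hτ _) (H.nonlocalPoho_pos (smul_ne_zero hτ.ne' hu))

/-- The exponents combine as θ + (3 − μ) + (2μ − 6) = θ − (3 − μ), which is positive. This one
inequality gives strict monotonicity and both limits of the fibre map, and the lower bound for the
kinetic energy. -/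
theorem fibre_mul_le (u : HHalf) {s σ : ℝ} (hs0 : 0 < s) (hs1 : s ≤ 1) (hσ : 0 < σ) :
    fibre μ f u (s * σ) ≤ s ^ (θ - (3 - μ)) * fibre μ f u σ := by
  have h1 := H.nonlocalPoho_smul_le hs0 hs1 (σ • u)
  rw [smul_smul] at h1
  unfold fibre
  calc (s * σ) ^ (2 * μ - 6) * nonlocalPoho μ f ((s * σ) • u)
      ≤ (s * σ) ^ (2 * μ - 6) * (s ^ (θ + (3 - μ)) * nonlocalPoho μ f (σ • u)) := by gcongr
    _ = s ^ (θ - (3 - μ)) * (σ ^ (2 * μ - 6) * nonlocalPoho μ f (σ • u)) := by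
      rw [Real.mul_rpow hs0.le hσ.le]
      have : s ^ (θ - (3 - μ)) = s ^ (2 * μ - 6) * s ^ (θ + (3 - μ)) := by
        rw [← Real.rpow_add hs0]; ring_nf
      rw [this]; ring

theorem fibre_strictMono {u : HHalf} (hu : u ≠ 0) {τ σ : ℝ} (hτ : 0 < τ) (h : τ < σ) :
    fibre μ f u τ < fibre μ f u σ := by
  have hσ := hτ.trans h
  have hs : τ / σ < 1 := (div_lt_one hσ).2 h
  have h1 := H.fibre_mul_le u (div_pos hτ hσ) hs.le hσ
  rw [div_mul_cancel₀ _ hσ.ne'] at h1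
  refine h1.trans_lt ?_
  have h2 : (τ / σ) ^ (θ - (3 - μ)) < 1 :=
    Real.rpow_lt_one (div_pos hτ hσ).le hs (by linarith [H.theta_gt])
  have h3 := H.fibre_pos hu hσ
  nlinarith

theorem continuous_fibre_left (τ : ℝ) : Continuous fun u => fibre μ f u τ :=
  continuous_const.mul (H.continuous_nonlocalPoho.comp (continuous_const_smul τ))

theorem continuousOn_fibre (u : HHalf) : ContinuousOn (fibre μ f u) (Ioi 0) := by
  refine ContinuousOn.mul (fun τ hτ => ?_) ?_
  · exact (Real.continuousAt_rpow_const _ _ (Or.inl (ne_of_gt hτ))).continuousWithinAt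
  · exact (H.continuous_nonlocalPoho.comp (continuous_id.smul continuous_const)).continuousOn

theorem exists_rpow_mul_lt {A B : ℝ} (hB : 0 < B) :
    ∃ s, 0 < s ∧ s ≤ 1 ∧ s ^ (θ - (3 - μ)) * A < B := by
  have he : 0 < θ - (3 - μ) := by linarith [H.theta_gt]
  have h1 : Tendsto (fun s : ℝ => s ^ (θ - (3 - μ)) * A) (𝓝[>] 0) (𝓝 (0 ^ (θ - (3 - μ)) * A)) :=
    ((Real.continuousAt_rpow_const 0 _ (Or.inr he.le)).tendsto.mono_left
      nhdsWithin_le_nhds).mul_const A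
  rw [Real.zero_rpow he.ne', zero_mul] at h1
  have h2 : ∀ᶠ s : ℝ in 𝓝[>] 0, s ≤ 1 :=
    (eventually_le_nhds (zero_lt_one' ℝ)).filter_mono nhdsWithin_le_nhds
  obtain ⟨s, hs1, hs2, hs3⟩ :=
    ((h1.eventually_lt_const hB).and (h2.and self_mem_nhdsWithin)).exists
  exact ⟨s, hs3, hs2, hs1⟩

/-- Intermediate values: the fibre map is below K at a small s, and above K at a large r⁻¹, because
fibre(1) ≤ r^(θ−(3−μ)) fibre(r⁻¹). -/
theorem exists_fibre_eq {u : HHalf} (hu : u ≠ 0) : ∃ τ, 0 < τ ∧ fibre μ f u τ = u.kinetic := by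
  have hK := HHalf.kinetic_pos hu
  have hg := H.fibre_pos hu one_pos
  obtain ⟨s, hs0, hs1, hs⟩ := H.exists_rpow_mul_lt (A := fibre μ f u 1) hK
  obtain ⟨r, hr0, hr1, hr⟩ := H.exists_rpow_mul_lt (A := u.kinetic) hg
  have h1 : fibre μ f u s ≤ u.kinetic := by
    have := H.fibre_mul_le u hs0 hs1 one_pos
    rw [mul_one] at this
    linarith
  have h2 : u.kinetic ≤ fibre μ f u r⁻¹ := by
    have := H.fibre_mul_le u hr0 hr1 (inv_pos.2 hr0)
    rw [mul_inv_cancel₀ hr0.ne'] at this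
    exact (lt_of_mul_lt_mul_left (hr.trans_le this) (by positivity)).le
  have hsr : s ≤ r⁻¹ := hs1.trans ((one_le_inv₀ hr0).2 hr1)
  obtain ⟨τ, hτ, hτe⟩ := intermediate_value_Icc hsr
    ((H.continuousOn_fibre u).mono fun t ht => hs0.trans_le ht.1) ⟨h1, h2⟩
  exact ⟨τ, hs0.trans_le hτ.1, hτe⟩

/-- The derivative is P of the dilated function divided by τ, so critical points along a fibre are
exactly the points of the Pohozaev manifold. -/
theorem hasDerivAt_fibreEnergy (u : HHalf) {τ : ℝ} (hτ : 0 < τ) :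
    HasDerivAt (fun τ => fibreEnergy μ f τ u) (τ * (u.kinetic - fibre μ f u τ)) τ := by
  have h1 : HasDerivAt (fun r : ℝ => r • u) u τ := by
    simpa using (hasDerivAt_id τ).smul_const u
  have h2 := (hasStrictFDerivAt_choquard H.mu_pos H.mu_lt_one H.cont H.nonneg H.bound
    (τ • u)).hasFDerivAt.comp_hasDerivAt τ h1
  have h3 := (Real.hasDerivAt_rpow_const (x := τ) (p := 2 * μ - 4) (Or.inl hτ.ne')).mul h2
  have h4 := (((hasDerivAt_pow 2 τ).mul_const u.kinetic).const_mul (1 / 2)).sub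
    (h3.const_mul (1 / 2))
  refine h4.congr_deriv ?_
  have h5 : nonlocalPoho μ f (τ • u) =
      τ * pairing μ (fun x => prim f ((τ • u) x)) (fun x => f ((τ • u) x) * u x) -
        (2 - μ) * choquard μ f (τ • u) := by
    rw [H.nonlocalPoho_eq, ← pairing_const_mul_right]
    congr 1
    refine pairing_congr (EventuallyEq.refl _ _) ?_
    filter_upwards [HHalf.coe_smul τ u] with x hx
    rw [hx, Pi.smul_apply, smul_eq_mul]
    ring
  rw [choquardDeriv_apply, fibre, h5, Function.comp_apply]
  have e1 : τ ^ (2 * μ - 4 - 1) = τ * τ ^ (2 * μ - 6) := by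
    have : 2 * μ - 4 - 1 = 1 + (2 * μ - 6) := by ring
    rw [this, Real.rpow_add hτ, Real.rpow_one]
  have e2 : τ ^ (2 * μ - 4) = τ ^ 2 * τ ^ (2 * μ - 6) := by
    have : 2 * μ - 4 = 2 + (2 * μ - 6) := by ring
    rw [this, Real.rpow_add hτ, Real.rpow_two]
  rw [e1, e2]
  push_cast
  ring

theorem fibreEnergy_le {u : HHalf} (hu : u ≠ 0) {T τ : ℝ} (hT : 0 < T)
    (hTe : fibre μ f u T = u.kinetic) (hτ : 0 < τ) : fibreEnergy μ f τ u ≤ fibreEnergy μ f T u := by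
  rcases le_total τ T with h | h
  · have hmono : MonotoneOn (fun τ => fibreEnergy μ f τ u) (Icc τ T) := by
      refine monotoneOn_of_hasDerivWithinAt_nonneg (convex_Icc τ T) (fun r hr =>
        (H.hasDerivAt_fibreEnergy u (hτ.trans_le hr.1)).continuousAt.continuousWithinAt)
        (fun r hr => (H.hasDerivAt_fibreEnergy u
          (hτ.trans_le (interior_subset hr).1)).hasDerivWithinAt) fun r hr => ?_
      rw [interior_Icc] at hr
      have h1 := H.fibre_strictMono hu (hτ.trans hr.1) hr.2
      exact mul_nonneg (hτ.trans hr.1).le (by linarith)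
    exact hmono (left_mem_Icc.2 h) (right_mem_Icc.2 h) h
  · have hanti : AntitoneOn (fun τ => fibreEnergy μ f τ u) (Icc T τ) := by
      refine antitoneOn_of_hasDerivWithinAt_nonpos (convex_Icc T τ) (fun r hr =>
        (H.hasDerivAt_fibreEnergy u (hT.trans_le hr.1)).continuousAt.continuousWithinAt)
        (fun r hr => (H.hasDerivAt_fibreEnergy u
          (hT.trans_le (interior_subset hr).1)).hasDerivWithinAt) fun r hr => ?_
      rw [interior_Icc] at hr
      have h1 := H.fibre_strictMono hu hT hr.1
      exact mul_nonpos_of_nonneg_of_nonpos (hT.trans hr.1).le (by linarith)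
    exact hanti (left_mem_Icc.2 h) (right_mem_Icc.2 h) h

/-- On the manifold K equals the nonlocal part of P, which is at least θ − (2 − μ) times the
Choquard term. Since θ > 3 − μ this factor exceeds 1, so half of the Choquard term cannot absorb
half of K. -/
theorem kinetic_le_energy {a : ℝ} {u : HHalf} (hu : u ∈ pohozaevManifold μ f a) :
    1 / 2 * (1 - 1 / (θ - (2 - μ))) * u.kinetic ≤ energy μ f u := by
  have hl : 0 < θ - (2 - μ) := by linarith [H.theta_gt]
  have h1 : u.kinetic = nonlocalPoho μ f u := by
    have := hu.2
    rw [H.pohozaev_eq] at this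
    linarith
  have h2 : (θ - (2 - μ)) * choquard μ f u ≤ nonlocalPoho μ f u := by
    rw [choquard, ← pairing_const_mul_right]
    exact pairing_mono H.mu_pos H.mu_lt_one (H.tame_prim u) (H.tame_prim u)
      ((H.tame_prim u).1.const_mul _) (H.tame_pohoDensity u).1
      (Eventually.of_forall fun x => H.prim_nonneg _)
      (Eventually.of_forall fun x => mul_nonneg hl.le (H.prim_nonneg _))
      (Eventually.of_forall fun x => le_rfl) (Eventually.of_forall fun x => H.le_pohoDensity _)
  have h3 : choquard μ f u ≤ 1 / (θ - (2 - μ)) * u.kinetic := by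
    rw [one_div_mul_eq_div, le_div_iff₀ hl, h1]
    linarith
  have h4 : energy μ f u = 1 / 2 * u.kinetic - 1 / 2 * choquard μ f u := rfl
  rw [h4]
  linarith

theorem coercivity_pos : 0 < 1 / 2 * (1 - 1 / (θ - (2 - μ))) := by
  have hl : 1 < θ - (2 - μ) := by linarith [H.theta_gt]
  have : 1 / (θ - (2 - μ)) < 1 := (div_lt_one (by linarith)).2 hl
  linarith

theorem energy_nonneg {a : ℝ} {u : HHalf} (hu : u ∈ pohozaevManifold μ f a) : 0 ≤ energy μ f u :=
  (mul_nonneg H.coercivity_pos.le u.kinetic_nonneg).trans (H.kinetic_le_energy hu)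

theorem dilation_mem_pohozaevManifold {a : ℝ} {u : HHalf} (hu : u ∈ sphere a) {τ : ℝ} (hτ : 0 < τ)
    (h : fibre μ f u τ = u.kinetic) : HHalf.dilation τ hτ u ∈ pohozaevManifold μ f a :=
  ⟨HHalf.dilation_mem_sphere hτ hu, by rw [H.pohozaev_dilation, h, sub_self, mul_zero]⟩

/-- A point u of the manifold with K = k² is the dilation by k of some w with kinetic energy 1 and
norm √(1 + a²), and the fibre map of w equals 1 at k. Continuity of the nonlocal term at 0 bounds
that fibre map at a fixed τ₀, uniformly in w, and `fibre_mul_le` then makes it less than 1 at every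
too small k. -/
theorem exists_kinetic_lower_bound {a : ℝ} (ha : 0 < a) :
    ∃ c, 0 < c ∧ ∀ u ∈ pohozaevManifold μ f a, c ≤ u.kinetic := by
  have h0 : nonlocalPoho μ f 0 = 0 := by
    have h1 : (fun x => pohoDensity μ f ((0 : HHalf) x)) =ᵐ[volume] fun _ => 0 := by
      filter_upwards [HHalf.coe_zero] with x hx
      rw [hx, Pi.zero_apply, pohoDensity, prim_zero]; ring
    rw [nonlocalPoho, pairing_congr (EventuallyEq.refl _ _) h1]
    simp [pairing]
  have hcont := H.continuous_nonlocalPoho.tendsto 0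
  rw [h0] at hcont
  obtain ⟨δ, hδ, hδb⟩ := Metric.eventually_nhds_iff.1 (hcont.eventually_lt_const one_pos)
  have hsq : 0 < √(1 + a ^ 2) := by positivity
  -- Chosen so that τ₀ w has norm δ/2 for every such w.
  set τ₀ := δ / 2 / √(1 + a ^ 2)
  have hτ₀ : 0 < τ₀ := by positivity
  obtain ⟨s₁, hs0, hs1, hs⟩ := H.exists_rpow_mul_lt (A := τ₀ ^ (2 * μ - 6)) one_pos
  refine ⟨(s₁ * τ₀) ^ 2, by positivity, fun u hu => ?_⟩
  have hune := ne_zero_of_mem_sphere ha hu.1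
  have hK := HHalf.kinetic_pos hune
  set k := √u.kinetic
  have hk : 0 < k := Real.sqrt_pos.2 hK
  have hk2 : k ^ 2 = u.kinetic := Real.sq_sqrt hK.le
  rw [← hk2]
  by_contra hcon
  have hlt : k < s₁ * τ₀ := lt_of_pow_lt_pow_left₀ 2 (by positivity) (not_le.1 hcon)
  set w := HHalf.dilation k⁻¹ (inv_pos.2 hk) u
  have hwK : w.kinetic = 1 := by
    rw [HHalf.kinetic_dilation, ← hk2]; field_simp
  have hwn : ‖w‖ ^ 2 = 1 + a ^ 2 := by
    rw [HHalf.norm_sq_eq, hwK]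
    have : ∫ x, w x ^ 2 = a ^ 2 := HHalf.dilation_mem_sphere _ hu.1
    rw [this]
  have hwg : fibre μ f w k = 1 := by
    have h1 := H.pohozaev_dilation hk w
    rw [HHalf.dilation_inv_dilation hk u, hu.2, hwK] at h1
    have : k ^ 2 ≠ 0 := by positivity
    have := (mul_eq_zero.1 h1.symm).resolve_left this
    linarith
  have hwτ : fibre μ f w τ₀ ≤ τ₀ ^ (2 * μ - 6) := by
    have h1 : nonlocalPoho μ f (τ₀ • w) < 1 := by
      refine hδb ?_
      have h2 : ‖w‖ = √(1 + a ^ 2) := by rw [← hwn, Real.sqrt_sq (norm_nonneg _)]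
      rw [dist_zero_right, norm_smul, Real.norm_of_nonneg hτ₀.le, h2]
      have : τ₀ * √(1 + a ^ 2) = δ / 2 := div_mul_cancel₀ _ hsq.ne'
      rw [this]; linarith
    have h2 : 0 < τ₀ ^ (2 * μ - 6) := Real.rpow_pos_of_pos hτ₀ _
    unfold fibre
    nlinarith
  have hs' : k / τ₀ < s₁ := (div_lt_iff₀ hτ₀).2 hlt
  have h1 := H.fibre_mul_le w (div_pos hk hτ₀) (hs'.le.trans hs1) hτ₀
  rw [div_mul_cancel₀ _ hτ₀.ne', hwg] at h1
  have h2 : (k / τ₀) ^ (θ - (3 - μ)) ≤ s₁ ^ (θ - (3 - μ)) :=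
    Real.rpow_le_rpow (by positivity) hs'.le (by linarith [H.theta_gt])
  have h3 : (k / τ₀) ^ (θ - (3 - μ)) * fibre μ f w τ₀ ≤
      s₁ ^ (θ - (3 - μ)) * τ₀ ^ (2 * μ - 6) :=
    mul_le_mul h2 hwτ (mul_nonneg (Real.rpow_nonneg hτ₀.le _)
      (H.nonlocalPoho_pos (smul_ne_zero hτ₀.ne' (by
        intro h
        rw [h] at hwn
        simp only [norm_zero] at hwn
        nlinarith))).le) (by positivity)
  linarith

end Admissible

/-! ### Ekeland's variational principle. -/

/-- Ekeland's variational principle. -/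
theorem exists_ekeland {X : Type*} [MetricSpace X] [CompleteSpace X] {φ : X → ℝ}
    (hφ : LowerSemicontinuous φ) (hbdd : BddBelow (range φ)) (x₀ : X) {ε : ℝ} (hε : 0 < ε) :
    ∃ v, φ v + ε * dist v x₀ ≤ φ x₀ ∧ ∀ z, φ v ≤ φ z + ε * dist z v := by
  set S : X → Set X := fun x => {z | φ z + ε * dist z x ≤ φ x}
  have hself : ∀ x, x ∈ S x := fun x => by simp [S]
  have htrans : ∀ {x y z}, y ∈ S x → z ∈ S y → z ∈ S x := by
    intro x y z hy hz
    have h1 : φ y + ε * dist y x ≤ φ x := hy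
    have h2 : φ z + ε * dist z y ≤ φ y := hz
    have h3 : ε * dist z x ≤ ε * (dist z y + dist y x) := by gcongr; exact dist_triangle _ _ _
    change φ z + ε * dist z x ≤ φ x
    linarith
  have hclosed : ∀ x, IsClosed (S x) := by
    intro x
    have h1 : LowerSemicontinuous fun z => φ z + ε * dist z x :=
      hφ.add ((by fun_prop : Continuous fun z => ε * dist z x).lowerSemicontinuous)
    exact lowerSemicontinuous_iff_isClosed_preimage.1 h1 (φ x)
  have hbS : ∀ x, BddBelow (φ '' S x) := fun x => hbdd.mono (image_subset_range _ _)
  -- Almost minimising φ over S(x) up to 2^(−n) forces the next set to lie within 2^(−n)/ε of its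
  -- centre.
  have hnext : ∀ (n : ℕ) (x : X), ∃ y ∈ S x, ∀ z ∈ S x, φ y ≤ φ z + (1 / 2) ^ n := by
    intro n x
    obtain ⟨_, ⟨y, hy, rfl⟩, hlt⟩ := Real.lt_sInf_add_pos (s := φ '' S x) ⟨_, x, hself x, rfl⟩
      (show (0 : ℝ) < (1 / 2) ^ n by positivity)
    exact ⟨y, hy, fun z hz => by
      have := csInf_le (hbS x) (mem_image_of_mem φ hz)
      linarith⟩
  choose next hnextS hnextle using hnext
  set x : ℕ → X := fun n => Nat.rec x₀ (fun n y => next n y) n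
  have hx0 : x 0 = x₀ := rfl
  have hxs : ∀ n, x (n + 1) = next n (x n) := fun n => rfl
  have hmem : ∀ n m, n ≤ m → x m ∈ S (x n) := by
    intro n m hnm
    induction m, hnm using Nat.le_induction with
    | base => exact hself _
    | succ m _ ih => exact htrans ih (by rw [hxs]; exact hnextS m (x m))
  have hsmall : ∀ n, ∀ z ∈ S (x (n + 1)), dist z (x (n + 1)) ≤ (1 / 2) ^ n / ε := by
    intro n z hz
    have h1 : φ z + ε * dist z (x (n + 1)) ≤ φ (x (n + 1)) := hz
    have h2 := hnextle n (x n) z (htrans (hmem n (n + 1) (Nat.le_succ n)) hz)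
    rw [← hxs] at h2
    rw [le_div_iff₀ hε]
    linarith
  have hlim0 : Tendsto (fun n : ℕ => ((1 : ℝ) / 2) ^ n / ε) atTop (𝓝 0) := by
    have := (tendsto_pow_atTop_nhds_zero_of_lt_one (by norm_num : (0 : ℝ) ≤ 1 / 2)
      (by norm_num)).div_const ε
    rwa [zero_div] at this
  have hcauchy : CauchySeq fun n => x (n + 1) :=
    cauchySeq_of_le_tendsto_0' (fun n => ((1 : ℝ) / 2) ^ n / ε) (fun n m hnm => by
      rw [dist_comm]
      exact hsmall n _ (hmem _ _ (Nat.succ_le_succ hnm))) hlim0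
  obtain ⟨v, hv⟩ := cauchySeq_tendsto_of_complete hcauchy
  have hvS : ∀ n, v ∈ S (x n) := fun n =>
    (hclosed (x n)).mem_of_tendsto hv (by
      filter_upwards [eventually_ge_atTop n] with m hm
      exact hmem n (m + 1) (by omega))
  refine ⟨v, hvS 0, fun z => ?_⟩
  -- A violating z lies in S(v), hence in every S(x n); these sets shrink to the single point v, so
  -- z = v, which violates nothing.
  by_contra hz
  have hzS : z ∈ S v := (not_le.1 hz).le
  have hzv : Tendsto (fun n => x (n + 1)) atTop (𝓝 z) := by
    rw [tendsto_iff_dist_tendsto_zero]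
    refine squeeze_zero (fun n => dist_nonneg) (fun n => ?_) hlim0
    rw [dist_comm]
    exact hsmall n z (htrans (hvS (n + 1)) hzS)
  have : z = v := tendsto_nhds_unique hzv hv
  rw [this, dist_self] at hz
  simp at hz

/-! ### The maximal energy along fibres. -/

/-- The dilation parameter that brings `u` to the Pohozaev manifold. -/
def fibreTime (μ : ℝ) (f : ℝ → ℝ) (u : HHalf) : ℝ :=
  open Classical in
  -- The default 1 never occurs for u ≠ 0.
  if h : ∃ τ, 0 < τ ∧ fibre μ f u τ = u.kinetic then h.choose else 1

/-- The maximum of the energy along the fibre of dilations of `u`. -/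
def maxEnergy (μ : ℝ) (f : ℝ → ℝ) (u : HHalf) : ℝ := fibreEnergy μ f (fibreTime μ f u) u

namespace Admissible

variable {μ θ C a : ℝ} {f : ℝ → ℝ} (H : Admissible μ f θ C)
include H

theorem fibreTime_pos {u : HHalf} (hu : u ≠ 0) : 0 < fibreTime μ f u := by
  have h := H.exists_fibre_eq hu
  rw [fibreTime, dif_pos h]
  exact h.choose_spec.1

theorem fibre_fibreTime {u : HHalf} (hu : u ≠ 0) : fibre μ f u (fibreTime μ f u) = u.kinetic := by
  have h := H.exists_fibre_eq hu
  rw [fibreTime, dif_pos h]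
  exact h.choose_spec.2

theorem fibreEnergy_le_maxEnergy {u : HHalf} (hu : u ≠ 0) {τ : ℝ} (hτ : 0 < τ) :
    fibreEnergy μ f τ u ≤ maxEnergy μ f u :=
  H.fibreEnergy_le hu (H.fibreTime_pos hu) (H.fibre_fibreTime hu) hτ

/-- Strict monotonicity traps the crossing: the strict inequalities between the fibre map and K at
parameters just below and just above T(v) are open conditions in the function, so they persist for z
near v. -/
theorem tendsto_fibreTime {v : HHalf} (hv : v ≠ 0) :
    Tendsto (fibreTime μ f) (𝓝 v) (𝓝 (fibreTime μ f v)) := by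
  have hT := H.fibreTime_pos hv
  have hTe := H.fibre_fibreTime hv
  have hne : ∀ᶠ z in 𝓝 v, z ≠ 0 := isOpen_ne.mem_nhds hv
  rw [tendsto_order]
  constructor
  · intro b hb
    -- The test parameter must be positive, whereas b need not be.
    set c := max b (fibreTime μ f v / 2)
    have hc0 : 0 < c := lt_max_of_lt_right (by linarith)
    have hcT : c < fibreTime μ f v := max_lt hb (by linarith)
    have h1 : fibre μ f v c < v.kinetic := hTe ▸ H.fibre_strictMono hv hc0 hcT
    filter_upwards [hne, (H.continuous_fibre_left c).continuousAt.eventually_lt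
      HHalf.continuous_kinetic.continuousAt h1] with z hz h2
    refine (le_max_left b (fibreTime μ f v / 2)).trans_lt ?_
    by_contra h3
    rcases (not_lt.1 h3).eq_or_lt with h4 | h4
    · have h5 := H.fibre_fibreTime hz
      rw [h4] at h5
      exact absurd h5 h2.ne
    · have h5 := H.fibre_strictMono hz (H.fibreTime_pos hz) h4
      rw [H.fibre_fibreTime hz] at h5
      exact absurd h5 h2.le.not_gt
  · intro b hb
    have h1 : v.kinetic < fibre μ f v b := hTe ▸ H.fibre_strictMono hv hT hb
    filter_upwards [hne, HHalf.continuous_kinetic.continuousAt.eventually_lt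
      (H.continuous_fibre_left b).continuousAt h1] with z hz h2
    by_contra h3
    rcases (not_lt.1 h3).eq_or_lt with h4 | h4
    · have h5 := H.fibre_fibreTime hz
      rw [← h4] at h5
      exact absurd h5 h2.ne'
    · have h5 := H.fibre_strictMono hz (hT.trans hb) h4
      rw [H.fibre_fibreTime hz] at h5
      exact absurd h5 h2.le.not_gt

theorem exists_hasStrictFDerivAt_fibreEnergy {τ : ℝ} (hτ : 0 < τ) (u : HHalf) :
    ∃ L : ℝ × HHalf →L[ℝ] ℝ,
      HasStrictFDerivAt (fun p : ℝ × HHalf => fibreEnergy μ f p.1 p.2) L (τ, u) := by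
  have h1 : HasStrictFDerivAt (fun p : ℝ × HHalf => p.1 ^ 2 * p.2.kinetic) _ (τ, u) :=
    ((contDiff_fst.pow 2).mul
      (HHalf.contDiff_kinetic.comp contDiff_snd)).contDiffAt.hasStrictFDerivAt one_ne_zero
  have h2 : HasStrictFDerivAt (fun p : ℝ × HHalf => p.1 ^ (2 * μ - 4)) _ (τ, u) :=
    (ContDiffAt.rpow_const_of_ne (n := 1) contDiffAt_fst hτ.ne').hasStrictFDerivAt one_ne_zero
  have hsmul : ContDiff ℝ 1 fun p : ℝ × HHalf => p.1 • p.2 := contDiff_fst.smul contDiff_snd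
  have h3 : HasStrictFDerivAt (fun p : ℝ × HHalf => p.1 • p.2) _ (τ, u) :=
    hsmul.contDiffAt.hasStrictFDerivAt one_ne_zero
  have h4 := (hasStrictFDerivAt_choquard H.mu_pos H.mu_lt_one H.cont H.nonneg H.bound
    (τ • u)).comp (τ, u) h3
  exact ⟨_, (h1.const_mul (1 / 2)).sub ((h2.mul h4).const_mul (1 / 2))⟩

theorem differentiableAt_energy (u : HHalf) : DifferentiableAt ℝ (energy μ f) u := by
  have h1 : DifferentiableAt ℝ (fun u : HHalf => u.kinetic) u :=
    HHalf.contDiff_kinetic.differentiable one_ne_zero u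
  have h2 : DifferentiableAt ℝ (choquard μ f) u :=
    (hasStrictFDerivAt_choquard H.mu_pos H.mu_lt_one H.cont H.nonneg H.bound
      u).hasFDerivAt.differentiableAt
  exact (h1.const_mul (1 / 2)).sub (h2.const_mul (1 / 2))

/-- Near v the maximal energy is at least the energy at the frozen parameter T(v), which is
continuous in the function and agrees with it at v. -/
theorem lowerSemicontinuousAt_maxEnergy {v : HHalf} (hv : v ≠ 0) :
    LowerSemicontinuousAt (maxEnergy μ f) v := by
  intro y hy
  have hτ := H.fibreTime_pos hv
  obtain ⟨L, hL⟩ := H.exists_hasStrictFDerivAt_fibreEnergy hτ v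
  have hc : ContinuousAt (fun z => fibreEnergy μ f (fibreTime μ f v) z) v :=
    ContinuousAt.comp (f := fun z : HHalf => (fibreTime μ f v, z)) hL.continuousAt (by fun_prop)
  have hne : ∀ᶠ z in 𝓝 v, z ≠ 0 := isOpen_ne.mem_nhds hv
  filter_upwards [hne, hc.eventually_const_lt hy] with z hz h1
  exact h1.trans_le (H.fibreEnergy_le_maxEnergy hz hτ)

end Admissible

/-! ### Almost critical points on the sphere. -/

/-- The line v + sψ is normalised. As ψ is orthogonal to v in L², its squared L² norm is a²(1 +
s²b), so the correction factor has zero derivative at s = 0. -/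
theorem exists_curve_in_sphere {a : ℝ} (ha : 0 < a) {v ψ : HHalf} (hv : v ∈ sphere a)
    (hψ : ψ ∈ tangentSpace v) :
    ∃ z : ℝ → HHalf, (∀ s, z s ∈ sphere a) ∧ z 0 = v ∧ HasDerivAt z ψ 0 := by
  set b := (∫ x, ψ x ^ 2) / a ^ 2
  have hb : 0 ≤ b := div_nonneg ψ.integral_sq_nonneg (sq_nonneg a)
  set ρ : ℝ → ℝ := fun s => (√(1 + s ^ 2 * b))⁻¹
  have hpos : ∀ s : ℝ, 0 < 1 + s ^ 2 * b := fun s => by positivity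
  have hρ0 : ρ 0 = 1 := by simp [ρ]
  have hρ : HasDerivAt ρ 0 0 := by
    have h1 : HasDerivAt (fun s : ℝ => 1 + s ^ 2 * b) 0 0 := by
      have := (((hasDerivAt_id (0 : ℝ)).pow 2).mul_const b).const_add 1
      simpa using this
    have h2 := (h1.sqrt (hpos 0).ne').inv (Real.sqrt_pos.2 (hpos 0)).ne'
    simpa [ρ] using! h2
  have hline : HasDerivAt (fun s : ℝ => v + s • ψ) ψ 0 := by
    simpa using ((hasDerivAt_id (0 : ℝ)).smul_const ψ).const_add v
  refine ⟨fun s => ρ s • (v + s • ψ), fun s => ?_, ?_, ?_⟩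
  · change ∫ x, (ρ s • (v + s • ψ)) x ^ 2 = a ^ 2
    rw [HHalf.integral_sq_smul]
    have hvv : ∫ x, v x * v x = a ^ 2 := by
      have : ∫ x, v x ^ 2 = a ^ 2 := hv
      simpa only [sq] using this
    have hψv : ∫ x, ψ x * v x = 0 := hψ
    have hvψ : ∫ x, v x * ψ x = 0 := by simpa only [mul_comm] using hψv
    have hcomm : ∀ p q : HHalf, ∫ x, p x * q x = ∫ x, q x * p x := fun p q => by
      simp only [mul_comm]
    have h1 : ∫ x, (v + s • ψ) x ^ 2 = a ^ 2 * (1 + s ^ 2 * b) := by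
      have e : ∫ x, (v + s • ψ) x ^ 2 = ∫ x, (v + s • ψ) x * (v + s • ψ) x := by simp only [sq]
      rw [e, HHalf.integral_add_mul, hcomm v, HHalf.integral_add_mul, HHalf.integral_smul_mul,
        HHalf.integral_smul_mul, hcomm ψ (v + s • ψ), HHalf.integral_add_mul, HHalf.integral_smul_mul,
        hvv, hψv, hvψ]
      have e2 : ∫ x, ψ x * ψ x = a ^ 2 * b := by
        simp only [b, sq (ψ.toL2 _)]
        field_simp
      rw [e2]; ring
    rw [h1, inv_pow, Real.sq_sqrt (hpos s).le]
    have := (hpos s).ne'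
    field_simp
  · simp [hρ0]
  · have h1 := hρ.smul hline
    rw [hρ0, one_smul, zero_smul, add_zero] at h1
    exact h1

namespace Admissible

variable {μ θ C a : ℝ} {f : ℝ → ℝ} (H : Admissible μ f θ C)
include H

/-- The derivative of the fibre energy in tangential directions, at an almost minimal point of the
maximal energy. -/
theorem neg_mul_norm_le_of_almost_min (ha : 0 < a) {ε : ℝ} {v ψ : HHalf} (hv : v ∈ sphere a)
    (hmin : ∀ z ∈ sphere a, maxEnergy μ f v ≤ maxEnergy μ f z + ε * ‖z - v‖)
    (hψ : ψ ∈ tangentSpace v) {L : ℝ × HHalf →L[ℝ] ℝ}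
    (hL : HasStrictFDerivAt (fun p : ℝ × HHalf => fibreEnergy μ f p.1 p.2) L
      (fibreTime μ f v, v)) : -(ε * ‖ψ‖) ≤ L (0, ψ) := by
  obtain ⟨z, hzS, hz0, hz⟩ := exists_curve_in_sphere ha hv hψ
  have hvne := ne_zero_of_mem_sphere ha hv
  have hzc : Tendsto z (𝓝[>] 0) (𝓝 v) := by
    have := hz.continuousAt.tendsto
    rw [hz0] at this
    exact this.mono_left nhdsWithin_le_nhds
  have hslope : Tendsto (fun s => s⁻¹ • (z s - v)) (𝓝[>] 0) (𝓝 ψ) := by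
    have := (hasDerivAt_iff_tendsto_slope_zero.1 hz).mono_left
      (nhdsWithin_mono (0 : ℝ) (s := Ioi 0) (t := {0}ᶜ) fun s hs => ne_of_gt hs)
    simpa [hz0] using this
  have hT : Tendsto (fun s => fibreTime μ f (z s)) (𝓝[>] 0) (𝓝 (fibreTime μ f v)) :=
    (H.tendsto_fibreTime hvne).comp hzc
  -- Both points carry the moving parameter T(z s), so no rate of convergence of T enters; strict
  -- differentiability is needed because the base point moves.
  have hpq : Tendsto (fun s => ((fibreTime μ f (z s), z s), (fibreTime μ f (z s), v))) (𝓝[>] 0)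
      (𝓝 ((fibreTime μ f v, v), (fibreTime μ f v, v))) := by
    exact (hT.prodMk_nhds hzc).prodMk_nhds (hT.prodMk_nhds tendsto_const_nhds)
  have ho := (hasStrictFDerivAt_iff_isLittleO.1 hL).comp_tendsto hpq
  have hO : (fun s => ((fibreTime μ f (z s), z s) : ℝ × HHalf) - (fibreTime μ f (z s), v))
      =O[𝓝[>] 0] fun s => s := by
    have h1 : (fun s => z s - v) =O[𝓝[>] 0] fun s => s := by
      have := (hz.isBigO_sub).mono (nhdsWithin_le_nhds (s := Ioi (0 : ℝ)))
      simpa [hz0] using this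
    refine (Asymptotics.isBigO_of_le _ fun s => ?_).trans h1
    simp [Prod.norm_def]
  have h2 := (ho.trans_isBigO hO).tendsto_div_nhds_zero
  have h3 : Tendsto (fun s => L (0, s⁻¹ • (z s - v))) (𝓝[>] 0) (𝓝 (L (0, ψ))) :=
    (L.continuous.tendsto _).comp (tendsto_const_nhds.prodMk_nhds hslope)
  have h4 := h2.add h3
  rw [zero_add] at h4
  have h5 : Tendsto (fun s => -(ε * ‖s⁻¹ • (z s - v)‖)) (𝓝[>] 0) (𝓝 (-(ε * ‖ψ‖))) :=
    (hslope.norm.const_mul ε).neg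
  refine le_of_tendsto_of_tendsto h5 h4 ?_
  filter_upwards [self_mem_nhdsWithin] with s hs
  have hs0 : (0 : ℝ) < s := hs
  have h6 : L (0, s⁻¹ • (z s - v)) = s⁻¹ * L (0, z s - v) := by
    rw [← smul_eq_mul, ← map_smul, Prod.smul_mk, smul_zero]
  have h7 := hmin (z s) (hzS s)
  -- The parameter optimal for z s is merely a competitor for v.
  have h8 := H.fibreEnergy_le_maxEnergy hvne
    (H.fibreTime_pos (ne_zero_of_mem_sphere ha (hzS s)))
  have h9 : ‖s⁻¹ • (z s - v)‖ = s⁻¹ * ‖z s - v‖ := by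
    rw [norm_smul, Real.norm_of_nonneg (inv_nonneg.2 hs0.le)]
  rw [h6, h9]
  simp only [Function.comp_apply, Prod.mk_sub_mk, sub_self]
  rw [div_eq_inv_mul, ← mul_add, sub_add_cancel]
  have h10 : -(ε * (s⁻¹ * ‖z s - v‖)) = s⁻¹ * -(ε * ‖z s - v‖) := by ring
  rw [h10]
  refine mul_le_mul_of_nonneg_left ?_ (inv_nonneg.2 hs0.le)
  unfold maxEnergy at *
  linarith

/-- Dilation is a linear bijection between the tangent spaces at v and at its dilate and intertwines
J with the fibre energy. The inverse dilation multiplies the kinetic part by τ⁻² and keeps the L²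
part, hence the factor √(1 + τ⁻²). -/
theorem norm_fderiv_tangent_le (ha : 0 < a) {ε : ℝ} (hε : 0 ≤ ε) {v : HHalf} (hv : v ∈ sphere a)
    (hmin : ∀ z ∈ sphere a, maxEnergy μ f v ≤ maxEnergy μ f z + ε * ‖z - v‖) {τ : ℝ} (hτ : 0 < τ)
    (hτv : τ = fibreTime μ f v) :
    ‖(fderiv ℝ (energy μ f) (HHalf.dilation τ hτ v)).comp
      (tangentSpace (HHalf.dilation τ hτ v)).subtypeL‖ ≤ ε * √(1 + τ⁻¹ ^ 2) := by
  refine ContinuousLinearMap.opNorm_le_bound _ (by positivity) fun φ => ?_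
  obtain ⟨φ, hφ⟩ := φ
  set u := HHalf.dilation τ hτ v
  set ψ := HHalf.dilation τ⁻¹ (inv_pos.2 hτ) φ
  have hψφ : HHalf.dilation τ hτ ψ = φ := HHalf.dilation_inv_dilation hτ φ
  have hψ : ψ ∈ tangentSpace v := by
    change ∫ x, ψ x * v x = 0
    rw [← HHalf.integral_dilation_mul hτ, hψφ]
    exact hφ
  have hψn : ‖ψ‖ ≤ √(1 + τ⁻¹ ^ 2) * ‖φ‖ := by
    refine le_of_sq_le_sq ?_ (by positivity)
    rw [mul_pow, Real.sq_sqrt (by positivity), HHalf.norm_sq_eq, HHalf.kinetic_dilation,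
      HHalf.integral_dilation_sq, HHalf.norm_sq_eq]
    have h1 := φ.kinetic_nonneg
    have h2 := φ.integral_sq_nonneg
    nlinarith [mul_nonneg (sq_nonneg τ⁻¹) h2]
  obtain ⟨L, hL⟩ := H.exists_hasStrictFDerivAt_fibreEnergy hτ v
  -- Both sides are the derivative at s = 0 of one function, the energy of the dilation of v + sψ.
  have hLψ : fderiv ℝ (energy μ f) u φ = L (0, ψ) := by
    have hl : ∀ p q : HHalf, HasDerivAt (fun s : ℝ => p + s • q) q 0 := fun p q => by
      simpa using ((hasDerivAt_id (0 : ℝ)).smul_const q).const_add p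
    have h1 : HasDerivAt (fun s : ℝ => energy μ f (u + s • φ)) (fderiv ℝ (energy μ f) u φ) 0 := by
      have h2 : HasFDerivAt (energy μ f) (fderiv ℝ (energy μ f) u) (u + (0 : ℝ) • φ) := by
        rw [zero_smul, add_zero]
        exact (H.differentiableAt_energy u).hasFDerivAt
      exact h2.comp_hasDerivAt 0 (hl u φ)
    have h3 : HasDerivAt (fun s : ℝ => fibreEnergy μ f τ (v + s • ψ)) (L (0, ψ)) 0 := by
      have h4 : HasFDerivAt (fun p : ℝ × HHalf => fibreEnergy μ f p.1 p.2) L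
          (τ, v + (0 : ℝ) • ψ) := by
        rw [zero_smul, add_zero]
        exact hL.hasFDerivAt
      exact h4.comp_hasDerivAt 0 ((hasDerivAt_const (0 : ℝ) τ).prodMk (hl v ψ))
    have h5 : (fun s : ℝ => energy μ f (u + s • φ)) =
        fun s : ℝ => fibreEnergy μ f τ (v + s • ψ) := by
      funext s
      rw [← energy_dilation μ f hτ, HHalf.dilation_add, HHalf.dilation_smul, hψφ]
    rw [h5] at h1
    exact h1.unique h3
  have h1 := H.neg_mul_norm_le_of_almost_min ha hv hmin hψ (hτv ▸ hL)
  have h2 := H.neg_mul_norm_le_of_almost_min ha hv hmin ((tangentSpace v).neg_mem hψ) (hτv ▸ hL)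
  have h3 : L (0, -ψ) = -L (0, ψ) := by
    rw [← map_neg, Prod.neg_mk, neg_zero]
  rw [h3, norm_neg] at h2
  change ‖fderiv ℝ (energy μ f) u φ‖ ≤ ε * √(1 + τ⁻¹ ^ 2) * ‖φ‖
  rw [hLψ, Real.norm_eq_abs, mul_assoc]
  exact (abs_le.2 ⟨h1, by linarith⟩).trans (mul_le_mul_of_nonneg_left hψn hε)

theorem bddBelow_energy : BddBelow (energy μ f '' pohozaevManifold μ f a) :=
  ⟨0, by rintro _ ⟨u, hu, rfl⟩; exact H.energy_nonneg hu⟩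

theorem dilation_fibreTime_mem (ha : 0 < a) {v : HHalf} (hv : v ∈ sphere a) :
    HHalf.dilation (fibreTime μ f v) (H.fibreTime_pos (ne_zero_of_mem_sphere ha hv)) v ∈
      pohozaevManifold μ f a :=
  H.dilation_mem_pohozaevManifold hv _ (H.fibre_fibreTime (ne_zero_of_mem_sphere ha hv))

theorem nonempty_pohozaevManifold (ha : 0 < a) : (pohozaevManifold μ f a).Nonempty := by
  obtain ⟨v, hv⟩ := sphere_nonempty a
  exact ⟨_, H.dilation_fibreTime_mem ha hv⟩

theorem isGLB_groundLevel (ha : 0 < a) :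
    IsGLB (energy μ f '' pohozaevManifold μ f a) (groundLevel μ f a) :=
  isGLB_csInf ((H.nonempty_pohozaevManifold ha).image _) H.bddBelow_energy

theorem groundLevel_le_maxEnergy (ha : 0 < a) {v : HHalf} (hv : v ∈ sphere a) :
    groundLevel μ f a ≤ maxEnergy μ f v := by
  have h := (H.isGLB_groundLevel ha).1 (mem_image_of_mem _ (H.dilation_fibreTime_mem ha hv))
  rwa [energy_dilation] at h

theorem maxEnergy_le_energy (ha : 0 < a) {w : HHalf} (hw : w ∈ pohozaevManifold μ f a) :
    maxEnergy μ f w ≤ energy μ f w := by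
  have hne := ne_zero_of_mem_sphere ha hw.1
  have h1 : fibre μ f w 1 = w.kinetic := by
    have := hw.2
    rw [H.pohozaev_eq] at this
    rw [fibre, Real.one_rpow, one_smul, one_mul]
    linarith
  have h2 : fibreEnergy μ f 1 w = energy μ f w := by
    rw [fibreEnergy, Real.one_rpow, one_smul, one_pow, one_mul, one_mul]
    rfl
  rw [← h2]
  exact H.fibreEnergy_le hne one_pos h1 (H.fibreTime_pos hne)

/-- A point w of the manifold with energy within ε² of m(a) starts Ekeland's principle for the
maximal energy with slope ε. It yields v within ε of w, so v inherits a norm bound, and the dilate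
of v by T(v) is the required point. -/
theorem exists_almost_critical (ha : 0 < a) : ∃ B : ℝ, ∀ ε : ℝ, 0 < ε → ε ≤ 1 →
    ∃ u ∈ pohozaevManifold μ f a, energy μ f u ≤ groundLevel μ f a + ε ^ 2 ∧
      ‖(fderiv ℝ (energy μ f) u).comp (tangentSpace u).subtypeL‖ ≤ ε * B := by
  obtain ⟨c, hc, hcK⟩ := H.exists_kinetic_lower_bound ha
  set c₀ := 1 / 2 * (1 - 1 / (θ - (2 - μ)))
  have hc₀ : 0 < c₀ := H.coercivity_pos
  set R := (groundLevel μ f a + 1) / c₀ + a ^ 2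
  -- R bounds ‖w‖² through the coercivity of J on the manifold, 2R + 2 bounds (‖w‖ + 1)², and c is
  -- the lower bound of the kinetic energy there.
  refine ⟨√(1 + (2 * R + 2) / c), fun ε hε hε1 => ?_⟩
  obtain ⟨_, ⟨w, hw, rfl⟩, hwlt⟩ := Real.lt_sInf_add_pos
    ((H.nonempty_pohozaevManifold ha).image (energy μ f)) (show 0 < ε ^ 2 by positivity)
  have hwlt' : energy μ f w < groundLevel μ f a + ε ^ 2 := hwlt
  have : CompleteSpace (sphere a) := (isClosed_sphere a).completeSpace_coe
  have hlsc : LowerSemicontinuous fun z : sphere a => maxEnergy μ f z := fun z =>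
    (H.lowerSemicontinuousAt_maxEnergy (ne_zero_of_mem_sphere ha z.2)).comp
      continuous_subtype_val.continuousAt
  obtain ⟨⟨v, hv⟩, hv1, hv2⟩ := exists_ekeland hlsc
    ⟨groundLevel μ f a, by rintro _ ⟨z, rfl⟩; exact H.groundLevel_le_maxEnergy ha z.2⟩
    ⟨w, hw.1⟩ hε
  simp only [Subtype.dist_eq, dist_eq_norm, Subtype.forall] at hv1 hv2
  have hvne := ne_zero_of_mem_sphere ha hv
  have hm := H.groundLevel_le_maxEnergy ha hv
  have hw1 := H.maxEnergy_le_energy ha hw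
  -- The decrease of the maximal energy from w to v is at most ε², because both values lie between
  -- m(a) and m(a) + ε².
  have hdist : ‖v - w‖ ≤ 1 := by
    have h1 : ε * ‖v - w‖ ≤ ε * ε := by nlinarith
    exact (le_of_mul_le_mul_left h1 hε).trans hε1
  have hτ := H.fibreTime_pos hvne
  have hmem := H.dilation_fibreTime_mem ha hv
  have hmin : ∀ z ∈ sphere a, maxEnergy μ f v ≤ maxEnergy μ f z + ε * ‖z - v‖ := hv2
  refine ⟨_, hmem, ?_, (H.norm_fderiv_tangent_le ha hε.le hv hmin hτ rfl).trans ?_⟩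
  · rw [energy_dilation]
    change maxEnergy μ f v ≤ _
    have : 0 ≤ ε * ‖v - w‖ := by positivity
    linarith
  · have hwn : ‖w‖ ^ 2 ≤ R := by
      have h1 := H.kinetic_le_energy hw
      have h2 : w.kinetic ≤ (groundLevel μ f a + 1) / c₀ := by
        rw [le_div_iff₀ hc₀]
        have h3 : ε ^ 2 ≤ 1 := pow_le_one₀ hε.le hε1
        have h4 : c₀ * w.kinetic ≤ energy μ f w := h1
        linarith
      have h3 : ∫ x, w x ^ 2 = a ^ 2 := hw.1
      rw [HHalf.norm_sq_eq, h3]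
      change _ ≤ (groundLevel μ f a + 1) / c₀ + a ^ 2
      linarith
    have hvn : v.kinetic ≤ 2 * R + 2 := by
      have h1 : ‖v‖ ≤ ‖w‖ + 1 := by
        have := norm_le_norm_add_norm_sub' v w
        linarith
      have h2 := v.kinetic_le_norm_sq
      nlinarith [norm_nonneg v, norm_nonneg w, sq_nonneg (‖w‖ - 1)]
    have h1 := hcK _ hmem
    rw [HHalf.kinetic_dilation] at h1
    -- The dilate lies on the manifold, so T(v)² K(v) ≥ c.
    have h2 : (fibreTime μ f v)⁻¹ ^ 2 ≤ (2 * R + 2) / c := by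
      rw [inv_pow, le_div_iff₀ hc, inv_mul_le_iff₀ (by positivity)]
      exact h1.trans (by gcongr)
    gcongr

end Admissible

end Choquard

end

theorem proposition6p1 (μ : ℝ) (hμ0 : 0 < μ) (hμ1 : μ < 1) (a : ℝ) (ha : 0 < a)
    (f : ℝ → ℝ)
    (hf1 : Continuous f ∧
      ∃ κ : ℝ, 2 - μ < κ ∧ Tendsto (fun t : ℝ => |f t| / |t| ^ κ) (𝓝[≠] 0) (𝓝 0))
    (hf2 : (∀ α : ℝ, Real.pi < α →
        Tendsto (fun t : ℝ => |f t| / Real.exp (α * t ^ 2)) (cocompact ℝ) (𝓝 0)) ∧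
      (∀ α : ℝ, 0 < α → α < Real.pi →
        Tendsto (fun t : ℝ => |f t| / Real.exp (α * t ^ 2)) (cocompact ℝ) atTop))
    (hf3 : ∃ θ : ℝ, 3 - μ < θ ∧
      ∀ t : ℝ, t ≠ 0 → 0 < θ * Choquard.prim f t ∧ θ * Choquard.prim f t ≤ t * f t)
    (hf5 :
      AntitoneOn (fun t : ℝ => (f t * t - (2 - μ) * Choquard.prim f t) / |t| ^ (3 - μ)) (Iio 0) ∧
      MonotoneOn (fun t : ℝ => (f t * t - (2 - μ) * Choquard.prim f t) / |t| ^ (3 - μ)) (Ioi 0)) :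
    IsGLB (Choquard.energy μ f '' Choquard.pohozaevManifold μ f a) (Choquard.groundLevel μ f a) ∧
    ∃ u : ℕ → Choquard.HHalf,
      (∀ n, u n ∈ Choquard.pohozaevManifold μ f a) ∧
      Choquard.IsPalaisSmaleOnSphere (Choquard.energy μ f) a (Choquard.groundLevel μ f a) u := by
  obtain ⟨C, hC, hb⟩ := Choquard.exists_exp_bound hμ1 hf1.1 hf1.2 hf2.1
  obtain ⟨θ, hθ, hAR⟩ := hf3
  have H : Choquard.Admissible μ f θ C :=
    ⟨hμ0, hμ1, hf1.1, hC, hb, hθ, hAR, hf5.1, hf5.2⟩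
  refine ⟨H.isGLB_groundLevel ha, ?_⟩
  obtain ⟨B, hB⟩ := H.exists_almost_critical ha
  choose u hu hlevel hderiv using fun n : ℕ =>
    hB (1 / ((n : ℝ) + 1)) (by positivity) ((div_le_one (by positivity)).2 (by simp))
  have hlim : Tendsto (fun n : ℕ => 1 / ((n : ℝ) + 1)) atTop (𝓝 0) :=
    tendsto_one_div_add_atTop_nhds_zero_nat
  refine ⟨u, hu, fun n => (hu n).1, fun n => H.differentiableAt_energy (u n), ?_, ?_⟩
  · have h1 := (hlim.pow 2).const_add (Choquard.groundLevel μ f a)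
    rw [zero_pow two_ne_zero, add_zero] at h1
    exact tendsto_of_tendsto_of_tendsto_of_le_of_le tendsto_const_nhds h1
      (fun n => (H.isGLB_groundLevel ha).1 (mem_image_of_mem _ (hu n))) hlevel
  · have h1 := hlim.mul_const B
    rw [zero_mul] at h1
    exact squeeze_zero (fun n => ContinuousLinearMap.opNorm_nonneg _) hderiv h1
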